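/- **Conventions.** Let $n\ge 1$. A *colored tree* with $n$ leaves is a finite rooted tree $T$ with finite edges $E(T)$, with semi-infinite edges consisting of a root edge (at the root vertex) and leaves labelled $1,\dots,n$, and with a set $V_{col}(T)$ of colored vertices such that every path from a leaf to the root contains exactly one colored vertex. It is *maximal* if its colored vertices are bivalent and all other vertices trivalent (semi-infinite edges are counted). A *stable nodal scaled marked line* is a nodal projective complex curve of genus $0$ (a tree of projective lines) with distinct non-nodal markings $z_0,\dots,z_n$ such that each component $\overline C_\alpha$ carries a translation invariant, possibly zero or infinite, form $\phi_\alpha=c_\alpha\,dz$, $c_\alpha\in\mathbb C\cup\{\infty\}$, on the affine line $\overline C_\alpha\setminus\{z_{\alpha 0}\}$; here $z_{\alpha i}$ is the marking $z_i$ if it lies on $\overline C_\alpha$, and otherwise the node of $\overline C_\alpha$ towards $z_i$. Each path from a marking $z_i$, $i\ge 1$, to the component of $z_0$ contains exactly one component with $c_\alpha\ne 0,\infty$, with zero forms before it and infinite forms after it, and each component has at least two special points if $c_\alpha\neq 0,\infty$, at least three otherwise. Its combinatorial type is the colored tree whose vertices are the components, rooted at the component of $z_0$, with colored vertices those with $c_\alpha\ne0,\infty$.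 Let $\overline M_{n,1}(\mathbb C)$ be the set of isomorphism classes, and for a colored tree $T$ let $\overline M_{n,1,\le T}(\mathbb C)$ be the subset of classes whose type is obtained from $T$ by contracting a (possibly empty) set of finite edges. The structure of a variety on these sets (Zariski topology and regular functions) is induced by the map to a product of projective lines $\mathbb P^1(\mathbb C)$ given by all the coordinates $\rho_{ijkl}$ ($i,j,k,l\in\{0,\dots,n\}$ distinct), the cross-ratio $\frac{(w_2-w_3)(w_4-w_1)}{(w_1-w_2)(w_3-w_4)}$ of $z_{\alpha i},z_{\alpha j},z_{\alpha k},z_{\alpha l}$ on a component where at least three of them are distinct, and $\rho_{ij}=\big(c_\alpha (z_{\alpha j}-z_{\alpha i})\big)^{-1}$ ($i,j\in\{1,\dots,n\}$ distinct) on the component where $z_{\alpha 0},z_{\alpha i},z_{\alpha j}$ are distinct. Let $T$ be a maximal colored tree with a planar structure, and assume (after relabelling) that it lists the leaves in the order $1,\dots,n$. For $1\le i<n$ let $v_i$ be the vertex where the paths from the leaves $i,i+1$ to the root meet; this labels each trivalent vertex exactly once. Put $x_i=z_{i+1}-z_i$ and $y=1/c$. The *simple ratio map* $\phi_T:\overline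 M_{n,1,\le T}(\mathbb C)\to\mathbb C^{E(T)}$ has the following components. For an edge $e$ from $v_i$ up (i.e. towards the root) to $v_j$, $\phi_{T,e}=x_i/x_j$, evaluated on the component where $z_0,z_j,z_{j+1}$ are distinct. For an edge from $v_i$ up (resp. down) to a colored vertex, $\phi_{T,e}=x_i/y$ (resp. $y/x_i$), evaluated on the component where $z_0,z_i,z_{i+1}$ are distinct, with value $0$ if the form there is zero (resp. infinite). For a labelling $\lambda\in\mathbb C^{E(T)}$ and a vertex $v$ above $w$ let $\pi(v,w)$ be the product of the labels on the path between them ($\pi(v,v)=1$). Let $X(T)\subset\mathbb C^{E(T)}$ be the set of *balanced labellings*: for every vertex $v$ such that no vertex on the path from $v$ to the root is colored, $\pi(v,c)$ is the same for all colored vertices $c$ below $v$. Let $X^*(T)\subset X(T)$ be the set of those $\lambda$ for which, for all $1\le i<j\le n$, $\sum_{l=i}^{j-1}\pi(v,v_l)\neq0$, where $v$ is the vertex where the paths from the leaves $i$ and $j$ to the root meet. (If $v=v_k$, the sum is $\sum_l x_l/x_k=(z_j-z_i)/x_k$.) **Theorem.** Let $T$ be a maximal colored tree with a planar structure. Then $X(T)$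 is an affine toric variety (the Zariski closure in $\mathbb C^{E(T)}$ of the image of a homomorphism of tori $(\mathbb C^*)^k\to(\mathbb C^*)^{E(T)}$ given by Laurent monomials), $X^*(T)$ is a Zariski open subset of $X(T)$, the complement of the zero set of a polynomial, and $\phi_T$ is an isomorphism of varieties of $\overline M_{n,1,\le T}(\mathbb C)$ onto $X^*(T)$: it is a bijection onto $X^*(T)$, and it and its inverse are regular maps. -/

import Mathlib

open scoped OnePoint

noncomputable section

namespace ScaledLine

/-! ### Products of projective lines over the complex numbers as algebraic varieties -/

/-- The complex projective line, `ℂ ∪ {∞}`. -/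
abbrev P1 : Type := OnePoint ℂ

/-- The point `[a : b]` of the projective line, i.e. `a / b`, meaningful for `(a, b) ≠ (0, 0)`. -/
def P1.mk (a b : ℂ) : P1 := if b = 0 then ∞ else ((a / b : ℂ) : P1)

/-- Homogeneous coordinates: `z ↦ (z, 1)` and `∞ ↦ (1, 0)`. -/
def P1.hom (w : P1) : ℂ × ℂ := w.elim (1, 0) (fun z => (z, 1))

/-- The determinant of the homogeneous coordinates of two points; it is `u - v` on `ℂ`. -/
def P1.det (u v : P1) : ℂ := u.hom.1 * v.hom.2 - u.hom.2 * v.hom.1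

/-- The cross-ratio `(w₁ - w₂) (w₃ - w₀) / ((w₀ - w₁) (w₂ - w₃))` of four points
`w₀, w₁, w₂, w₃` of the projective line at least three of which are distinct. Written in
homogeneous coordinates this includes the points at infinity and the degenerate values:
`∞` if `w₀ = w₁` or `w₂ = w₃`, `1` if `w₀ = w₂` or `w₁ = w₃`, `0` if `w₀ = w₃` or `w₁ = w₂`. -/
def P1.crossRatio (w : Fin 4 → P1) : P1 :=
  P1.mk (P1.det (w 1) (w 2) * P1.det (w 3) (w 0)) (P1.det (w 0) (w 1) * P1.det (w 2) (w 3))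

/-- The domain of the two affine charts of the projective line: the complement of `∞` for
`false`, the complement of `0` for `true`. -/
def P1.InChart (s : Bool) (w : P1) : Prop := if s then w ≠ ((0 : ℂ) : P1) else w ≠ ∞

/-- The affine coordinate in these charts: `z` for `false`, `1 / z` for `true`. -/
def P1.coord (s : Bool) (w : P1) : ℂ := w.elim 0 (fun z => if s then z⁻¹ else z)

/-- Let `X` and `Y` be identified by `ιX` and `ιY` with subsets of products of projective lines,
with the Zariski topology and the regular functions induced from there. The map `f : X → Y` is a
morphism (regular map) if each component of `ιY ∘ f` is, in a Zariski neighbourhood of each point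
contained in an affine chart, of the form `[P : Q]` for polynomials `P`, `Q` in the chart
coordinates that have no common zero there. (Any smaller principal neighbourhood `R ≠ 0` is
obtained by multiplying `P` and `Q` by `R`.) -/
def IsRegularMap {X Y I J : Type*} (ιX : X → I → P1) (ιY : Y → J → P1) (f : X → Y) : Prop :=
  ∀ (x : X) (j : J), ∃ (s : I → Bool) (P Q : MvPolynomial I ℂ),
    (∀ i, P1.InChart (s i) (ιX x i)) ∧
    ¬ (MvPolynomial.eval (fun i => P1.coord (s i) (ιX x i)) P = 0 ∧
        MvPolynomial.eval (fun i => P1.coord (s i) (ιX x i)) Q = 0) ∧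
    ∀ x' : X, (∀ i, P1.InChart (s i) (ιX x' i)) →
      ¬ (MvPolynomial.eval (fun i => P1.coord (s i) (ιX x' i)) P = 0 ∧
          MvPolynomial.eval (fun i => P1.coord (s i) (ιX x' i)) Q = 0) →
      ιY (f x') j = P1.mk (MvPolynomial.eval (fun i => P1.coord (s i) (ιX x' i)) P)
        (MvPolynomial.eval (fun i => P1.coord (s i) (ιX x' i)) Q)

/-- An affine toric variety in `ℂ^E`: the Zariski closure of the image of a homomorphism
of tori `(ℂˣ)^k → (ℂˣ)^E`, given by Laurent monomials. -/
def IsAffineToric {E : Type*} (X : Set (E → ℂ)) : Prop :=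
  ∃ (k : ℕ) (A : E → Fin k → ℤ), X = {x | ∀ p : MvPolynomial E ℂ,
    (∀ t : Fin k → ℂˣ, MvPolynomial.eval (fun e => ∏ j, ((t j ^ A e j : ℂˣ) : ℂ)) p = 0) →
      MvPolynomial.eval x p = 0}

/-! ### Rooted trees with labelled leaves -/

/-- A finite rooted tree with `m + 1` leaves (semi-infinite edges) labelled by `Fin (m + 1)`.
Every vertex other than the root is joined by a finite edge to its `parent`; `leaf i` is the vertex
to which the leaf `i` is attached. The root vertex carries the root edge, a further
semi-infinite edge. -/
structure MarkedTree (m : ℕ) where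
  V : Type
  finite : Finite V
  root : V
  parent : V → V
  parent_root : parent root = root
  reach : ∀ v, ∃ k : ℕ, parent^[k] v = root
  leaf : Fin (m + 1) → V

namespace MarkedTree

variable {m : ℕ} (T : MarkedTree m)

/-- The finite edges; a vertex `v ≠ root` stands for the edge from `v` to its parent. -/
abbrev Edge : Type := {v : T.V // v ≠ T.root}

/-- `a` lies on the path from `v` to the root (both ends included). -/
def IsAbove (a v : T.V) : Prop := ∃ k : ℕ, T.parent^[k] v = a

/-- The number of edges, finite or semi-infinite, at a vertex. -/
def valence (v : T.V) : ℕ :=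
  Nat.card {w : T.V // w ≠ T.root ∧ T.parent w = v} + Nat.card {i // T.leaf i = v} + 1

/-- The number of edges of the path from `v` up to `a`, if `a` is above `v`. -/
def dist (v a : T.V) : ℕ := sInf {k : ℕ | T.parent^[k] v = a}

/-- The vertex where the paths from the leaves `i` and `j` to the root meet. -/
def meet (i j : Fin (m + 1)) : T.V :=
  T.parent^[sInf {k : ℕ | T.IsAbove (T.parent^[k] (T.leaf i)) (T.leaf j)}] (T.leaf i)

open Classical in
/-- The product of the labels of the edges of the path from `v` up to `a`. -/
def pathProd (l : T.Edge → ℂ) (v a : T.V) : ℂ :=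
  ∏ k ∈ Finset.range (T.dist v a),
    if h : T.parent^[k] v ≠ T.root then l ⟨T.parent^[k] v, h⟩ else 1

end MarkedTree

/-- A colored tree: every path from a leaf to the root has exactly one colored vertex. -/
structure ColoredTree (m : ℕ) extends MarkedTree m where
  col : Set V
  col_unique : ∀ i, ∃! v, v ∈ col ∧ toMarkedTree.IsAbove v (leaf i)

namespace ColoredTree

variable {m : ℕ} (T : ColoredTree m)

/-- A maximal colored tree: colored vertices are bivalent, all others trivalent. -/
def IsMaximal : Prop :=
  (∀ v ∈ T.col, T.valence v = 2) ∧ ∀ v ∉ T.col, T.valence v = 3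

/-- `T'` is obtained from `T` by contracting a set of finite edges: there is a map of vertices
(`f v` is the vertex to which `v` is contracted) respecting roots, leaves and
colored vertices, which contracts each edge or maps it to an edge, and which is bijective from the
edges that are not contracted to the edges of `T'`. -/
def ContractsTo (T T' : ColoredTree m) : Prop :=
  ∃ f : T.V → T'.V, Function.Surjective f ∧ f T.root = T'.root ∧
    (∀ i, f (T.leaf i) = T'.leaf i) ∧
    (∀ v, v ≠ T.root → f v = f (T.parent v) ∨
      (f v ≠ T'.root ∧ T'.parent (f v) = f (T.parent v))) ∧
    (∀ v w, v ≠ T.root → w ≠ T.root → f v ≠ f (T.parent v) → f w ≠ f (T.parent w) →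
      f v = f w → v = w) ∧
    T'.col = f '' T.col

/-- A planar structure, encoded by the order `σ 0, σ 1, …, σ m` in which it lists the leaves:
the leaves behind each vertex are consecutive. -/
def IsPlanar (σ : Equiv.Perm (Fin (m + 1))) : Prop :=
  ∀ v, {k | T.IsAbove v (T.leaf (σ k))}.OrdConnected

/-- The vertex where the paths of two consecutive leaves to the root meet. -/
def gapVertex (σ : Equiv.Perm (Fin (m + 1))) (i : Fin m) : T.V :=
  T.meet (σ i.castSucc) (σ i.succ)

/-- The balanced labellings `X(T)`: for each vertex on the root side of the colored vertices,
the product of the labels along the path to a colored vertex lying behind it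
does not depend on the colored vertex. -/
def balanced : Set (T.Edge → ℂ) :=
  {l | ∀ v, (∀ a, T.IsAbove a v → a ∉ T.col) →
    ∀ c ∈ T.col, ∀ c' ∈ T.col, T.IsAbove v c → T.IsAbove v c' →
      T.pathProd l c v = T.pathProd l c' v}

/-- `X*(T)`: the balanced labellings for which no two leaves get the same position. With
`x i = z (i+1) - z i` the product of labels from the vertex of the gap `p` up to the
vertex of the gap `k` is `x p / x k`; so for leaves `i < j` in the planar order, whose paths
meet at the vertex of the gap `k`, the sum below is `(z j - z i) / x k`. -/
def balancedStar (σ : Equiv.Perm (Fin (m + 1))) : Set (T.Edge → ℂ) :=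
  {l | l ∈ T.balanced ∧ ∀ i j : Fin (m + 1), i < j →
    ∑ p : Fin m with i ≤ p.castSucc ∧ p.castSucc < j,
      T.pathProd l (T.gapVertex σ p) (T.meet (σ i) (σ j)) ≠ 0}

end ColoredTree

/-! ### Stable nodal scaled marked lines -/

/-- A stable nodal scaled line with markings `z_0` and `mark i`, `i : Fin (m + 1)`: a tree of
projective lines, one for each vertex `v`, with the coordinate chosen such that
the point `z_{v0}` (the marking `z_0` for the root, otherwise the node towards the root) is `∞`;
the complement of that point is the affine line `ℂ`. For `v ≠ root` the component of `v` is
attached to the point `node v` of the component of its parent (`node root` has no meaning).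
The component of `v` carries the translation invariant, possibly
zero or infinite, form `form v • dz`. -/
structure Curve (m : ℕ) extends MarkedTree m where
  node : V → ℂ
  mark : Fin (m + 1) → ℂ
  form : V → OnePoint ℂ
  node_inj : ∀ v w, v ≠ root → w ≠ root → parent v = parent w → node v = node w → v = w
  mark_inj : ∀ i j, leaf i = leaf j → mark i = mark j → i = j
  node_ne_mark : ∀ v i, v ≠ root → parent v = leaf i → node v ≠ mark i
  /-- Beyond a component with nonzero form, towards the root, the forms are infinite. -/
  form_parent : ∀ v, v ≠ root → form v ≠ ((0 : ℂ) : OnePoint ℂ) → form (parent v) = ∞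
  /-- Each path from a marking to the root has exactly one component with nondegenerate form. -/
  form_unique : ∀ i, ∃! v, (form v ≠ ((0 : ℂ) : OnePoint ℂ) ∧ form v ≠ ∞) ∧
    toMarkedTree.IsAbove v (leaf i)
  stable : ∀ v, (form v ≠ ((0 : ℂ) : OnePoint ℂ) ∧ form v ≠ ∞ → 2 ≤ toMarkedTree.valence v) ∧
    (form v = ((0 : ℂ) : OnePoint ℂ) ∨ form v = ∞ → 3 ≤ toMarkedTree.valence v)

namespace Curve

variable {m : ℕ} (S : Curve m)

/-- The combinatorial type; colored vertices are the components with nondegenerate form. -/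
def type : ColoredTree m where
  toMarkedTree := S.toMarkedTree
  col := {v | S.form v ≠ ((0 : ℂ) : OnePoint ℂ) ∧ S.form v ≠ ∞}
  col_unique := S.form_unique

/-- For a component `v` on the path from the marking `i` to the root, the special point `z_{vi}`:
the marking, or the node towards it. -/
def pos (v : S.V) (i : Fin (m + 1)) : ℂ :=
  if S.dist (S.leaf i) v = 0 then S.mark i
  else S.node (S.parent^[S.dist (S.leaf i) v - 1] (S.leaf i))

open Classical in
/-- The special point `z_{vi}` in the projective line, where `none` is the index of the marking
`z_0`: it is the point at infinity if the marking lies in the direction of the root. -/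
def point (v : S.V) : Option (Fin (m + 1)) → P1
  | none => ∞
  | some i => if S.IsAbove v (S.leaf i) then (S.pos v i : P1) else ∞

/-- The points `z_{v0}`, `z_{vi}`, `z_{vj}` are distinct. -/
def Separates (v : S.V) (i j : Fin (m + 1)) : Prop :=
  S.IsAbove v (S.leaf i) ∧ S.IsAbove v (S.leaf j) ∧ S.pos v i ≠ S.pos v j

/-- At least three of four points are distinct. -/
def ThreeDistinct (w : Fin 4 → P1) : Prop :=
  ∃ a b c, w a ≠ w b ∧ w a ≠ w c ∧ w b ≠ w c

/-- The cross-ratio `ρ_{ijkl}` of four markings, evaluated at any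
component on which at least three of the corresponding special points are distinct. -/
def rho4 (q : Fin 4 ↪ Option (Fin (m + 1))) : P1 :=
  Classical.epsilon fun w => ∃ v, ThreeDistinct (fun a => S.point v (q a)) ∧
    w = P1.crossRatio (fun a => S.point v (q a))

/-- The coordinate `ρ_{ij} = (φ(1) (z_j - z_i))⁻¹`, evaluated at the component where `z_0`, `z_i`,
`z_j` are distinct; it is `0` for an infinite form, and `∞` for the form zero. -/
def rho2 (p : Fin 2 ↪ Fin (m + 1)) : P1 :=
  Classical.epsilon fun w => ∃ v, S.Separates v (p 0) (p 1) ∧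
    w = (S.form v).elim ((0 : ℂ) : P1) (fun c => P1.mk 1 (c * (S.pos v (p 1) - S.pos v (p 0))))

/-- All cross-ratio coordinates together. -/
def rho : (Fin 4 ↪ Option (Fin (m + 1))) ⊕ (Fin 2 ↪ Fin (m + 1)) → P1 :=
  Sum.elim S.rho4 S.rho2

/-- `x_i = z_{i+1} - z_i` on the component `v`, for the markings in the order given by `σ`. -/
def gap (σ : Equiv.Perm (Fin (m + 1))) (v : S.V) (i : Fin m) : ℂ :=
  S.pos v (σ i.succ) - S.pos v (σ i.castSucc)

/-- The simple ratios. For an edge `e` of `T` between the vertices `v_i` (below) and `v_j` (above,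
i.e. closer to the root) of two gaps, the ratio is `x_i / x_j`, evaluated at the component of `S`
separating the markings of the gap `j` (those of the gap `i` then lie behind it). For the edge from the vertex `v_i` to a colored vertex above
(below) it the ratio is `x_i / y` (`y / x_i`), where `y = 1 / φ(1)`, evaluated at the component
separating the markings of the gap `i`; it is `0` if the form there is zero (infinite). -/
def IsSimpleRatio (T : ColoredTree m) (σ : Equiv.Perm (Fin (m + 1))) (e : T.Edge) (w : ℂ) : Prop :=
  (e.1 ∉ T.col ∧ T.parent e.1 ∉ T.col ∧ ∃ i j v, T.gapVertex σ i = e.1 ∧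
    T.gapVertex σ j = T.parent e.1 ∧ S.Separates v (σ j.castSucc) (σ j.succ) ∧
    S.IsAbove v (S.leaf (σ i.castSucc)) ∧ S.IsAbove v (S.leaf (σ i.succ)) ∧
    w = S.gap σ v i / S.gap σ v j) ∨
  (e.1 ∉ T.col ∧ T.parent e.1 ∈ T.col ∧ ∃ i v, T.gapVertex σ i = e.1 ∧
    S.Separates v (σ i.castSucc) (σ i.succ) ∧
    w = (S.form v).elim 0 (fun c => c * S.gap σ v i)) ∨
  (e.1 ∈ T.col ∧ T.parent e.1 ∉ T.col ∧ ∃ i v, T.gapVertex σ i = T.parent e.1 ∧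
    S.Separates v (σ i.castSucc) (σ i.succ) ∧
    w = (S.form v).elim 0 (fun c => (c * S.gap σ v i)⁻¹))

/-- The simple ratio map on curves. -/
def simpleRatio (T : ColoredTree m) (σ : Equiv.Perm (Fin (m + 1))) (e : T.Edge) : ℂ :=
  Classical.epsilon (S.IsSimpleRatio T σ e)

/-- An isomorphism: an isomorphism `ψ` of the trees, and on each component an affine
isomorphism `z ↦ a v * z + b v` that preserves nodes, markings and forms. -/
structure Iso (S S' : Curve m) where
  ψ : S.V ≃ S'.V
  a : S.V → ℂ
  b : S.V → ℂ
  a_ne : ∀ v, a v ≠ 0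
  root : ψ S.root = S'.root
  parent : ∀ v, S'.parent (ψ v) = ψ (S.parent v)
  leaf : ∀ i, S'.leaf i = ψ (S.leaf i)
  node : ∀ v, v ≠ S.root → S'.node (ψ v) = a (S.parent v) * S.node v + b (S.parent v)
  mark : ∀ i, S'.mark i = a (S.leaf i) * S.mark i + b (S.leaf i)
  form : ∀ v, S'.form (ψ v) = (S.form v).map (fun c => c / a v)

instance setoid (m : ℕ) : Setoid (Curve m) where
  r S S' := Nonempty (Iso S S')
  iseqv := by
    refine ⟨fun S => ⟨⟨Equiv.refl _, fun _ => 1, fun _ => 0, by simp, rfl, fun _ => rfl,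
      fun _ => rfl, by simp, by simp, ?_⟩⟩, ?_, ?_⟩
    · intro v
      induction h : S.form v using OnePoint.rec <;> simp [h]
    · rintro S S' ⟨f⟩
      have hp : ∀ v, S.parent (f.ψ.symm v) = f.ψ.symm (S'.parent v) := by
        intro v
        rw [Equiv.eq_symm_apply, ← f.parent, Equiv.apply_symm_apply]
      refine ⟨⟨f.ψ.symm, fun v => (f.a (f.ψ.symm v))⁻¹,
        fun v => - f.b (f.ψ.symm v) / f.a (f.ψ.symm v), fun v => inv_ne_zero (f.a_ne _),
        ?_, hp, ?_, ?_, ?_, ?_⟩⟩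
      · rw [← f.root, Equiv.symm_apply_apply]
      · intro i; rw [f.leaf, Equiv.symm_apply_apply]
      · intro v hv
        have h1 : f.ψ.symm v ≠ S.root := by
          intro h; apply hv; rw [← f.root, ← h, Equiv.apply_symm_apply]
        have h2 := f.node _ h1
        rw [Equiv.apply_symm_apply, hp] at h2
        have := f.a_ne (f.ψ.symm (S'.parent v))
        rw [h2]; field_simp; ring
      · intro i
        have := f.a_ne (S.leaf i)
        rw [f.leaf, f.mark, Equiv.symm_apply_apply]; field_simp; ring
      · intro v
        have h := f.form (f.ψ.symm v)
        rw [Equiv.apply_symm_apply] at h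
        rw [h]
        have := f.a_ne (f.ψ.symm v)
        induction h : S.form (f.ψ.symm v) using OnePoint.rec with
        | infty => simp
        | coe c => simp only [OnePoint.map_some]; congr 1; field_simp
    · rintro S S' S'' ⟨f⟩ ⟨g⟩
      refine ⟨⟨f.ψ.trans g.ψ, fun v => g.a (f.ψ v) * f.a v,
        fun v => g.a (f.ψ v) * f.b v + g.b (f.ψ v), fun v => mul_ne_zero (g.a_ne _) (f.a_ne _),
        by simp [f.root, g.root], by simp [f.parent, g.parent], by simp [f.leaf, g.leaf],
        ?_, ?_, ?_⟩⟩
      · intro v hv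
        have h1 : f.ψ v ≠ S'.root := by rw [← f.root]; simpa using hv
        rw [Equiv.trans_apply, g.node _ h1, f.parent, f.node _ hv]; ring
      · intro i
        rw [g.mark, f.mark, f.leaf]; ring
      · intro v
        rw [Equiv.trans_apply, g.form, f.form]
        induction h : S.form v using OnePoint.rec with
        | infty => simp
        | coe c => simp only [OnePoint.map_some]; congr 1; rw [div_div, mul_comm]

namespace Iso

variable {m : ℕ} {S S' : Curve m}

theorem iterate (f : Iso S S') (k : ℕ) (v : S.V) :
    S'.parent^[k] (f.ψ v) = f.ψ (S.parent^[k] v) := by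
  induction k generalizing v with
  | zero => rfl
  | succ k ih => rw [Function.iterate_succ_apply, f.parent, ih, Function.iterate_succ_apply]

theorem isAbove (f : Iso S S') (a v : S.V) : S'.IsAbove (f.ψ a) (f.ψ v) ↔ S.IsAbove a v := by
  simp [MarkedTree.IsAbove, f.iterate]

theorem dist (f : Iso S S') (v a : S.V) : S'.dist (f.ψ v) (f.ψ a) = S.dist v a := by
  simp [MarkedTree.dist, f.iterate]

theorem pos (f : Iso S S') (v : S.V) (i : Fin (m + 1)) (h : S.IsAbove v (S.leaf i)) :
    S'.pos (f.ψ v) i = f.a v * S.pos v i + f.b v := by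
  have hk : S.parent^[S.dist (S.leaf i) v] (S.leaf i) = v :=
    Nat.sInf_mem (s := {k : ℕ | S.parent^[k] (S.leaf i) = v}) h
  unfold Curve.pos
  rw [f.leaf, f.dist]
  split_ifs with h0
  · rw [h0] at hk
    rw [f.mark, ← hk]; rfl
  · obtain ⟨d, hd⟩ := Nat.exists_eq_succ_of_ne_zero h0
    rw [hd, Function.iterate_succ_apply'] at hk
    rw [hd, Nat.succ_sub_one, f.iterate, f.node, hk]
    intro hr
    rw [hr, S.parent_root] at hk
    have hle : S.dist (S.leaf i) v ≤ d :=
      Nat.sInf_le (s := {k : ℕ | S.parent^[k] (S.leaf i) = v}) (hr.trans hk)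
    omega

theorem point (f : Iso S S') (v : S.V) (q : Option (Fin (m + 1))) :
    S'.point (f.ψ v) q = (S.point v q).map (fun z => f.a v * z + f.b v) := by
  cases q with
  | none => rfl
  | some i =>
    have h := f.isAbove v (S.leaf i)
    rw [← f.leaf] at h
    by_cases hv : S.IsAbove v (S.leaf i)
    · simp [Curve.point, h, hv, f.pos v i hv]
    · simp [Curve.point, h, hv]

theorem separates (f : Iso S S') (v : S.V) (i j : Fin (m + 1)) :
    S'.Separates (f.ψ v) i j ↔ S.Separates v i j := by
  unfold Curve.Separates
  rw [f.leaf, f.leaf, f.isAbove, f.isAbove]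
  refine and_congr_right fun hi => and_congr_right fun hj => ?_
  rw [f.pos v i hi, f.pos v j hj]
  simp [f.a_ne v]

theorem map_injective {a : ℂ} (ha : a ≠ 0) (b : ℂ) :
    Function.Injective (OnePoint.map (fun z : ℂ => a * z + b)) := by
  apply Option.map_injective
  intro x y h
  simpa [ha] using h

theorem det_map {a : ℂ} (ha : a ≠ 0) (b : ℂ) : ∃ s : P1 → ℂ, (∀ w, s w ≠ 0) ∧ ∀ u v : P1,
    P1.det (u.map (fun z => a * z + b)) (v.map (fun z => a * z + b)) =
      s u * s v * P1.det u v := by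
  obtain ⟨r, hr⟩ := IsAlgClosed.exists_pow_nat_eq a (n := 2) two_pos
  have hr0 : r ≠ 0 := by rintro rfl; apply ha; rw [← hr]; simp
  refine ⟨fun w => w.elim r⁻¹ (fun _ => r), ?_, ?_⟩
  · intro w
    induction w using OnePoint.rec <;> simp [hr0]
  · intro u v
    induction u using OnePoint.rec <;> induction v using OnePoint.rec <;>
      (simp [P1.det, P1.hom, hr0, ← hr]; try ring)

theorem crossRatio_map {a : ℂ} (ha : a ≠ 0) (b : ℂ) (w : Fin 4 → P1) :
    P1.crossRatio (fun i => (w i).map (fun z => a * z + b)) = P1.crossRatio w := by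
  obtain ⟨s, hs, h⟩ := det_map ha b
  have h0 := hs (w 0)
  have h1 := hs (w 1)
  have h2 := hs (w 2)
  have h3 := hs (w 3)
  simp only [P1.crossRatio, h, P1.mk]
  by_cases hd : P1.det (w 0) (w 1) * P1.det (w 2) (w 3) = 0
  · rw [if_pos hd, if_pos]
    linear_combination s (w 0) * s (w 1) * s (w 2) * s (w 3) * hd
  · rw [if_neg hd, if_neg]
    · congr 1
      have := left_ne_zero_of_mul hd
      have := right_ne_zero_of_mul hd
      field_simp
    · have := left_ne_zero_of_mul hd
      have := right_ne_zero_of_mul hd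
      simp_all

theorem rho4 (f : Iso S S') (q : Fin 4 ↪ Option (Fin (m + 1))) : S.rho4 q = S'.rho4 q := by
  unfold Curve.rho4
  congr 1
  funext w
  rw [f.ψ.surjective.exists]
  simp only [f.point, ThreeDistinct, (map_injective (f.a_ne _) _).ne_iff,
    crossRatio_map (f.a_ne _)]

theorem rho2 (f : Iso S S') (p : Fin 2 ↪ Fin (m + 1)) : S.rho2 p = S'.rho2 p := by
  unfold Curve.rho2
  congr 1
  funext w
  rw [f.ψ.surjective.exists]
  refine propext (exists_congr fun v => ?_)
  rw [f.separates]
  refine and_congr_right fun h => ?_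
  rw [f.pos v _ h.1, f.pos v _ h.2.1, f.form]
  have := f.a_ne v
  induction hc : S.form v using OnePoint.rec with
  | infty => simp
  | coe c =>
    simp only [OnePoint.map_some, OnePoint.elim_some]
    have e : c / f.a v * (f.a v * S.pos v (p 1) + f.b v - (f.a v * S.pos v (p 0) + f.b v)) =
      c * (S.pos v (p 1) - S.pos v (p 0)) := by field_simp; ring
    rw [e]

theorem rho (f : Iso S S') : S.rho = S'.rho := by
  unfold Curve.rho
  rw [funext f.rho4, funext f.rho2]

theorem gap (f : Iso S S') (σ : Equiv.Perm (Fin (m + 1))) (v : S.V) (i : Fin m)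
    (h : S.IsAbove v (S.leaf (σ i.castSucc))) (h' : S.IsAbove v (S.leaf (σ i.succ))) :
    S'.gap σ (f.ψ v) i = f.a v * S.gap σ v i := by
  unfold Curve.gap
  rw [f.pos v _ h, f.pos v _ h']
  ring

theorem simpleRatio (f : Iso S S') (T : ColoredTree m) (σ : Equiv.Perm (Fin (m + 1))) :
    S.simpleRatio T σ = S'.simpleRatio T σ := by
  funext e
  unfold Curve.simpleRatio
  congr 1
  funext w
  unfold Curve.IsSimpleRatio
  simp only [f.ψ.surjective.exists, f.separates]
  refine propext (or_congr ?_ (or_congr ?_ ?_)) <;>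
    refine and_congr_right fun _ => and_congr_right fun _ => ?_
  · refine exists_congr fun i => exists_congr fun j => exists_congr fun v =>
      and_congr_right fun _ => and_congr_right fun _ => and_congr_right fun hj => ?_
    rw [f.leaf, f.leaf, f.isAbove, f.isAbove]
    refine and_congr_right fun h => and_congr_right fun h' => ?_
    rw [f.gap σ v i h h', f.gap σ v j hj.1 hj.2.1, mul_div_mul_left _ _ (f.a_ne v)]
  · refine exists_congr fun i => exists_congr fun v =>
      and_congr_right fun _ => and_congr_right fun hj => ?_
    rw [f.gap σ v i hj.1 hj.2.1, f.form]
    have := f.a_ne v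
    induction hc : S.form v using OnePoint.rec with
    | infty => simp
    | coe c =>
      simp only [OnePoint.map_some, OnePoint.elim_some]
      rw [← mul_assoc, div_mul_cancel₀ _ this]
  · refine exists_congr fun i => exists_congr fun v =>
      and_congr_right fun _ => and_congr_right fun hj => ?_
    rw [f.gap σ v i hj.1 hj.2.1, f.form]
    have := f.a_ne v
    induction hc : S.form v using OnePoint.rec with
    | infty => simp
    | coe c =>
      simp only [OnePoint.map_some, OnePoint.elim_some]
      rw [← mul_assoc, div_mul_cancel₀ _ this]

end Iso

end Curve

/-! ### The moduli space -/

/-- The moduli space of isomorphism classes of stable nodal scaled lines with markings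
`z_0` and `z_i`, `i : Fin (m + 1)`. -/
def Moduli (m : ℕ) : Type 1 := Quotient (Curve.setoid m)

namespace Moduli

variable {m : ℕ}

/-- The map to a product of projective lines given by all cross-ratios; it
defines the structure of a variety on the moduli space and its subsets. -/
def rho (C : Moduli m) : (Fin 4 ↪ Option (Fin (m + 1))) ⊕ (Fin 2 ↪ Fin (m + 1)) → P1 :=
  Quotient.lift Curve.rho (fun _ _ h => Nonempty.elim h fun f => f.rho) C

/-- The simple ratio map. -/
def simpleRatio (T : ColoredTree m) (σ : Equiv.Perm (Fin (m + 1))) (C : Moduli m) :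
    T.Edge → ℂ :=
  Quotient.lift (fun S : Curve m => S.simpleRatio T σ) (fun _ _ h => Nonempty.elim h fun f => f.simpleRatio T σ) C

/-- The classes of the curves whose combinatorial type is `T` or
is obtained from `T` by contracting finite edges. -/
def below (T : ColoredTree m) : Set (Moduli m) :=
  {C | ∃ S : Curve m, Quotient.mk (Curve.setoid m) S = C ∧ T.ContractsTo S.type}

end Moduli

end ScaledLine

end

/-! Let `f` contract `T` to the type of a curve `S`. Give every vertex `v` of `T` a size: the length
of its gap on the component `f v` if `v` is trivalent, and `1 / φ(1)` there if `v` is colored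
(`IsContraction.scale`). Sizes are nonzero. The simple ratio of an edge is the quotient of the sizes
at its two ends if `f` contracts the edge; otherwise it is zero, because the gap collapses into a
node or the form degenerates (`isSimpleRatio_iff`). Hence the zeros of the labelling record the
surviving edges, and products along paths telescope (`pathProd_eq`). Summing gaps in the planar
order shows that on each component the labels determine the special points and the form up to an
affine change of coordinate (`pos_sub`, `form_above`, `form_below`). So the labels determine the
curve (`IsContraction.iso`). They are balanced because the one form on a component can be read off
from any colored vertex behind it, and the open condition holds because two markings are distinct
points on the component where their paths meet (`simpleRatio_mem`).

Conversely, a labelling in `X*(T)` yields a curve: contract the edges with nonzero label, and on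
each remaining component place the leaves at the partial sums `lpos` of path products, with the form
`lform`. Balance makes the form well defined, a zero label sends all leaves behind that edge to one
node, and the nonvanishing sums keep special points distinct (`curve`, `curve_simpleRatio`).

The map and its inverse are regular by explicit formulas. A ratio of gaps is up to sign a
cross-ratio with `z_0`, or a product of two, all finite on the whole domain; a ratio at a colored
vertex is a `ρ_{ij}` or its inverse (`exists_simpleRatio_poly`). In the other direction, special
points have homogeneous coordinates that are polynomials in the labels (`pointPoly`), so a
cross-ratio is a quotient of polynomials wherever three chosen points stay distinct
(`exists_rho4_poly`, `exists_rho2_poly`).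

For the toric statement, a nowhere zero labelling is balanced exactly if it consists of quotients of
nonzero numbers attached to the vertices, with one common number at the colored ones; these
labellings form the image of a torus. Balance is a system of polynomial equations, so what remains
is density: every balanced labelling is a limit of nowhere zero ones (`IsMaximal.exists_approx`).
The approximation is built from the leaves towards the root, using that multiplication of complex
numbers is open. -/

namespace ScaledLine

/-! ### Rooted trees -/

namespace MarkedTree

variable {m : ℕ} {T : MarkedTree m}

theorem IsAbove.refl (v : T.V) : T.IsAbove v v := ⟨0, rfl⟩

theorem IsAbove.trans {a b c : T.V} (h : T.IsAbove a b) (h' : T.IsAbove b c) : T.IsAbove a c := by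
  obtain ⟨k, rfl⟩ := h
  obtain ⟨j, rfl⟩ := h'
  exact ⟨k + j, Function.iterate_add_apply _ _ _ _⟩

theorem isAbove_root (v : T.V) : T.IsAbove T.root v := T.reach v

theorem isAbove_parent (v : T.V) : T.IsAbove (T.parent v) v := ⟨1, rfl⟩

theorem iterate_parent_root (k : ℕ) : T.parent^[k] T.root = T.root :=
  Function.iterate_fixed T.parent_root k

/-- Every orbit of `parent` ends in the fixed point `root`, so a periodic vertex is the root. This
acyclicity makes `IsAbove` a partial order. -/
theorem eq_root_of_iterate {v : T.V} {k : ℕ} (hk : k ≠ 0) (h : T.parent^[k] v = v) :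
    v = T.root := by
  obtain ⟨K, hK⟩ := T.reach v
  have h1 : ∀ N, T.parent^[k * N] v = v := fun N => by
    rw [Function.iterate_mul]
    exact Function.iterate_fixed h N
  have h2 : K ≤ k * K := Nat.le_mul_of_pos_left K (Nat.pos_of_ne_zero hk)
  obtain ⟨d, hd⟩ := Nat.exists_eq_add_of_le' h2
  rw [← h1 K, hd, Function.iterate_add_apply, hK, iterate_parent_root]

theorem IsAbove.antisymm {a b : T.V} (h : T.IsAbove a b) (h' : T.IsAbove b a) : a = b := by
  obtain ⟨k, hk⟩ := h
  obtain ⟨j, hj⟩ := h'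
  by_cases h0 : j + k = 0
  · obtain ⟨rfl, rfl⟩ : j = 0 ∧ k = 0 := by omega
    exact hk.symm
  · have : b = T.root := eq_root_of_iterate h0 (by rw [Function.iterate_add_apply, hk, hj])
    rw [← hk, this, iterate_parent_root]

theorem IsAbove.total {a b v : T.V} (h : T.IsAbove a v) (h' : T.IsAbove b v) :
    T.IsAbove a b ∨ T.IsAbove b a := by
  obtain ⟨k, rfl⟩ := h
  obtain ⟨j, rfl⟩ := h'
  rcases le_total j k with hjk | hjk
  · obtain ⟨d, rfl⟩ := Nat.exists_eq_add_of_le' hjk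
    exact Or.inl ⟨d, (Function.iterate_add_apply _ _ _ _).symm⟩
  · obtain ⟨d, rfl⟩ := Nat.exists_eq_add_of_le' hjk
    exact Or.inr ⟨d, (Function.iterate_add_apply _ _ _ _).symm⟩

theorem IsAbove.eq_or_parent {a v : T.V} (h : T.IsAbove a v) :
    v = a ∨ (v ≠ T.root ∧ T.IsAbove a (T.parent v)) := by
  obtain ⟨k, hk⟩ := h
  by_cases hv : v = T.root
  · left
    rw [← hk, hv, iterate_parent_root]
  · cases k with
    | zero => exact Or.inl hk
    | succ k => exact Or.inr ⟨hv, k, hk⟩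

theorem IsAbove.parent {a v : T.V} (h : T.IsAbove a v) (hne : v ≠ a) :
    T.IsAbove a (T.parent v) := (h.eq_or_parent.resolve_left hne).2

theorem IsAbove.ne_root {a v : T.V} (h : T.IsAbove a v) (hne : v ≠ a) :
    v ≠ T.root := (h.eq_or_parent.resolve_left hne).1

theorem parent_ne {v : T.V} (hv : v ≠ T.root) : T.parent v ≠ v := fun h =>
  hv (eq_root_of_iterate one_ne_zero h)

theorem not_isAbove_parent {v : T.V} (hv : v ≠ T.root) : ¬ T.IsAbove v (T.parent v) := fun h =>
  parent_ne hv (h.antisymm (isAbove_parent v)).symm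

/-- Induction up the path from `v` to `a`. -/
theorem IsAbove.rec_parent {a : T.V} {P : T.V → Prop} (base : P a)
    (step : ∀ v, v ≠ T.root → v ≠ a → T.IsAbove a (T.parent v) → P (T.parent v) → P v)
    {v : T.V} (h : T.IsAbove a v) : P v := by
  obtain ⟨k, hk⟩ := h
  induction k generalizing v with
  | zero =>
    obtain rfl : v = a := hk
    exact base
  | succ k ih =>
    by_cases hv : v = a
    · exact hv ▸ base
    · have h1 : T.IsAbove a v := ⟨k + 1, hk⟩
      exact step v (h1.ne_root hv) hv (h1.parent hv) (ih hk)

/-- The vertex below `a` on the path from `v` to `a`. -/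
theorem IsAbove.exists_child {a v : T.V} (h : T.IsAbove a v) (hne : v ≠ a) :
    ∃ w, w ≠ T.root ∧ T.parent w = a ∧ T.IsAbove w v := by
  have : v = a ∨ ∃ w, w ≠ T.root ∧ T.parent w = a ∧ T.IsAbove w v := by
    refine IsAbove.rec_parent (P := fun v => v = a ∨ ∃ w, w ≠ T.root ∧ T.parent w = a ∧
      T.IsAbove w v) (Or.inl rfl) (fun v hr _ _ ih => Or.inr ?_) h
    rcases ih with ih | ⟨w, h1, h2, h3⟩
    · exact ⟨v, hr, ih, .refl v⟩
    · exact ⟨w, h1, h2, h3.trans (isAbove_parent v)⟩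
  exact this.resolve_left hne

theorem isAbove_dist {a v : T.V} (h : T.IsAbove a v) : T.parent^[T.dist v a] v = a :=
  Nat.sInf_mem (s := {k : ℕ | T.parent^[k] v = a}) h

theorem dist_self (v : T.V) : T.dist v v = 0 := by
  have : T.dist v v ≤ 0 := Nat.sInf_le (s := {k : ℕ | T.parent^[k] v = v}) rfl
  omega

theorem dist_parent {a v : T.V} (h : T.IsAbove a v) (hne : v ≠ a) :
    T.dist v a = T.dist (T.parent v) a + 1 := by
  have h1 := isAbove_dist h
  have h2 := isAbove_dist (h.parent hne)
  have h3 : T.dist v a ≤ T.dist (T.parent v) a + 1 :=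
    Nat.sInf_le (s := {k : ℕ | T.parent^[k] v = a}) h2
  cases hd : T.dist v a with
  | zero => rw [hd] at h1; exact absurd h1 hne
  | succ d =>
    rw [hd] at h1
    have : T.dist (T.parent v) a ≤ d :=
      Nat.sInf_le (s := {k : ℕ | T.parent^[k] (T.parent v) = a}) h1
    omega

/-! Products of labels along paths -/

open Classical in
/-- The label of the edge from `v` to its parent, with the value `0` for the root. -/
noncomputable def label (l : T.Edge → ℂ) (v : T.V) : ℂ := if h : v ≠ T.root then l ⟨v, h⟩ else 0

theorem label_edge (l : T.Edge → ℂ) (e : T.Edge) : label l e.1 = l e := dif_pos e.2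

/-- The default value lets the root count as the lower end of an uncontracted edge, so that it
survives contraction of the nonzero labels. -/
theorem label_root (l : T.Edge → ℂ) : label l T.root = 0 := dif_neg (by simp)

theorem pathProd_self (l : T.Edge → ℂ) (v : T.V) : T.pathProd l v v = 1 := by
  simp [pathProd, dist_self]

theorem pathProd_parent (l : T.Edge → ℂ) {a v : T.V} (h : T.IsAbove a v) (hne : v ≠ a) :
    T.pathProd l v a = label l v * T.pathProd l (T.parent v) a := by
  have hr := h.ne_root hne
  rw [pathProd, dist_parent h hne, Finset.prod_range_succ', mul_comm]
  congr 1
  simp [label, hr]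

theorem pathProd_mul (l : T.Edge → ℂ) {a b v : T.V} (h : T.IsAbove a v) (h' : T.IsAbove b a) :
    T.pathProd l v a * T.pathProd l a b = T.pathProd l v b := by
  refine IsAbove.rec_parent (P := fun v => T.pathProd l v a * T.pathProd l a b = T.pathProd l v b)
    ?_ (fun v hr hne hav ih => ?_) h
  · rw [pathProd_self, one_mul]
  · have hav' : T.IsAbove a v := hav.trans (isAbove_parent v)
    have hvb : v ≠ b := by
      rintro rfl
      exact hne (h'.antisymm hav')
    rw [pathProd_parent l hav' hne, pathProd_parent l (h'.trans hav') hvb, mul_assoc, ih]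

theorem pathProd_child (l : T.Edge → ℂ) {v w : T.V} (hw : w ≠ T.root) (h : T.IsAbove w v) :
    T.pathProd l v (T.parent w) = T.pathProd l v w * label l w := by
  rw [← pathProd_mul l h (isAbove_parent w),
    pathProd_parent l (isAbove_parent w) (parent_ne hw).symm, pathProd_self, mul_one]

theorem pathProd_congr {l l' : T.Edge → ℂ} {a v : T.V} (h : T.IsAbove a v)
    (hl : ∀ w, T.IsAbove w v → T.IsAbove a w → w ≠ a → label l w = label l' w) :
    T.pathProd l v a = T.pathProd l' v a := by
  revert hl
  refine IsAbove.rec_parent (P := fun v => (∀ w, T.IsAbove w v → T.IsAbove a w → w ≠ a →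
    label l w = label l' w) → T.pathProd l v a = T.pathProd l' v a)
    (fun _ => by rw [pathProd_self, pathProd_self]) (fun v hr hne hav ih hl => ?_) h
  have hav' : T.IsAbove a v := hav.trans (isAbove_parent v)
  rw [pathProd_parent l hav' hne, pathProd_parent l' hav' hne, hl v (.refl v) hav' hne,
    ih fun w h1 h2 h3 => hl w (h1.trans (isAbove_parent v)) h2 h3]

theorem pathProd_ne_zero_iff (l : T.Edge → ℂ) {a v : T.V} (h : T.IsAbove a v) :
    T.pathProd l v a ≠ 0 ↔ ∀ w, T.IsAbove w v → T.IsAbove a w → w ≠ a → label l w ≠ 0 := by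
  refine IsAbove.rec_parent (P := fun v => T.pathProd l v a ≠ 0 ↔
    ∀ w, T.IsAbove w v → T.IsAbove a w → w ≠ a → label l w ≠ 0) ?_ (fun v hr hne hav ih => ?_) h
  · rw [pathProd_self]
    exact ⟨fun _ w h1 h2 h3 => absurd (h1.antisymm h2) h3, fun _ => one_ne_zero⟩
  · have hav' : T.IsAbove a v := hav.trans (isAbove_parent v)
    rw [pathProd_parent l hav' hne, mul_ne_zero_iff, ih]
    constructor
    · rintro ⟨h1, h2⟩ w hw haw hwa
      by_cases hvw : v = w
      · exact hvw ▸ h1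
      · exact h2 w (hw.parent hvw) haw hwa
    · exact fun h => ⟨h v (.refl v) hav' hne,
        fun w h1 h2 h3 => h w (h1.trans (isAbove_parent v)) h2 h3⟩

theorem exists_pathProd_poly (v a : T.V) :
    ∃ P : MvPolynomial T.Edge ℂ, ∀ l, MvPolynomial.eval l P = T.pathProd l v a := by
  classical
  refine ⟨∏ k ∈ Finset.range (T.dist v a),
    if h : T.parent^[k] v ≠ T.root then MvPolynomial.X ⟨T.parent^[k] v, h⟩ else 1, fun l => ?_⟩
  rw [map_prod, pathProd]
  refine Finset.prod_congr rfl fun k _ => ?_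
  split_ifs <;> simp

/-- The product of labels along a path as a polynomial. -/
noncomputable def pathPoly (T : MarkedTree m) (v a : T.V) : MvPolynomial T.Edge ℂ :=
  (exists_pathProd_poly v a).choose

@[simp]
theorem eval_pathPoly (l : T.Edge → ℂ) (v a : T.V) :
    MvPolynomial.eval l (T.pathPoly v a) = T.pathProd l v a :=
  (exists_pathProd_poly v a).choose_spec l

/-! The vertex where two paths meet -/

theorem isAbove_meet_left (i j : Fin (m + 1)) : T.IsAbove (T.meet i j) (T.leaf i) := ⟨_, rfl⟩

theorem isAbove_meet_right (i j : Fin (m + 1)) : T.IsAbove (T.meet i j) (T.leaf j) := by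
  obtain ⟨K, hK⟩ := T.reach (T.leaf i)
  exact Nat.sInf_mem (s := {k : ℕ | T.IsAbove (T.parent^[k] (T.leaf i)) (T.leaf j)})
    ⟨K, by rw [Set.mem_ofPred_eq, hK]; exact isAbove_root _⟩

/-- The infimum in the definition of `meet` picks the first vertex on the path from `i` that is also
above `j`; any other common upper bound comes later on that path. -/
theorem isAbove_meet {a : T.V} {i j : Fin (m + 1)} (hi : T.IsAbove a (T.leaf i))
    (hj : T.IsAbove a (T.leaf j)) : T.IsAbove a (T.meet i j) := by
  obtain ⟨k, rfl⟩ := hi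
  have h : sInf {k : ℕ | T.IsAbove (T.parent^[k] (T.leaf i)) (T.leaf j)} ≤ k := Nat.sInf_le hj
  obtain ⟨d, hd⟩ := Nat.exists_eq_add_of_le' h
  exact ⟨d, by rw [meet, ← Function.iterate_add_apply, ← hd]⟩

theorem isAbove_meet_iff {a : T.V} {i j : Fin (m + 1)} : T.IsAbove a (T.meet i j) ↔
    T.IsAbove a (T.leaf i) ∧ T.IsAbove a (T.leaf j) :=
  ⟨fun h => ⟨h.trans (isAbove_meet_left i j), h.trans (isAbove_meet_right i j)⟩,
    fun h => isAbove_meet h.1 h.2⟩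

theorem meet_comm (i j : Fin (m + 1)) : T.meet i j = T.meet j i :=
  (isAbove_meet (isAbove_meet_right j i) (isAbove_meet_left j i)).antisymm
    (isAbove_meet (isAbove_meet_right i j) (isAbove_meet_left i j)) |>.symm

/-- Above two leaves, `v` is their meeting point unless both are behind the same child. -/
theorem ne_meet_iff {v : T.V} {i j : Fin (m + 1)} (hi : T.IsAbove v (T.leaf i))
    (hj : T.IsAbove v (T.leaf j)) : v ≠ T.meet i j ↔
      ∃ w, w ≠ T.root ∧ T.parent w = v ∧ T.IsAbove w (T.leaf i) ∧ T.IsAbove w (T.leaf j) := by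
  constructor
  · intro h
    obtain ⟨w, h1, h2, h3⟩ := (isAbove_meet hi hj).exists_child h.symm
    exact ⟨w, h1, h2, isAbove_meet_iff.1 h3⟩
  · rintro ⟨w, h1, h2, h3, h4⟩ rfl
    exact not_isAbove_parent h1 (h2 ▸ isAbove_meet h3 h4)

/-- Vertices above `v` form a chain, and of two distinct comparable siblings one would lie above the
common parent. -/
theorem child_unique {v w w' : T.V} (hw : w ≠ T.root) (hw' : w' ≠ T.root)
    (h : T.parent w = T.parent w') (hv : T.IsAbove w v) (hv' : T.IsAbove w' v) : w = w' := by
  rcases hv.total hv' with h1 | h1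
  · by_contra hne
    have := h1.parent (Ne.symm hne)
    rw [← h] at this
    exact not_isAbove_parent hw this
  · by_contra hne
    have := h1.parent hne
    rw [h] at this
    exact not_isAbove_parent hw' this

/-- Not meeting at `v` means being behind the same child of `v`, and that child is unique. -/
theorem ne_meet_trans {v : T.V} {i j k : Fin (m + 1)} (hi : T.IsAbove v (T.leaf i))
    (hj : T.IsAbove v (T.leaf j)) (hk : T.IsAbove v (T.leaf k))
    (h : v ≠ T.meet i j) (h' : v ≠ T.meet j k) : v ≠ T.meet i k := by
  obtain ⟨w, h1, h2, h3, h4⟩ := (ne_meet_iff hi hj).1 h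
  obtain ⟨w', h1', h2', h3', h4'⟩ := (ne_meet_iff hj hk).1 h'
  obtain rfl := child_unique h1 h1' (h2.trans h2'.symm) h4 h3'
  exact (ne_meet_iff hi hk).2 ⟨w, h1, h2, h3, h4'⟩

/-! Branches and valence -/

/-- The edges at `v` that lead away from the root, finite or semi-infinite. -/
abbrev Branch (v : T.V) : Type :=
  {w : T.V // w ≠ T.root ∧ T.parent w = v} ⊕ {i : Fin (m + 1) // T.leaf i = v}

/-- The leaf `i` lies behind the branch. -/
def Leads {v : T.V} (b : Branch v) (i : Fin (m + 1)) : Prop :=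
  b.elim (fun w => T.IsAbove w.1 (T.leaf i)) (fun j => i = j.1)

instance (v : T.V) : Finite (Branch v) := by
  have := T.finite
  infer_instance

theorem valence_eq (v : T.V) : T.valence v = Nat.card (Branch v) + 1 := by
  have := T.finite
  rw [valence, Nat.card_sum]

theorem exists_leads {v : T.V} {i : Fin (m + 1)} (h : T.IsAbove v (T.leaf i)) :
    ∃ b : Branch v, Leads b i := by
  by_cases hv : T.leaf i = v
  · exact ⟨Sum.inr ⟨i, hv⟩, rfl⟩
  · obtain ⟨w, h1, h2, h3⟩ := h.exists_child hv
    exact ⟨Sum.inl ⟨w, h1, h2⟩, h3⟩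

theorem Leads.isAbove {v : T.V} {b : Branch v} {i : Fin (m + 1)} (h : Leads b i) :
    T.IsAbove v (T.leaf i) := by
  rcases b with ⟨w, h1, h2⟩ | ⟨j, hj⟩
  · rw [← h2]
    exact (isAbove_parent w).trans h
  · obtain rfl : i = j := h
    exact hj ▸ .refl _

theorem Leads.ne_meet {v : T.V} {b : Branch v} {i j : Fin (m + 1)} (h : Leads b i)
    (h' : Leads b j) (hij : i ≠ j) : v ≠ T.meet i j := by
  rw [ne_meet_iff h.isAbove h'.isAbove]
  rcases b with ⟨w, h1, h2⟩ | ⟨k, hk⟩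
  · exact ⟨w, h1, h2, h, h'⟩
  · exact absurd (Eq.trans h (Eq.symm h')) hij

theorem Leads.unique {v : T.V} {b b' : Branch v} {i : Fin (m + 1)} (h : Leads b i)
    (h' : Leads b' i) : b = b' := by
  rcases b with ⟨w, h1, h2⟩ | ⟨k, hk⟩ <;> rcases b' with ⟨w', h1', h2'⟩ | ⟨k', hk'⟩
  · obtain rfl := child_unique h1 h1' (h2.trans h2'.symm) h h'
    rfl
  · obtain rfl : i = k' := h'
    have h3 : T.IsAbove w (T.leaf i) := h
    rw [hk', ← h2] at h3
    exact absurd h3 (not_isAbove_parent h1)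
  · obtain rfl : i = k := h
    have h3 : T.IsAbove w' (T.leaf i) := h'
    rw [hk, ← h2'] at h3
    exact absurd h3 (not_isAbove_parent h1')
  · obtain rfl : i = k := h
    obtain rfl : i = k' := h'
    rfl

theorem Leads.meet_eq {v : T.V} {b b' : Branch v} {i j : Fin (m + 1)} (h : Leads b i)
    (h' : Leads b' j) (hb : b ≠ b') : i ≠ j ∧ T.meet i j = v := by
  have hij : i ≠ j := by
    rintro rfl
    exact hb (h.unique h')
  refine ⟨hij, ?_⟩
  by_contra hne
  obtain ⟨w, h1, h2, h3, h4⟩ := (ne_meet_iff h.isAbove h'.isAbove).1 (Ne.symm hne)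
  have e1 : b = Sum.inl ⟨w, h1, h2⟩ := h.unique h3
  have e2 : b' = Sum.inl ⟨w, h1, h2⟩ := h'.unique h4
  exact hb (e1.trans e2.symm)

theorem two_le_valence {v : T.V} {i : Fin (m + 1)} (h : T.IsAbove v (T.leaf i)) :
    2 ≤ T.valence v := by
  obtain ⟨b, _⟩ := exists_leads h
  have : 0 < Nat.card (Branch v) := Nat.card_pos_iff.2 ⟨⟨b⟩, inferInstance⟩
  rw [valence_eq]
  omega

/-- Leaves that meet pairwise at `v` lie in different branches; the extra `1` counts the edge
towards the root. -/
theorem card_le_valence {v : T.V} {ι : Type} (i : ι → Fin (m + 1))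
    (hi : ∀ a, T.IsAbove v (T.leaf (i a)))
    (h : ∀ a b, a ≠ b → i a ≠ i b ∧ T.meet (i a) (i b) = v) :
    Nat.card ι + 1 ≤ T.valence v := by
  choose b hb using fun a => exists_leads (hi a)
  have hinj : Function.Injective b := by
    intro x y hxy
    by_contra hne
    exact (hb x).ne_meet (hxy ▸ hb y) (h x y hne).1 (h x y hne).2.symm
  rw [valence_eq]
  exact Nat.add_le_add_right (Nat.card_le_card_of_injective b hinj) 1

theorem three_le_valence {i j : Fin (m + 1)} (hij : i ≠ j) : 3 ≤ T.valence (T.meet i j) := by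
  have := card_le_valence (v := T.meet i j) ![i, j]
    (by
      intro a
      fin_cases a
      exacts [isAbove_meet_left i j, isAbove_meet_right i j])
    (by
      intro a b hab
      fin_cases a <;> fin_cases b <;> simp [hij, Ne.symm hij, meet_comm] at hab ⊢)
  simpa using this

theorem four_le_valence {v : T.V} {i j k : Fin (m + 1)} (hij : i ≠ j) (hik : i ≠ k) (hjk : j ≠ k)
    (h1 : T.meet i j = v) (h2 : T.meet i k = v) (h3 : T.meet j k = v) : 4 ≤ T.valence v := by
  have := card_le_valence (v := v) ![i, j, k]
    (by
      intro a
      fin_cases a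
      exacts [h1 ▸ isAbove_meet_left i j, h1 ▸ isAbove_meet_right i j,
        h2 ▸ isAbove_meet_right i k])
    (by
      have h1' := meet_comm (T := T) j i
      have h2' := meet_comm (T := T) k i
      have h3' := meet_comm (T := T) k j
      intro a b hab
      fin_cases a <;> fin_cases b <;>
        simp [hij, hik, hjk, Ne.symm hij, Ne.symm hik, Ne.symm hjk, h1, h2, h3, h1', h2', h3']
          at hab ⊢)
  simpa using this

/-- Induction from the leaves to the root. -/
theorem induction_down {P : T.V → Prop}
    (h : ∀ v, (∀ w, w ≠ T.root → T.parent w = v → P w) → P v) (v : T.V) : P v := by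
  have := T.finite
  have wf : WellFounded fun a b : T.V => T.IsAbove b a ∧ a ≠ b := by
    have : IsTrans T.V fun a b => T.IsAbove b a ∧ a ≠ b := ⟨fun a b c h1 h2 =>
      ⟨h2.1.trans h1.1, by rintro rfl; exact h1.2 (h2.1.antisymm h1.1)⟩⟩
    have : Std.Irrefl fun a b : T.V => T.IsAbove b a ∧ a ≠ b := ⟨fun a h => h.2 rfl⟩
    exact Finite.wellFounded_of_trans_of_irrefl _
  refine wf.induction v fun v ih => h v fun w hw hwv => ih w ?_
  subst hwv
  exact ⟨isAbove_parent w, (parent_ne hw).symm⟩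

theorem exists_leaf (hT : ∀ v, 2 ≤ T.valence v) (v : T.V) : ∃ i, T.IsAbove v (T.leaf i) := by
  refine induction_down (P := fun v => ∃ i, T.IsAbove v (T.leaf i)) (fun v ih => ?_) v
  have h1 := hT v
  rw [valence_eq] at h1
  obtain ⟨b⟩ := (Nat.card_pos_iff.1 (by omega : 0 < Nat.card (Branch v))).1
  rcases b with ⟨w, h2, h3⟩ | ⟨i, hi⟩
  · obtain ⟨i, hi⟩ := ih w h2 h3
    exact ⟨i, h3 ▸ (isAbove_parent w).trans hi⟩
  · exact ⟨i, hi ▸ .refl _⟩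

theorem Branch.exists_leads (hT : ∀ v, 2 ≤ T.valence v) {v : T.V} (b : Branch v) :
    ∃ i, Leads b i := by
  rcases b with w | i
  · exact exists_leaf hT w.1
  · exact ⟨i.1, rfl⟩

theorem exists_meet_eq (hT : ∀ v, 2 ≤ T.valence v) {v : T.V} (hv : 3 ≤ T.valence v) :
    ∃ i j, i ≠ j ∧ T.meet i j = v := by
  rw [valence_eq] at hv
  have : 1 < Nat.card (Branch v) := by omega
  rw [Finite.one_lt_card_iff_nontrivial] at this
  obtain ⟨b, b', hb⟩ := exists_pair_ne (Branch v)
  obtain ⟨i, hi⟩ := b.exists_leads hT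
  obtain ⟨j, hj⟩ := b'.exists_leads hT
  exact ⟨i, j, hi.meet_eq hj hb⟩

end MarkedTree

end ScaledLine

namespace ScaledLine

/-! ### Maximal colored trees with a planar structure -/

namespace ColoredTree

open MarkedTree

variable {m : ℕ} {T : ColoredTree m} {σ : Equiv.Perm (Fin (m + 1))}

theorem IsMaximal.two_le_valence (hT : T.IsMaximal) (v : T.V) : 2 ≤ T.valence v := by
  by_cases h : v ∈ T.col
  · exact (hT.1 v h).ge
  · exact (hT.2 v h).ge.trans' (by norm_num)

theorem IsMaximal.exists_leaf (hT : T.IsMaximal) (v : T.V) :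
    ∃ i, T.IsAbove v (T.leaf (σ i)) := by
  obtain ⟨i, hi⟩ := MarkedTree.exists_leaf hT.two_le_valence v
  exact ⟨σ.symm i, by rwa [Equiv.apply_symm_apply]⟩

theorem IsMaximal.meet_notMem_col (hT : T.IsMaximal) {i j : Fin (m + 1)} (hij : i ≠ j) :
    T.meet i j ∉ T.col := fun h => by
  have h1 := three_le_valence (T := T.toMarkedTree) hij
  have h2 := hT.1 _ h
  omega

theorem IsMaximal.gapVertex_notMem_col (hT : T.IsMaximal) (p : Fin m) :
    T.gapVertex σ p ∉ T.col :=
  hT.meet_notMem_col (σ.injective.ne (Fin.castSucc_lt_succ (i := p)).ne)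

/-- The leaves between two leaves behind `u` are behind `u`. -/
theorem IsPlanar.isAbove_leaf (hσ : T.IsPlanar σ) {u : T.V} {i j k : Fin (m + 1)}
    (hi : T.IsAbove u (T.leaf (σ i))) (hj : T.IsAbove u (T.leaf (σ j))) (hik : i ≤ k)
    (hkj : k ≤ j) : T.IsAbove u (T.leaf (σ k)) :=
  (hσ u).out hi hj ⟨hik, hkj⟩

theorem IsPlanar.isAbove_gapVertex (hσ : T.IsPlanar σ) {u : T.V} {i j : Fin (m + 1)} {p : Fin m}
    (hi : T.IsAbove u (T.leaf (σ i))) (hj : T.IsAbove u (T.leaf (σ j))) (hip : i ≤ p.castSucc)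
    (hpj : p.castSucc < j) : T.IsAbove u (T.gapVertex σ p) :=
  isAbove_meet (hσ.isAbove_leaf hi hj hip hpj.le)
    (hσ.isAbove_leaf hi hj (hip.trans Fin.castSucc_lt_succ.le) (Fin.castSucc_lt_iff_succ_le.1 hpj))

/-- Every trivalent vertex is the vertex of a gap. -/
theorem IsMaximal.exists_gapVertex_eq (hT : T.IsMaximal) (hσ : T.IsPlanar σ) {v : T.V}
    (hv : v ∉ T.col) : ∃ p, T.gapVertex σ p = v := by
  obtain ⟨a, b, hab, hm⟩ := exists_meet_eq hT.two_le_valence (hT.2 v hv).ge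
  obtain ⟨i, j, hij, hm⟩ : ∃ i j, i < j ∧ T.meet (σ i) (σ j) = v := by
    obtain ⟨i, rfl⟩ := σ.surjective a
    obtain ⟨j, rfl⟩ := σ.surjective b
    rcases lt_or_gt_of_ne (fun h : i = j => hab (congrArg σ h)) with h | h
    · exact ⟨i, j, h, hm⟩
    · exact ⟨j, i, h, by rw [meet_comm, hm]⟩
  have hi : T.IsAbove v (T.leaf (σ i)) := hm ▸ isAbove_meet_left _ _
  have hj : T.IsAbove v (T.leaf (σ j)) := hm ▸ isAbove_meet_right _ _
  by_contra! hne
  -- If no gap has its vertex at `v`, consecutive leaves from `i` to `j` never change the child of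
  -- `v` they are behind, so `i` and `j` could not meet at `v`. The case `k = i` is kept apart
  -- because `T.meet (σ i) (σ i)` is the vertex of the leaf, possibly `v` itself.
  have key : ∀ k : Fin (m + 1), i ≤ k → k ≤ j → k = i ∨ v ≠ T.meet (σ i) (σ k) := by
    intro k
    induction k using Fin.induction with
    | zero => exact fun h _ => Or.inl (le_antisymm (Fin.zero_le _) h)
    | succ p ih =>
      intro h1 h2
      rcases h1.eq_or_lt with h1 | h1
      · exact Or.inl h1.symm
      have h3 : i ≤ p.castSucc := Fin.le_castSucc_iff.2 h1
      have h4 : p.castSucc ≤ j := Fin.castSucc_lt_succ.le.trans h2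
      right
      rcases ih h3 h4 with h5 | h5
      · rw [← h5]
        exact (hne p).symm
      · exact ne_meet_trans hi (hσ.isAbove_leaf hi hj h3 h4) (hσ.isAbove_leaf hi hj h1.le h2) h5
          (hne p).symm
  rcases key j hij.le le_rfl with h | h
  · exact hij.ne' h
  · exact h hm.symm

/-- If gaps `p < q` shared a vertex, the left leaf of `p` and both leaves of `q` would meet there
pairwise, forcing valence at least four. -/
theorem IsMaximal.gapVertex_injective (hT : T.IsMaximal) (hσ : T.IsPlanar σ) :
    Function.Injective (T.gapVertex σ) := by
  have key : ∀ p q, p < q → T.gapVertex σ p ≠ T.gapVertex σ q := by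
    intro p q hpq h
    have hp : T.IsAbove (T.gapVertex σ p) (T.leaf (σ p.castSucc)) := isAbove_meet_left _ _
    -- A child with both `p.castSucc` and `k` behind it would by planarity also have `p.succ` behind
    -- it.
    have h1 : ∀ k, p.succ ≤ k → T.IsAbove (T.gapVertex σ p) (T.leaf (σ k)) →
        T.meet (σ p.castSucc) (σ k) = T.gapVertex σ p := by
      intro k hk hk'
      by_contra hne
      obtain ⟨w, hw1, hw2, hw3, hw4⟩ := (ne_meet_iff hp hk').1 (Ne.symm hne)
      have := hσ.isAbove_leaf hw3 hw4 Fin.castSucc_lt_succ.le hk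
      exact (ne_meet_iff hp (isAbove_meet_right _ _)).2 ⟨w, hw1, hw2, hw3, this⟩ rfl
    have h2 : p.succ ≤ q.castSucc := Fin.castSucc_lt_iff_succ_le.1 hpq
    have h3 : q.castSucc < q.succ := Fin.castSucc_lt_succ
    have h4 := h1 _ h2 (h ▸ isAbove_meet_left _ _)
    have h5 := h1 _ (h2.trans h3.le) (h ▸ isAbove_meet_right _ _)
    have h6 : p.castSucc < q.castSucc := hpq
    have h7 := four_le_valence (σ.injective.ne h6.ne) (σ.injective.ne (h6.trans h3).ne)
      (σ.injective.ne h3.ne) h4 h5 h.symm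
    have h8 := hT.2 _ (hT.gapVertex_notMem_col (σ := σ) p)
    omega
  intro p q h
  rcases lt_trichotomy p q with h' | h' | h'
  · exact absurd h (key p q h')
  · exact h'
  · exact absurd h.symm (key q p h')

/-! Position relative to the colored vertices -/

/-- Some vertex strictly between `v` and the root, or the root, is colored. -/
def BehindCol (T : ColoredTree m) (v : T.V) : Prop := ∃ c ∈ T.col, T.IsAbove c v ∧ c ≠ v

theorem col_eq {c c' : T.V} (hc : c ∈ T.col) (hc' : c' ∈ T.col) {i : Fin (m + 1)}
    (h : T.IsAbove c (T.leaf i)) (h' : T.IsAbove c' (T.leaf i)) : c = c' :=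
  (T.col_unique i).unique ⟨hc, h⟩ ⟨hc', h'⟩

theorem IsMaximal.col_eq_of_isAbove (hT : T.IsMaximal) {c c' : T.V} (hc : c ∈ T.col)
    (hc' : c' ∈ T.col) (h : T.IsAbove c c') : c = c' := by
  obtain ⟨i, hi⟩ := MarkedTree.exists_leaf hT.two_le_valence c'
  exact col_eq hc hc' (h.trans hi) hi

theorem IsMaximal.exists_col_below (hT : T.IsMaximal) {v : T.V} (hv : ¬ T.BehindCol v) :
    ∃ c ∈ T.col, T.IsAbove v c := by
  obtain ⟨i, hi⟩ := MarkedTree.exists_leaf hT.two_le_valence v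
  obtain ⟨c, ⟨hc, hci⟩, -⟩ := T.col_unique i
  rcases hci.total hi with h | h
  · by_cases hcv : c = v
    · exact ⟨c, hc, hcv ▸ .refl _⟩
    · exact absurd ⟨c, hc, h, hcv⟩ hv
  · exact ⟨c, hc, h⟩

theorem IsMaximal.not_behindCol (hT : T.IsMaximal) {v c : T.V} (hc : c ∈ T.col)
    (h : T.IsAbove v c) : ¬ T.BehindCol v := by
  rintro ⟨c', hc', h1, h2⟩
  obtain rfl := hT.col_eq_of_isAbove hc' hc (h1.trans h)
  exact h2 (h1.antisymm h)

theorem not_behindCol_iff {v : T.V} : ¬ T.BehindCol v ∧ v ∉ T.col ↔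
    ∀ a, T.IsAbove a v → a ∉ T.col := by
  constructor
  · rintro ⟨h1, h2⟩ a ha hac
    by_cases hav : a = v
    · exact h2 (hav ▸ hac)
    · exact h1 ⟨a, hac, ha, hav⟩
  · exact fun h => ⟨fun ⟨c, hc, h1, _⟩ => h c h1 hc, h v (.refl v)⟩

/-- The restriction on `v` can be dropped: a vertex above a colored `c` has no colored vertex
strictly above it, and if it is itself colored then `c = v = c'`. -/
theorem IsMaximal.balanced_iff (hT : T.IsMaximal) {l : T.Edge → ℂ} : l ∈ T.balanced ↔
    ∀ v c c', c ∈ T.col → c' ∈ T.col → T.IsAbove v c → T.IsAbove v c' →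
      T.pathProd l c v = T.pathProd l c' v := by
  constructor
  · intro h v c c' hc hc' hvc hvc'
    by_cases hv : v ∈ T.col
    · rw [← hT.col_eq_of_isAbove hv hc hvc, ← hT.col_eq_of_isAbove hv hc' hvc']
    · exact h v (not_behindCol_iff.1 ⟨hT.not_behindCol hc hvc, hv⟩) c hc c' hc' hvc hvc'
  · exact fun h v _ c hc c' hc' => h v c c' hc hc'

/-! Positions of the leaves determined by a labelling -/

/-- The position of the leaf `i` (in the planar order) in the coordinate in which the gap at the
vertex `v` has length `1`, up to a constant. -/
noncomputable def lpos (T : ColoredTree m) (σ : Equiv.Perm (Fin (m + 1))) (l : T.Edge → ℂ)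
    (v : T.V) (i : Fin (m + 1)) : ℂ :=
  ∑ p : Fin m with p.castSucc < i, T.pathProd l (T.gapVertex σ p) v

/-- The sum defining `lpos` may run over gaps that are not behind `v`, where the path product has no
meaning. They cancel in differences: between two leaves behind `v`, planarity leaves only gaps
behind `v`. -/
theorem lpos_sub (l : T.Edge → ℂ) (v : T.V) {i j : Fin (m + 1)} (hij : i ≤ j) :
    T.lpos σ l v j - T.lpos σ l v i =
      ∑ p : Fin m with i ≤ p.castSucc ∧ p.castSucc < j, T.pathProd l (T.gapVertex σ p) v := by
  rw [sub_eq_iff_eq_add', lpos, lpos, ← Finset.sum_union]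
  · congr 1
    ext p
    simp only [Finset.mem_filter, Finset.mem_univ, true_and, Finset.mem_union]
    constructor
    · intro h
      rcases lt_or_ge p.castSucc i with h' | h'
      · exact Or.inl h'
      · exact Or.inr ⟨h', h⟩
    · rintro (h | h)
      · exact h.trans_le hij
      · exact h.2
  · rw [Finset.disjoint_filter]
    rintro p - h1 ⟨h2, -⟩
    exact absurd h1 (not_lt.2 h2)

theorem lpos_succ_sub (l : T.Edge → ℂ) (v : T.V) (p : Fin m) :
    T.lpos σ l v p.succ - T.lpos σ l v p.castSucc = T.pathProd l (T.gapVertex σ p) v := by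
  have h : (Finset.univ.filter fun q : Fin m =>
      p.castSucc ≤ q.castSucc ∧ q.castSucc < p.succ) = {p} := by
    ext q
    simp only [Finset.mem_filter, Finset.mem_univ, true_and, Finset.mem_singleton,
      Fin.castSucc_lt_succ_iff, Fin.castSucc_le_castSucc_iff]
    exact ⟨fun h => le_antisymm h.2 h.1, fun h => h ▸ ⟨le_rfl, le_rfl⟩⟩
  rw [lpos_sub l _ Fin.castSucc_lt_succ.le, h, Finset.sum_singleton]

/-- Passing to a higher vertex rescales the picture behind `u`: every gap between leaves behind `u`
has its path to `v` running through `u`. -/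
theorem IsPlanar.lpos_sub_mul (hσ : T.IsPlanar σ) (l : T.Edge → ℂ) {u v : T.V}
    {i j : Fin (m + 1)} (hi : T.IsAbove u (T.leaf (σ i))) (hj : T.IsAbove u (T.leaf (σ j)))
    (hu : T.IsAbove v u) :
    T.lpos σ l v j - T.lpos σ l v i =
      (T.lpos σ l u j - T.lpos σ l u i) * T.pathProd l u v := by
  have key : ∀ i j, i ≤ j → T.IsAbove u (T.leaf (σ i)) → T.IsAbove u (T.leaf (σ j)) →
      T.lpos σ l v j - T.lpos σ l v i =
        (T.lpos σ l u j - T.lpos σ l u i) * T.pathProd l u v := by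
    intro i j hij hi hj
    rw [lpos_sub l v hij, lpos_sub l u hij, Finset.sum_mul]
    refine Finset.sum_congr rfl fun p hp => ?_
    simp only [Finset.mem_filter, Finset.mem_univ, true_and] at hp
    rw [pathProd_mul l (hσ.isAbove_gapVertex hi hj hp.1 hp.2) hu]
  rcases le_total i j with h | h
  · exact key i j h hi hj
  · rw [← neg_sub, key j i h hj hi]
    ring

theorem mem_balancedStar_iff {l : T.Edge → ℂ} : l ∈ T.balancedStar σ ↔ l ∈ T.balanced ∧
    ∀ i j, i ≠ j → T.lpos σ l (T.meet (σ i) (σ j)) j ≠ T.lpos σ l (T.meet (σ i) (σ j)) i := by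
  refine and_congr_right fun _ => ?_
  constructor
  · intro h i j hij
    rcases lt_or_gt_of_ne hij with h' | h'
    · rw [← sub_ne_zero, lpos_sub l _ h'.le]
      exact h i j h'
    · rw [ne_comm, ← sub_ne_zero, lpos_sub l _ h'.le, meet_comm]
      exact h j i h'
  · intro h i j hij
    rw [← lpos_sub l _ hij.le, sub_ne_zero]
    exact h i j hij.ne

/-- The position of a leaf as a polynomial in the labels. -/
noncomputable def lposPoly (T : ColoredTree m) (σ : Equiv.Perm (Fin (m + 1))) (v : T.V)
    (i : Fin (m + 1)) :
    MvPolynomial T.Edge ℂ :=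
  ∑ p : Fin m with p.castSucc < i, T.pathPoly (T.gapVertex σ p) v

@[simp]
theorem eval_lposPoly (l : T.Edge → ℂ) (v : T.V) (i : Fin (m + 1)) :
    MvPolynomial.eval l (T.lposPoly σ v i) = T.lpos σ l v i := by
  simp [lposPoly, lpos]

theorem balancedStar_eq : ∃ F : MvPolynomial T.Edge ℂ,
    T.balancedStar σ = {l | l ∈ T.balanced ∧ MvPolynomial.eval l F ≠ 0} := by
  refine ⟨∏ q : Fin (m + 1) × Fin (m + 1) with q.1 ≠ q.2,
    (T.lposPoly σ (T.meet (σ q.1) (σ q.2)) q.2 - T.lposPoly σ (T.meet (σ q.1) (σ q.2)) q.1), ?_⟩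
  ext l
  rw [mem_balancedStar_iff, Set.mem_ofPred_eq, map_prod, Finset.prod_ne_zero_iff]
  simp [sub_eq_zero]

end ColoredTree

end ScaledLine

namespace ScaledLine

/-! ### The balanced labellings form an affine toric variety -/

namespace MarkedTree

variable {m : ℕ} {T : MarkedTree m}

theorem pathProd_eq_div {l : T.Edge → ℂ} {g : T.V → ℂ} (hg : ∀ v, g v ≠ 0)
    (h : ∀ e : T.Edge, l e = g e.1 / g (T.parent e.1)) {a v : T.V} (hav : T.IsAbove a v) :
    T.pathProd l v a = g v / g a := by
  refine IsAbove.rec_parent (P := fun v => T.pathProd l v a = g v / g a) ?_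
    (fun v hr hne hav ih => ?_) hav
  · rw [pathProd_self, div_self (hg a)]
  · rw [pathProd_parent l (hav.trans (isAbove_parent v)) hne, ih, label_edge l ⟨v, hr⟩, h]
    have := hg (T.parent v)
    field_simp

end MarkedTree

namespace ColoredTree

open MarkedTree Filter Topology

variable {m : ℕ} {T : ColoredTree m}

/-- Multiplication of complex numbers is an open map. -/
theorem eventually_exists_mul_eq (a b : ℂ) {p : ℂ → Prop} {δ : ℝ} (hδ : 0 < δ)
    (hp : ∀ᶠ y in 𝓝 b, p y) : ∀ᶠ g in 𝓝 (a * b), ∃ x y, x * y = g ∧ ‖x - a‖ < δ ∧ p y := by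
  by_cases ha : a = 0
  · by_cases hb : b = 0
    -- The only point where neither factor can be kept fixed is `(0, 0)`; there `x` and `y` are both
    -- taken to be a square root of `g`.
    · subst ha hb
      obtain ⟨ε, hε, hε'⟩ := Metric.eventually_nhds_iff.1 hp
      rw [Metric.eventually_nhds_iff]
      refine ⟨(min δ ε) ^ 2, by positivity, fun g hg => ?_⟩
      obtain ⟨r, hr⟩ := IsAlgClosed.exists_pow_nat_eq g (n := 2) two_pos
      have h1 : ‖r‖ < min δ ε := by
        rw [mul_zero, dist_zero_right, ← hr, norm_pow] at hg
        exact lt_of_pow_lt_pow_left₀ 2 (by positivity) hg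
      refine ⟨r, r, by rw [← hr, sq], by simpa using h1.trans_le (min_le_left _ _), hε' ?_⟩
      simpa using h1.trans_le (min_le_right _ _)
    · have hc : Tendsto (fun g : ℂ => g / b - a) (𝓝 (a * b)) (𝓝 0) := by
        have : Continuous fun g : ℂ => g / b - a := by fun_prop
        simpa [hb] using this.tendsto (a * b)
      filter_upwards [hc.norm.eventually_lt_const (by simpa using hδ)] with g hg
      exact ⟨g / b, b, div_mul_cancel₀ g hb, hg, hp.self_of_nhds⟩
  · have hc : Tendsto (fun g : ℂ => g / a) (𝓝 (a * b)) (𝓝 b) := by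
      have : Continuous fun g : ℂ => g / a := by fun_prop
      simpa [ha] using this.tendsto (a * b)
    filter_upwards [hc.eventually hp] with g hg
    exact ⟨a, g / a, mul_div_cancel₀ g ha, by simpa using hδ, hg⟩

/-- A balanced labelling can be approximated behind `v` by nowhere zero labellings for which the
product along the paths from colored vertices to `v` is a prescribed number. -/
theorem IsMaximal.eventually_exists_approx (hT : T.IsMaximal) {l : T.Edge → ℂ}
    (hl : l ∈ T.balanced) {δ : ℝ} (hδ : 0 < δ) (v : T.V) :
    ∀ c ∈ T.col, T.IsAbove v c → ∀ᶠ g in 𝓝 (T.pathProd l c v), g ≠ 0 → (v ∈ T.col → g = 1) →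
      ∃ l' : T.Edge → ℂ, (∀ e, l' e ≠ 0) ∧
        (∀ e : T.Edge, T.IsAbove v e.1 → e.1 ≠ v → ‖l' e - l e‖ < δ) ∧
        ∀ c ∈ T.col, T.IsAbove v c → T.pathProd l' c v = g := by
  classical
  have := T.finite
  refine induction_down (P := fun v => ∀ c ∈ T.col, T.IsAbove v c →
    ∀ᶠ g in 𝓝 (T.pathProd l c v), g ≠ 0 → (v ∈ T.col → g = 1) →
      ∃ l' : T.Edge → ℂ, (∀ e, l' e ≠ 0) ∧
        (∀ e : T.Edge, T.IsAbove v e.1 → e.1 ≠ v → ‖l' e - l e‖ < δ) ∧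
        ∀ c ∈ T.col, T.IsAbove v c → T.pathProd l' c v = g) (fun v ih c hc hvc => ?_) v
  by_cases hv : v ∈ T.col
  · refine Eventually.of_forall fun g _ hg1 => ⟨fun e => if l e = 0 then ((δ / 2 : ℝ) : ℂ) else l e,
      fun e => ?_, fun e _ _ => ?_, fun c' hc' hvc' => ?_⟩
    · dsimp only
      split_ifs with h
      · exact_mod_cast (half_pos hδ).ne'
      · exact h
    · dsimp only
      split_ifs with h
      · rw [h, sub_zero, Complex.norm_real, Real.norm_of_nonneg (half_pos hδ).le]
        exact half_lt_self hδ
      · simpa using hδ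
    · rw [← hT.col_eq_of_isAbove hv hc' hvc', pathProd_self, hg1 hv]
  have hvb : ¬ T.BehindCol v := hT.not_behindCol hc hvc
  have hchild : ∀ w, w ≠ T.root → T.parent w = v → ¬ T.BehindCol w := by
    rintro w hw rfl ⟨c', hc', h1, h2⟩
    exact not_behindCol_iff.1 ⟨hvb, hv⟩ c' (h1.parent h2.symm) hc'
  -- For each child `w` the target `g` is split as `x * y`, with `x` the new label of the edge at
  -- `w` and `y` the target for the products up to `w`. By balance the old products through all
  -- children agree, so one neighbourhood filter serves all of them.
  have key : ∀ w : {w : T.V // w ≠ T.root ∧ T.parent w = v}, ∀ᶠ g in 𝓝 (T.pathProd l c v),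
      g ≠ 0 → ∃ (x y : ℂ) (l' : T.Edge → ℂ), x * y = g ∧ ‖x - label l w.1‖ < δ ∧ (∀ e, l' e ≠ 0) ∧
        (∀ e : T.Edge, T.IsAbove w.1 e.1 → e.1 ≠ w.1 → ‖l' e - l e‖ < δ) ∧
        ∀ c ∈ T.col, T.IsAbove w.1 c → T.pathProd l' c w.1 = y := by
    rintro ⟨w, hw, rfl⟩
    obtain ⟨c', hc', hwc'⟩ := hT.exists_col_below (hchild w hw rfl)
    rw [hT.balanced_iff.1 hl _ c c' hc hc' hvc ((isAbove_parent w).trans hwc'),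
      pathProd_child l hw hwc', mul_comm]
    -- A colored child forces `y = 1`, so the edge label takes the whole factor `g`; otherwise
    -- openness of multiplication distributes it.
    by_cases hwc : w ∈ T.col
    · obtain rfl := hT.col_eq_of_isAbove hwc hc' hwc'
      have h1 := ih w hw rfl w hwc (.refl w)
      rw [pathProd_self] at h1 ⊢
      have h2 := h1.self_of_nhds one_ne_zero fun _ => rfl
      obtain ⟨l', h3, h4, h5⟩ := h2
      filter_upwards [Metric.ball_mem_nhds _ hδ] with g hg _
      rw [mul_one, mem_ball_iff_norm] at hg
      exact ⟨g, 1, l', mul_one g, hg, h3, h4, h5⟩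
    · filter_upwards [eventually_exists_mul_eq (label l w) _ hδ (ih w hw rfl c' hc' hwc')]
      rintro g ⟨x, y, rfl, hx, hy⟩ hg
      obtain ⟨l', h1, h2, h3⟩ := hy (right_ne_zero_of_mul hg) (fun h => absurd h hwc)
      exact ⟨x, y, l', rfl, hx, h1, h2, h3⟩
  filter_upwards [eventually_all.2 key] with g hg hg0 _
  choose x y L hxy hx hL0 hL hLc using fun w => hg w hg0
  -- The labellings found behind the children are glued: `x w` on the edge at `w`, `L w` behind it,
  -- and the irrelevant value `1` away from `v`.
  let l' : T.Edge → ℂ := fun e =>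
    if h : ∃ w : {w : T.V // w ≠ T.root ∧ T.parent w = v}, T.IsAbove w.1 e.1 then
      (if e.1 = h.choose.1 then x h.choose else L h.choose e)
    else 1
  have hl' : ∀ (w : {w : T.V // w ≠ T.root ∧ T.parent w = v}) (e : T.Edge), T.IsAbove w.1 e.1 →
      l' e = if e.1 = w.1 then x w else L w e := by
    intro w e hwe
    have h : ∃ w : {w : T.V // w ≠ T.root ∧ T.parent w = v}, T.IsAbove w.1 e.1 := ⟨w, hwe⟩
    have h1 : h.choose = w := Subtype.ext <| child_unique h.choose.2.1 w.2.1
      (h.choose.2.2.trans w.2.2.symm) h.choose_spec hwe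
    simp only [l', dif_pos h]
    rw [h1]
  have hx0 : ∀ w, x w ≠ 0 := fun w h => hg0 (by rw [← hxy w, h, zero_mul])
  refine ⟨l', fun e => ?_, fun e he hev => ?_, fun c' hc' hvc' => ?_⟩
  · by_cases h : ∃ w : {w : T.V // w ≠ T.root ∧ T.parent w = v}, T.IsAbove w.1 e.1
    · obtain ⟨w, hw⟩ := h
      rw [hl' w e hw]
      split_ifs
      exacts [hx0 w, hL0 w e]
    · simp only [l', dif_neg h]
      exact one_ne_zero
  · obtain ⟨w, hw, hwv, hwe⟩ := he.exists_child hev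
    rw [hl' ⟨w, hw, hwv⟩ e hwe]
    split_ifs with h
    · rw [← label_edge l e, h]
      exact hx ⟨w, hw, hwv⟩
    · exact hL ⟨w, hw, hwv⟩ e hwe h
  · obtain ⟨w, hw, hwv, hwc⟩ := hvc'.exists_child (by rintro rfl; exact hv hc')
    subst hwv
    have h1 : label l' w = x ⟨w, hw, rfl⟩ := by
      rw [label_edge l' ⟨w, hw⟩, hl' ⟨w, hw, rfl⟩ _ (.refl w), if_pos rfl]
    rw [pathProd_child l' hw hwc, h1, ← hxy ⟨w, hw, rfl⟩, ← hLc ⟨w, hw, rfl⟩ c' hc' hwc, mul_comm]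
    congr 1
    refine pathProd_congr hwc fun u hu hwu hne => ?_
    have hur := hwu.ne_root hne
    rw [label_edge l' ⟨u, hur⟩, label_edge _ ⟨u, hur⟩, hl' ⟨w, hw, rfl⟩ _ hwu, if_neg hne]

/-! ### Density of the nowhere zero balanced labellings -/

theorem not_behindCol_root : ¬ T.BehindCol T.root := by
  rintro ⟨c, -, h1, h2⟩
  exact h2 (h1.antisymm (isAbove_root c))

/-- The nowhere zero balanced labellings are dense in the balanced labellings. -/
theorem IsMaximal.exists_approx (hT : T.IsMaximal) {l : T.Edge → ℂ}
    (hl : l ∈ T.balanced) {δ : ℝ} (hδ : 0 < δ) :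
    ∃ l' ∈ T.balanced, (∀ e, l' e ≠ 0) ∧ ∀ e, ‖l' e - l e‖ < δ := by
  obtain ⟨c, hc, hrc⟩ := hT.exists_col_below (T := T) not_behindCol_root
  have h := hT.eventually_exists_approx hl hδ T.root c hc hrc
  obtain ⟨g, hg0, l', h0, h1, h2⟩ : ∃ g : ℂ, g ≠ 0 ∧ ∃ l' : T.Edge → ℂ, (∀ e, l' e ≠ 0) ∧
        (∀ e : T.Edge, T.IsAbove T.root e.1 → e.1 ≠ T.root → ‖l' e - l e‖ < δ) ∧
        ∀ c ∈ T.col, T.IsAbove T.root c → T.pathProd l' c T.root = g := by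
    -- A colored root leaves only `g = 1`; otherwise some nonzero `g` exists arbitrarily close to
    -- the given product, even if that product is zero.
    by_cases hr : T.root ∈ T.col
    · obtain rfl := hT.col_eq_of_isAbove hr hc hrc
      rw [pathProd_self] at h
      exact ⟨1, one_ne_zero, h.self_of_nhds one_ne_zero fun _ => rfl⟩
    · obtain ⟨g, hg0, hg⟩ := ((mem_closure_iff_frequently.1
        (dense_compl_singleton (0 : ℂ) (T.pathProd l c T.root))).and_eventually h).exists
      exact ⟨g, hg0, hg hg0 fun h => absurd h hr⟩
  refine ⟨l', hT.balanced_iff.2 fun v c c' hc hc' hvc hvc' => ?_, h0,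
    fun e => h1 e (isAbove_root _) e.2⟩
  -- Equal products up to the root suffice: the common factor from `v` to the root is nonzero and
  -- cancels.
  have h3 : T.pathProd l' v T.root ≠ 0 := (pathProd_ne_zero_iff l' (isAbove_root v)).2
    fun w _ _ hw => label_edge l' ⟨w, hw⟩ ▸ h0 _
  refine mul_right_cancel₀ h3 ?_
  rw [pathProd_mul l' hvc (isAbove_root v), pathProd_mul l' hvc' (isAbove_root v),
    h2 c hc (isAbove_root c), h2 c' hc' (isAbove_root c')]

/-- The torus has one coordinate per vertex plus a last one shared by all colored vertices, and the
label of an edge is the quotient of the coordinates at its ends. Polynomials vanishing on the torus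
vanish on `balanced` by density and continuity; the equations of balance vanish on the torus by
telescoping. -/
theorem IsMaximal.isAffineToric_balanced (hT : T.IsMaximal) : IsAffineToric T.balanced := by
  classical
  have := T.finite
  let := Fintype.ofFinite T.Edge
  let eqv : T.V ≃ Fin (Nat.card T.V) := Finite.equivFin T.V
  let idx : T.V → Fin (Nat.card T.V + 1) := fun v =>
    if v ∈ T.col then Fin.last _ else (eqv v).castSucc
  let A : T.Edge → Fin (Nat.card T.V + 1) → ℤ := fun e j =>
    (if idx e.1 = j then 1 else 0) - (if idx (T.parent e.1) = j then 1 else 0)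
  let torus : (Fin (Nat.card T.V + 1) → ℂˣ) → T.Edge → ℂ :=
    fun t e => ∏ j, ((t j ^ A e j : ℂˣ) : ℂ)
  have htorus : ∀ t e, torus t e = t (idx e.1) / t (idx (T.parent e.1)) := by
    intro t e
    have : ∏ j, t j ^ A e j = t (idx e.1) / t (idx (T.parent e.1)) := by
      have h1 : ∀ a, ∏ j, t j ^ (if a = j then 1 else 0 : ℤ) = t a := fun a => by
        rw [Finset.prod_eq_single a (fun b _ hb => by simp [hb.symm]) (by simp), if_pos rfl,
          zpow_one]
      simp only [A, zpow_sub, ← div_eq_mul_inv, Finset.prod_div_distrib, h1]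
    simp only [torus]
    rw [← Units.coe_prod, this, Units.val_div_eq_div_val]
  refine ⟨_, A, Set.ext fun x => ⟨fun hx p hp => ?_, fun hx => ?_⟩⟩
  · have hcl : x ∈ closure {l : T.Edge → ℂ | MvPolynomial.eval l p = 0} := by
      rw [Metric.mem_closure_iff]
      intro ε hε
      obtain ⟨l, hl, hl0, hlx⟩ := hT.exists_approx hx hε
      refine ⟨l, ?_, ?_⟩
      · obtain ⟨c₀, hc₀, hrc₀⟩ := hT.exists_col_below (T := T) not_behindCol_root
        have hg : ∀ v, T.pathProd l v T.root ≠ 0 := fun v =>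
          (pathProd_ne_zero_iff l (isAbove_root v)).2 fun w _ _ hw => label_edge l ⟨w, hw⟩ ▸ hl0 _
        -- The torus point is the product of the labels from a vertex to the root; by balance at the
        -- root it is the same for every colored vertex.
        let t : Fin (Nat.card T.V + 1) → ℂˣ := Fin.lastCases (Units.mk0 _ (hg c₀))
          fun k => Units.mk0 _ (hg (eqv.symm k))
        have ht : ∀ v, (t (idx v) : ℂ) = T.pathProd l v T.root := by
          intro v
          by_cases hv : v ∈ T.col
          · simp only [t, idx, if_pos hv, Fin.lastCases_last, Units.val_mk0]
            exact hT.balanced_iff.1 hl _ _ _ hc₀ hv hrc₀ (isAbove_root v)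
          · simp [t, idx, if_neg hv]
        have h1 : torus t = l := by
          funext e
          rw [htorus, ht, ht, pathProd_parent l (isAbove_root e.1) e.2, label_edge,
            mul_div_cancel_right₀ _ (hg _)]
        have := hp t
        rw [← h1]
        exact this
      · rw [dist_pi_lt_iff hε]
        intro e
        rw [dist_comm, dist_eq_norm]
        exact hlx e
    have hcont : IsClosed {l : T.Edge → ℂ | MvPolynomial.eval l p = 0} :=
      isClosed_singleton.preimage (MvPolynomial.continuous_eval p)
    exact hcont.closure_subset hcl
  · refine hT.balanced_iff.2 fun v c c' hc hc' hvc hvc' => ?_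
    have h1 := hx (T.pathPoly c v - T.pathPoly c' v) fun t => by
      have h2 : ∀ e : T.Edge, torus t e =
          (fun v => ((t (idx v) : ℂˣ) : ℂ)) e.1 / (fun v => ((t (idx v) : ℂˣ) : ℂ)) (T.parent e.1) :=
        htorus t
      have h3 : ∀ v, (fun v => ((t (idx v) : ℂˣ) : ℂ)) v ≠ 0 := fun v => (t (idx v)).ne_zero
      rw [map_sub, eval_pathPoly, eval_pathPoly]
      change T.pathProd (torus t) c v - T.pathProd (torus t) c' v = 0
      rw [pathProd_eq_div h3 h2 hvc, pathProd_eq_div h3 h2 hvc']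
      simp only [idx, if_pos hc, if_pos hc', sub_self]
    rwa [map_sub, eval_pathPoly, eval_pathPoly, sub_eq_zero] at h1

end ColoredTree

end ScaledLine

namespace ScaledLine

namespace MarkedTree

variable {m : ℕ} {T : MarkedTree m}

theorem dist_child {v w : T.V} (hw : w ≠ T.root) (h : T.IsAbove w v) :
    T.dist v (T.parent w) = T.dist v w + 1 := by
  have h1 := isAbove_dist h
  have h2 := isAbove_dist ((isAbove_parent w).trans h)
  refine le_antisymm (Nat.sInf_le (s := {k : ℕ | T.parent^[k] v = T.parent w}) ?_) ?_
  · change T.parent^[_ + 1] v = _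
    rw [Function.iterate_succ_apply', h1]
  · by_contra! hlt
    obtain ⟨d, hd⟩ := Nat.exists_eq_add_of_le' (Nat.le_of_lt_succ hlt)
    rw [hd, Function.iterate_add_apply, h2] at h1
    exact not_isAbove_parent hw ⟨d, h1⟩

end MarkedTree

open MarkedTree

/-! ### Positions of the special points on the components of a curve -/

namespace Curve

variable {m : ℕ} {S : Curve m} {σ : Equiv.Perm (Fin (m + 1))}

theorem exists_leaf (S : Curve m) (v : S.V) : ∃ i, S.IsAbove v (S.leaf i) := by
  refine MarkedTree.exists_leaf (fun v => ?_) v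
  by_cases h : S.form v = ((0 : ℂ) : OnePoint ℂ) ∨ S.form v = ∞
  · exact ((S.stable v).2 h).trans' (by norm_num)
  · exact (S.stable v).1 (not_or.1 h)

theorem pos_leaf (i : Fin (m + 1)) : S.pos (S.leaf i) i = S.mark i := by
  rw [pos, if_pos (dist_self _)]

theorem pos_parent {w : S.V} (hw : w ≠ S.root) {i : Fin (m + 1)} (h : S.IsAbove w (S.leaf i)) :
    S.pos (S.parent w) i = S.node w := by
  rw [pos, dist_child hw h, if_neg (Nat.succ_ne_zero _), Nat.add_sub_cancel, isAbove_dist h]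

/-- Special points in different branches are distinct by `node_inj`, `mark_inj` and `node_ne_mark`,
while markings behind one child are all seen at its node. -/
theorem pos_eq_iff {v : S.V} {i j : Fin (m + 1)} (hi : S.IsAbove v (S.leaf i))
    (hj : S.IsAbove v (S.leaf j)) : S.pos v i = S.pos v j ↔ i = j ∨ v ≠ S.meet i j := by
  constructor
  · contrapose!
    rintro ⟨hij, hv⟩ hp
    have hne := (ne_meet_iff hi hj).not_right.1 hv
    push Not at hne
    rcases hi.eq_or_parent with h1 | -
    · subst h1
      rw [pos_leaf] at hp
      by_cases h2 : S.leaf j = S.leaf i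
      · rw [← h2, pos_leaf] at hp
        exact hij (S.mark_inj i j h2.symm hp)
      · obtain ⟨w, hw1, hw2, hw3⟩ := hj.exists_child h2
        rw [← hw2, pos_parent hw1 hw3] at hp
        exact S.node_ne_mark w i hw1 hw2 hp.symm
    · by_cases h1 : S.leaf i = v
      · subst h1
        rw [pos_leaf] at hp
        by_cases h2 : S.leaf j = S.leaf i
        · rw [← h2, pos_leaf] at hp
          exact hij (S.mark_inj i j h2.symm hp)
        · obtain ⟨w, hw1, hw2, hw3⟩ := hj.exists_child h2
          rw [← hw2, pos_parent hw1 hw3] at hp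
          exact S.node_ne_mark w i hw1 hw2 hp.symm
      · obtain ⟨w, hw1, rfl, hw3⟩ := hi.exists_child h1
        rw [pos_parent hw1 hw3] at hp
        by_cases h2 : S.leaf j = S.parent w
        · rw [← h2, pos_leaf] at hp
          exact S.node_ne_mark w j hw1 h2.symm hp
        · obtain ⟨w', hw1', hw2', hw3'⟩ := hj.exists_child h2
          rw [← hw2', pos_parent hw1' hw3'] at hp
          obtain rfl := S.node_inj w w' hw1 hw1' hw2'.symm hp
          exact hne w hw1 rfl hw3 hw3'
  · rintro (rfl | h)
    · rfl
    · obtain ⟨w, h1, rfl, h2, h3⟩ := (ne_meet_iff hi hj).1 h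
      rw [pos_parent h1 h2, pos_parent h1 h3]

theorem separates_iff {v : S.V} {i j : Fin (m + 1)} :
    S.Separates v i j ↔ i ≠ j ∧ v = S.meet i j := by
  constructor
  · rintro ⟨h1, h2, h3⟩
    rwa [Ne, pos_eq_iff h1 h2, not_or, not_not] at h3
  · rintro ⟨h1, rfl⟩
    refine ⟨isAbove_meet_left i j, isAbove_meet_right i j, ?_⟩
    rw [Ne, pos_eq_iff (isAbove_meet_left i j) (isAbove_meet_right i j)]
    simp [h1]

/-- The single step `form_parent` propagates upwards, since an infinite form is in particular
nonzero. -/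
theorem form_eq_infty {v w : S.V} (h : S.IsAbove v w) (hne : w ≠ v)
    (hw : S.form w ≠ ((0 : ℂ) : OnePoint ℂ)) : S.form v = ∞ := by
  revert hne hw
  refine IsAbove.rec_parent (P := fun w => w ≠ v → S.form w ≠ ((0 : ℂ) : OnePoint ℂ) →
    S.form v = ∞) (fun h _ => absurd rfl h) (fun w hr hwv _ ih _ hw => ?_) h
  have h1 := S.form_parent w hr hw
  by_cases h2 : S.parent w = v
  · rwa [h2] at h1
  · exact ih h2 (by rw [h1]; exact OnePoint.infty_ne_coe 0)

theorem sum_gap {F : Fin (m + 1) → ℂ} {i j : Fin (m + 1)} (hij : i ≤ j) :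
    ∑ p : Fin m with i ≤ p.castSucc ∧ p.castSucc < j, (F p.succ - F p.castSucc) = F j - F i := by
  induction j using Fin.induction with
  | zero =>
    obtain rfl : i = 0 := le_antisymm hij (Fin.zero_le _)
    simp
  | succ q ih =>
    rcases hij.eq_or_lt with rfl | hlt
    · rw [sub_self, Finset.filter_false_of_mem, Finset.sum_empty]
      exact fun p _ h => absurd h.2 (not_lt.2 h.1)
    · have hiq : i ≤ q.castSucc := Fin.le_castSucc_iff.2 hlt
      have h1 : (Finset.univ.filter fun p : Fin m => i ≤ p.castSucc ∧ p.castSucc < q.succ) =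
          insert q (Finset.univ.filter fun p : Fin m => i ≤ p.castSucc ∧ p.castSucc < q.castSucc) := by
        ext p
        simp only [Finset.mem_filter, Finset.mem_univ, true_and, Finset.mem_insert]
        rw [Fin.castSucc_lt_succ_iff, Fin.castSucc_lt_castSucc_iff]
        constructor
        · exact fun ⟨h, h'⟩ => h'.eq_or_lt.imp id fun h' => ⟨h, h'⟩
        · rintro (rfl | h)
          exacts [⟨hiq, le_rfl⟩, ⟨h.1, h.2.le⟩]
      rw [h1, Finset.sum_insert (by simp), ih hiq]
      ring

end Curve

/-! ### Curves whose type is a contraction of a given tree -/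

/-- The map of vertices `f` contracts `T` to the combinatorial type of `S`. -/
structure IsContraction {m : ℕ} (T : ColoredTree m) (S : Curve m) (f : T.V → S.V) : Prop where
  surj : Function.Surjective f
  root : f T.root = S.root
  leaf : ∀ i, f (T.leaf i) = S.leaf i
  parent : ∀ v, v ≠ T.root → f v = f (T.parent v) ∨
    (f v ≠ S.root ∧ S.parent (f v) = f (T.parent v))
  inj : ∀ v w, v ≠ T.root → w ≠ T.root → f v ≠ f (T.parent v) → f w ≠ f (T.parent w) →
    f v = f w → v = w
  col : S.type.col = f '' T.col

theorem contractsTo_iff {m : ℕ} {T : ColoredTree m} {S : Curve m} :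
    T.ContractsTo S.type ↔ ∃ f, IsContraction T S f :=
  ⟨fun ⟨f, h1, h2, h3, h4, h5, h6⟩ => ⟨f, h1, h2, h3, h4, h5, h6⟩,
    fun ⟨f, h1, h2, h3, h4, h5, h6⟩ => ⟨f, h1, h2, h3, h4, h5, h6⟩⟩

namespace IsContraction

variable {m : ℕ} {T : ColoredTree m} {S : Curve m} {f : T.V → S.V}
  {σ : Equiv.Perm (Fin (m + 1))}

/-! ### Contractions and the order of the trees -/

theorem mono (hf : IsContraction T S f) {a v : T.V} (h : T.IsAbove a v) :
    S.IsAbove (f a) (f v) := by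
  refine IsAbove.rec_parent (P := fun v => S.IsAbove (f a) (f v)) (.refl _)
    (fun v hr _ _ ih => ?_) h
  rcases hf.parent v hr with h1 | ⟨_, h1⟩
  · rwa [h1]
  · exact ih.trans (h1 ▸ isAbove_parent _)

theorem isAbove_leaf (hf : IsContraction T S f) {a : T.V} {i : Fin (m + 1)}
    (h : T.IsAbove a (T.leaf i)) : S.IsAbove (f a) (S.leaf i) := hf.leaf i ▸ hf.mono h

/-- If the ends of a path have the same image, its first edge is contracted: the image of the path
is monotone. -/
theorem eq_parent_of_eq (hf : IsContraction T S f) {a v : T.V} (h : T.IsAbove a (T.parent v))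
    (hv : f v = f a) : f v = f (T.parent v) :=
  (hv ▸ hf.mono h : S.IsAbove (f v) (f (T.parent v))).antisymm (hf.mono (isAbove_parent v))

/-- Edges of paths lift along contractions. -/
theorem exists_lift (hf : IsContraction T S f) {a v : T.V} (h : T.IsAbove a v) {w : S.V}
    (hw : S.IsAbove w (f v)) (hwa : ¬ S.IsAbove w (f a)) : ∃ e, e ≠ T.root ∧ T.IsAbove e v ∧
      T.IsAbove a e ∧ e ≠ a ∧ f e = w ∧ f e ≠ f (T.parent e) := by
  revert hw
  refine IsAbove.rec_parent (P := fun v => S.IsAbove w (f v) → ∃ e, e ≠ T.root ∧ T.IsAbove e v ∧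
      T.IsAbove a e ∧ e ≠ a ∧ f e = w ∧ f e ≠ f (T.parent e)) (fun h => absurd h hwa)
    (fun v hr hva hav ih hw => ?_) h
  have hstep : S.IsAbove w (f (T.parent v)) → ∃ e, e ≠ T.root ∧ T.IsAbove e v ∧
      T.IsAbove a e ∧ e ≠ a ∧ f e = w ∧ f e ≠ f (T.parent e) := by
    intro h'
    obtain ⟨e, h0, h1, h2⟩ := ih h'
    exact ⟨e, h0, h1.trans (isAbove_parent v), h2⟩
  by_cases h1 : f v = f (T.parent v)
  · exact hstep (h1 ▸ hw)
  · by_cases h2 : f v = w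
    · exact ⟨v, hr, .refl v, hav.trans (isAbove_parent v), hva, h2, h1⟩
    · refine hstep ?_
      rw [← ((hf.parent v hr).resolve_left h1).2]
      exact hw.parent h2

/-- Otherwise both leaves are behind one edge below `f (T.meet i j)`. It lifts to both paths below
the meet in `T`, and the two lifts coincide by injectivity on uncontracted edges, so the paths would
have met earlier. -/
theorem meet (hf : IsContraction T S f) (i j : Fin (m + 1)) : S.meet i j = f (T.meet i j) := by
  by_contra hne
  have hi := isAbove_meet_left (T := T.toMarkedTree) i j
  have hj := isAbove_meet_right (T := T.toMarkedTree) i j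
  obtain ⟨w, hw1, hw2, hw3, hw4⟩ :=
    (ne_meet_iff (hf.isAbove_leaf hi) (hf.isAbove_leaf hj)).1 (Ne.symm hne)
  have hw5 : ¬ S.IsAbove w (f (T.meet i j)) := hw2 ▸ not_isAbove_parent hw1
  obtain ⟨e, h0, h1, h2, h3, h4, h5⟩ := hf.exists_lift hi (w := w) (by rwa [hf.leaf]) hw5
  obtain ⟨e', h0', h1', h2', h3', h4', h5'⟩ := hf.exists_lift hj (w := w) (by rwa [hf.leaf]) hw5
  obtain rfl := hf.inj e e' h0 h0' h5 h5' (h4.trans h4'.symm)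
  exact h3 ((isAbove_meet h1 h1').antisymm h2)

theorem separates_iff (hf : IsContraction T S f) {v : S.V} {i j : Fin (m + 1)} :
    S.Separates v i j ↔ i ≠ j ∧ v = f (T.meet i j) := by
  rw [Curve.separates_iff, hf.meet]

theorem separates_gap (hf : IsContraction T S f) {v : S.V} {p : Fin m} :
    S.Separates v (σ p.castSucc) (σ p.succ) ↔ v = f (T.gapVertex σ p) := by
  rw [hf.separates_iff, and_iff_right (σ.injective.ne Fin.castSucc_lt_succ.ne)]
  rfl

theorem gap_ne_zero (hf : IsContraction T S f) (p : Fin m) :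
    S.gap σ (f (T.gapVertex σ p)) p ≠ 0 :=
  sub_ne_zero.2 (hf.separates_gap.2 rfl).2.2.symm

/-- The size of the curve `S` at the vertex `v` of `T`: the length of the gap at `v`, or `1 / φ(1)`
if `v` is colored. -/
noncomputable def scale (T : ColoredTree m) (S : Curve m) (σ : Equiv.Perm (Fin (m + 1)))
    (f : T.V → S.V) (v : T.V) : ℂ :=
  open Classical in
  if h : ∃ p, T.gapVertex σ p = v then S.gap σ (f v) h.choose
    else (S.form (f v)).elim 0 (fun c => c⁻¹)

theorem scale_gapVertex (hT : T.IsMaximal) (hσ : T.IsPlanar σ) (p : Fin m) :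
    scale T S σ f (T.gapVertex σ p) = S.gap σ (f (T.gapVertex σ p)) p := by
  have h : ∃ q, T.gapVertex σ q = T.gapVertex σ p := ⟨p, rfl⟩
  rw [scale, dif_pos h, hT.gapVertex_injective hσ h.choose_spec]

theorem scale_col (hT : T.IsMaximal) {c : T.V} (hc : c ∈ T.col) :
    scale T S σ f c = (S.form (f c)).elim 0 (fun c => c⁻¹) := by
  rw [scale, dif_neg]
  rintro ⟨p, rfl⟩
  exact hT.gapVertex_notMem_col p hc

theorem exists_form_col (hf : IsContraction T S f) {c : T.V} (hc : c ∈ T.col) :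
    ∃ z : ℂ, z ≠ 0 ∧ S.form (f c) = (z : OnePoint ℂ) := by
  have h : f c ∈ S.type.col := hf.col ▸ Set.mem_image_of_mem f hc
  obtain ⟨h1, h2⟩ := h
  obtain ⟨z, hz⟩ := OnePoint.ne_infty_iff_exists.1 h2
  refine ⟨z, ?_, hz.symm⟩
  rintro rfl
  exact h1 hz.symm

theorem form_col (hf : IsContraction T S f) (hT : T.IsMaximal) {c : T.V} (hc : c ∈ T.col) :
    S.form (f c) = (((scale T S σ f c)⁻¹ : ℂ) : OnePoint ℂ) := by
  obtain ⟨z, _, hz⟩ := hf.exists_form_col hc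
  rw [scale_col hT hc, hz, OnePoint.elim_some, inv_inv]

theorem scale_ne_zero (hf : IsContraction T S f) (hT : T.IsMaximal) (hσ : T.IsPlanar σ) (v : T.V) :
    scale T S σ f v ≠ 0 := by
  by_cases hv : v ∈ T.col
  · obtain ⟨z, h0, hz⟩ := hf.exists_form_col hv
    rw [scale_col hT hv, hz, OnePoint.elim_some]
    exact inv_ne_zero h0
  · obtain ⟨p, rfl⟩ := hT.exists_gapVertex_eq hσ hv
    rw [scale_gapVertex hT hσ]
    exact hf.gap_ne_zero p

theorem form_above_of_ne (hf : IsContraction T S f) {c v : T.V} (hc : c ∈ T.col)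
    (h : T.IsAbove v c) (hne : f c ≠ f v) : S.form (f v) = ∞ := by
  obtain ⟨z, h0, hz⟩ := hf.exists_form_col hc
  refine Curve.form_eq_infty (hf.mono h) hne ?_
  rw [hz]
  exact fun h => h0 (OnePoint.coe_injective h)

theorem form_below_of_ne (hf : IsContraction T S f) {c v : T.V} (hc : c ∈ T.col)
    (h : T.IsAbove c v) (hne : f v ≠ f c) : S.form (f v) = ((0 : ℂ) : OnePoint ℂ) := by
  by_contra h0
  have h1 := Curve.form_eq_infty (hf.mono h) hne h0
  obtain ⟨z, _, hz⟩ := hf.exists_form_col hc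
  rw [hz] at h1
  exact OnePoint.coe_ne_infty z h1

/-- The two markings of the gap meet on a component strictly below `f u`, so from `f u` both are
seen at the same node. -/
theorem gap_eq_zero (hf : IsContraction T S f) {p : Fin m} {u : T.V}
    (hu : T.IsAbove u (T.gapVertex σ p)) (hne : f (T.gapVertex σ p) ≠ f u) :
    S.gap σ (f u) p = 0 := by
  have h := isAbove_meet_iff.1 hu
  rw [Curve.gap, sub_eq_zero, Curve.pos_eq_iff (hf.isAbove_leaf h.2) (hf.isAbove_leaf h.1)]
  refine Or.inr ?_
  rw [meet_comm, hf.meet]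
  exact hne.symm

open Classical in
/-- The simple ratios are the ratios of the sizes of the curve at the ends of the edge. -/
theorem isSimpleRatio_iff (hf : IsContraction T S f) (hT : T.IsMaximal) (hσ : T.IsPlanar σ)
    (e : T.Edge) (w : ℂ) : S.IsSimpleRatio T σ e w ↔ w = if f e.1 = f (T.parent e.1) then
      scale T S σ f e.1 / scale T S σ f (T.parent e.1) else 0 := by
  obtain ⟨e, he⟩ := e
  have hpe := isAbove_parent (T := T.toMarkedTree) e
  simp only [Curve.IsSimpleRatio, hf.separates_gap]
  by_cases h1 : e ∈ T.col <;> by_cases h2 : T.parent e ∈ T.col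
  · exact absurd (hT.col_eq_of_isAbove h2 h1 hpe) (parent_ne he)
  · obtain ⟨i, hi⟩ := hT.exists_gapVertex_eq hσ h2
    -- If the edge is contracted, both sizes live on one component and the form there is the inverse
    -- of the colored size; if not, the form above the colored component is infinite.
    have key : (S.form (f (T.parent e))).elim 0 (fun c => (c * S.gap σ (f (T.parent e)) i)⁻¹) =
        if f e = f (T.parent e) then
          scale T S σ f e / scale T S σ f (T.parent e) else 0 := by
      split_ifs with h
      · rw [← h, hf.form_col (σ := σ) hT h1, OnePoint.elim_some, ← hi, scale_gapVertex hT hσ, hi,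
          ← h]
        simp [div_eq_mul_inv, mul_comm]
      · rw [hf.form_above_of_ne h1 hpe h, OnePoint.elim_infty]
    simp only [h1, h2, not_true_eq_false, not_false_eq_true, false_and, true_and, false_or]
    constructor
    · rintro ⟨i', v, hi', rfl, rfl⟩
      obtain rfl := hT.gapVertex_injective hσ (hi'.trans hi.symm)
      rw [hi', key]
    · rintro rfl
      exact ⟨i, _, hi, rfl, by rw [hi, key]⟩
  · obtain ⟨i, hi⟩ := hT.exists_gapVertex_eq hσ h1
    have key : (S.form (f e)).elim 0 (fun c => c * S.gap σ (f e) i) =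
        if f e = f (T.parent e) then
          scale T S σ f e / scale T S σ f (T.parent e) else 0 := by
      split_ifs with h
      · rw [h, hf.form_col (σ := σ) hT h2, OnePoint.elim_some, ← hi, scale_gapVertex hT hσ, hi, h]
        simp [div_eq_mul_inv, mul_comm]
      · rw [hf.form_below_of_ne h2 hpe h, OnePoint.elim_some, zero_mul]
    simp only [h1, h2, not_true_eq_false, not_false_eq_true, false_and, true_and, false_or,
      or_false]
    constructor
    · rintro ⟨i', v, hi', rfl, rfl⟩
      obtain rfl := hT.gapVertex_injective hσ (hi'.trans hi.symm)
      rw [hi', key]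
    · rintro rfl
      exact ⟨i, _, hi, rfl, by rw [hi, key]⟩
  · obtain ⟨i, hi⟩ := hT.exists_gapVertex_eq hσ h1
    obtain ⟨j, hj⟩ := hT.exists_gapVertex_eq hσ h2
    have key : S.gap σ (f (T.parent e)) i / S.gap σ (f (T.parent e)) j =
        if f e = f (T.parent e) then
          scale T S σ f e / scale T S σ f (T.parent e) else 0 := by
      split_ifs with h
      · have h3 := scale_gapVertex (S := S) (f := f) hT hσ i
        have h4 := scale_gapVertex (S := S) (f := f) hT hσ j
        rw [hi, h] at h3
        rw [hj] at h4
        rw [h3, h4]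
      · rw [hf.gap_eq_zero (hi ▸ hpe) (hi.symm ▸ h), zero_div]
    simp only [h1, h2, not_false_eq_true, false_and, true_and, or_false]
    constructor
    · rintro ⟨i', j', v, hi', hj', rfl, -, -, rfl⟩
      obtain rfl := hT.gapVertex_injective hσ (hi'.trans hi.symm)
      obtain rfl := hT.gapVertex_injective hσ (hj'.trans hj.symm)
      rw [hj', key]
    · rintro rfl
      have h3 := isAbove_meet_iff.1 (hi ▸ hpe : T.IsAbove (T.parent e) (T.gapVertex σ i))
      exact ⟨i, j, _, hi, hj, rfl, hj ▸ hf.isAbove_leaf h3.1, hj ▸ hf.isAbove_leaf h3.2,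
        by rw [hj, key]⟩

open Classical in
theorem simpleRatio_eq (hf : IsContraction T S f) (hT : T.IsMaximal) (hσ : T.IsPlanar σ)
    (e : T.Edge) : S.simpleRatio T σ e = if f e.1 = f (T.parent e.1) then
      scale T S σ f e.1 / scale T S σ f (T.parent e.1) else 0 := by
  rw [Curve.simpleRatio, funext fun w => propext (hf.isSimpleRatio_iff hT hσ e w)]
  exact Classical.epsilon_singleton _

/-- Sizes never vanish, so a zero simple ratio detects exactly an uncontracted edge: the labels
remember the combinatorial type. -/
theorem eq_parent_iff (hf : IsContraction T S f) (hT : T.IsMaximal) (hσ : T.IsPlanar σ)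
    {v : T.V} (hv : v ≠ T.root) :
    f v = f (T.parent v) ↔ label (S.simpleRatio T σ) v ≠ 0 := by
  classical
  rw [label_edge _ ⟨v, hv⟩, hf.simpleRatio_eq hT hσ, ite_ne_right_iff]
  exact (and_iff_left (div_ne_zero (hf.scale_ne_zero hT hσ _) (hf.scale_ne_zero hT hσ _))).symm

open Classical in
theorem pathProd_eq (hf : IsContraction T S f) (hT : T.IsMaximal) (hσ : T.IsPlanar σ)
    {a v : T.V} (h : T.IsAbove a v) : T.pathProd (S.simpleRatio T σ) v a =
      if f v = f a then scale T S σ f v / scale T S σ f a else 0 := by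
  refine IsAbove.rec_parent (P := fun v => T.pathProd (S.simpleRatio T σ) v a =
      if f v = f a then scale T S σ f v / scale T S σ f a else 0) ?_
    (fun v hr hva hav ih => ?_) h
  · rw [pathProd_self, if_pos rfl, div_self (hf.scale_ne_zero hT hσ a)]
  · rw [pathProd_parent _ (hav.trans (isAbove_parent v)) hva, ih, label_edge _ ⟨v, hr⟩,
      hf.simpleRatio_eq hT hσ]
    by_cases h1 : f v = f a
    · have h2 := hf.eq_parent_of_eq hav h1
      rw [if_pos h2, if_pos (h2.symm.trans h1), if_pos h1,
        div_mul_div_cancel₀ (hf.scale_ne_zero hT hσ _)]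
    · rw [if_neg h1]
      by_cases h2 : f v = f (T.parent v)
      · rw [if_neg (fun h => h1 (h2.trans h)), mul_zero]
      · rw [if_neg h2, zero_mul]

theorem gap_eq (hf : IsContraction T S f) (hT : T.IsMaximal) (hσ : T.IsPlanar σ) {p : Fin m}
    {u : T.V} (hu : T.IsAbove u (T.gapVertex σ p)) : S.gap σ (f u) p =
      scale T S σ f u * T.pathProd (S.simpleRatio T σ) (T.gapVertex σ p) u := by
  classical
  rw [hf.pathProd_eq hT hσ hu]
  split_ifs with h
  · rw [mul_div_cancel₀ _ (hf.scale_ne_zero hT hσ u), scale_gapVertex hT hσ, h]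
  · rw [mul_zero, hf.gap_eq_zero hu h]

/-- Summing the gaps between the two leaves shows that the true coordinate on `f u` differs from
`lpos` by an affine map with slope the size of `u`. -/
theorem pos_sub (hf : IsContraction T S f) (hT : T.IsMaximal) (hσ : T.IsPlanar σ) {u : T.V}
    {i j : Fin (m + 1)} (hi : T.IsAbove u (T.leaf (σ i))) (hj : T.IsAbove u (T.leaf (σ j))) :
    S.pos (f u) (σ j) - S.pos (f u) (σ i) = scale T S σ f u *
      (T.lpos σ (S.simpleRatio T σ) u j - T.lpos σ (S.simpleRatio T σ) u i) := by
  have key : ∀ i j, i ≤ j → T.IsAbove u (T.leaf (σ i)) → T.IsAbove u (T.leaf (σ j)) →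
      S.pos (f u) (σ j) - S.pos (f u) (σ i) = scale T S σ f u *
        (T.lpos σ (S.simpleRatio T σ) u j - T.lpos σ (S.simpleRatio T σ) u i) := by
    intro i j hij hi hj
    rw [ColoredTree.lpos_sub _ _ hij, ← Curve.sum_gap (F := fun i => S.pos (f u) (σ i)) hij,
      Finset.mul_sum]
    refine Finset.sum_congr rfl fun p hp => ?_
    simp only [Finset.mem_filter, Finset.mem_univ, true_and] at hp
    exact hf.gap_eq hT hσ (hσ.isAbove_gapVertex hi hj hp.1 hp.2)
  rcases le_total i j with h | h
  · exact key i j h hi hj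
  · rw [← neg_sub, key j i h hj hi]
    ring

/-- If the path from `c` to `v` is contracted, the product telescopes to the size of `c`. If not, it
is zero, and `P1.mk 1 0 = ∞` is the correct form. -/
theorem form_above (hf : IsContraction T S f) (hT : T.IsMaximal) (hσ : T.IsPlanar σ) {c v : T.V}
    (hc : c ∈ T.col) (h : T.IsAbove v c) : S.form (f v) =
      P1.mk 1 (scale T S σ f v * T.pathProd (S.simpleRatio T σ) c v) := by
  classical
  rw [hf.pathProd_eq hT hσ h]
  split_ifs with h1
  · rw [mul_div_cancel₀ _ (hf.scale_ne_zero hT hσ v), ← h1, hf.form_col (σ := σ) hT hc, P1.mk,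
      if_neg (hf.scale_ne_zero hT hσ c), one_div]
  · rw [mul_zero, P1.mk, if_pos rfl, hf.form_above_of_ne hc h h1]

theorem form_below (hf : IsContraction T S f) (hT : T.IsMaximal) (hσ : T.IsPlanar σ) {c v : T.V}
    (hc : c ∈ T.col) (h : T.IsAbove c v) : S.form (f v) =
      ((T.pathProd (S.simpleRatio T σ) v c / scale T S σ f v : ℂ) : OnePoint ℂ) := by
  classical
  rw [hf.pathProd_eq hT hσ h]
  split_ifs with h1
  · rw [h1, hf.form_col (σ := σ) hT hc, div_right_comm, div_self (hf.scale_ne_zero hT hσ v),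
      one_div]
  · rw [zero_div, hf.form_below_of_ne hc h h1]

theorem _root_.ScaledLine.P1.mk_one_injective : Function.Injective (P1.mk 1) := by
  intro a b h
  unfold P1.mk at h
  split_ifs at h with h1 h2 h2
  · rw [h1, h2]
  · exact absurd h (OnePoint.infty_ne_coe _)
  · exact absurd h (OnePoint.coe_ne_infty _)
  · simpa using OnePoint.coe_injective h

/-- Balance expresses that the form on `f v` is one number, whichever colored vertex it is computed
from; the open condition expresses that two markings are distinct where their paths meet. -/
theorem simpleRatio_mem (hf : IsContraction T S f) (hT : T.IsMaximal) (hσ : T.IsPlanar σ) :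
    S.simpleRatio T σ ∈ T.balancedStar σ := by
  refine ColoredTree.mem_balancedStar_iff.2 ⟨hT.balanced_iff.2 fun v c c' hc hc' h h' => ?_,
    fun i j hij heq => ?_⟩
  · refine mul_left_cancel₀ (hf.scale_ne_zero hT hσ v) (P1.mk_one_injective ?_)
    rw [← hf.form_above hT hσ hc h, ← hf.form_above hT hσ hc' h']
  · have h1 := hf.pos_sub hT hσ (isAbove_meet_left (σ i) (σ j)) (isAbove_meet_right (σ i) (σ j))
    rw [heq, sub_self, mul_zero] at h1
    exact (hf.separates_iff.2 ⟨σ.injective.ne hij, rfl⟩).2.2 (sub_eq_zero.1 h1).symm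

end IsContraction

end ScaledLine

namespace ScaledLine

open MarkedTree

/-! ### Contracting the edges with nonzero label -/

namespace MarkedTree

variable {m : ℕ} {T : MarkedTree m} {l : T.Edge → ℂ}

theorem exists_label_eq_zero (l : T.Edge → ℂ) (v : T.V) :
    {k : ℕ | label l (T.parent^[k] v) = 0}.Nonempty := by
  obtain ⟨k, hk⟩ := T.reach v
  exact ⟨k, by rw [Set.mem_ofPred_eq, hk, label_root]⟩

/-- The first vertex on the path from `v` to the root that is the root or the lower end of an edge
with label zero. -/
noncomputable def top (l : T.Edge → ℂ) (v : T.V) : T.V :=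
  T.parent^[sInf {k : ℕ | label l (T.parent^[k] v) = 0}] v

theorem isAbove_top (v : T.V) : T.IsAbove (top l v) v := ⟨_, rfl⟩

theorem label_top (v : T.V) : label l (top l v) = 0 := Nat.sInf_mem (exists_label_eq_zero l v)

theorem IsAbove.top {a v : T.V} (h : T.IsAbove a v) (ha : label l a = 0) :
    T.IsAbove a (top l v) := by
  obtain ⟨k, rfl⟩ := h
  obtain ⟨d, hd⟩ := Nat.exists_eq_add_of_le'
    (Nat.sInf_le ha : sInf {k : ℕ | label l (T.parent^[k] v) = 0} ≤ k)
  exact ⟨d, by rw [MarkedTree.top, ← Function.iterate_add_apply, ← hd]⟩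

theorem top_eq_self {v : T.V} (h : label l v = 0) : top l v = v :=
  (isAbove_top v).antisymm ((IsAbove.refl v).top h)

theorem top_eq_iff {a v : T.V} (h : T.IsAbove a v) (ha : label l a = 0) :
    top l v = a ↔ T.pathProd l v a ≠ 0 := by
  rw [pathProd_ne_zero_iff l h]
  constructor
  · rintro rfl w hw hw' hne h0
    exact hne ((hw.top h0).antisymm hw')
  · intro h'
    by_contra hne
    exact h' _ (isAbove_top v) (h.top ha) hne (label_top v)

theorem top_parent {v : T.V} (hv : label l v ≠ 0) : top l (T.parent v) = top l v := by
  have hne : v ≠ top l v := by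
    intro h
    exact hv (h ▸ label_top v)
  exact (((isAbove_top (l := l) _).trans (isAbove_parent v)).top (label_top _)).antisymm
    (((isAbove_top v).parent hne).top (label_top v))

theorem top_eq_top_parent_iff {v : T.V} (hv : v ≠ T.root) :
    top l v = top l (T.parent v) ↔ label l v ≠ 0 := by
  refine ⟨fun h h0 => ?_, fun h => (top_parent h).symm⟩
  have h1 := isAbove_top (l := l) (T.parent v)
  rw [← h, top_eq_self h0] at h1
  exact not_isAbove_parent hv h1

/-- Walking up in `T`, an edge with nonzero label does not change `top`, and an edge with label zero
is one step of the contracted parent map. Hence the contracted order is the restriction of the old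
one. -/
theorem exists_iterate_top {a v : T.V} (h : T.IsAbove a v) (ha : label l a = 0) :
    ∃ k : ℕ, (fun w : {v : T.V // label l v = 0} =>
      (⟨top l (T.parent w.1), label_top _⟩ : {v : T.V // label l v = 0}))^[k]
        ⟨top l v, label_top v⟩ = ⟨a, ha⟩ := by
  refine IsAbove.rec_parent (P := fun v => ∃ k : ℕ, (fun w : {v : T.V // label l v = 0} =>
      (⟨top l (T.parent w.1), label_top _⟩ : {v : T.V // label l v = 0}))^[k]
        ⟨top l v, label_top v⟩ = ⟨a, ha⟩) ⟨0, Subtype.ext (top_eq_self ha)⟩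
    (fun v hr hva hav ih => ?_) h
  by_cases hv : label l v = 0
  · obtain ⟨k, hk⟩ := ih
    refine ⟨k + 1, ?_⟩
    rw [Function.iterate_succ_apply]
    simpa only [top_eq_self hv] using hk
  · simpa only [top_parent hv] using ih

/-- The tree obtained by contracting the edges with nonzero label. -/
noncomputable def contract (T : MarkedTree m) (l : T.Edge → ℂ) : MarkedTree m where
  V := {v : T.V // label l v = 0}
  finite := have := T.finite; inferInstance
  root := ⟨T.root, label_root l⟩
  parent w := ⟨top l (T.parent w.1), label_top _⟩
  parent_root := Subtype.ext <| show top l (T.parent T.root) = T.root by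
    rw [T.parent_root, top_eq_self (label_root l)]
  reach v := by
    have h := exists_iterate_top (isAbove_root v.1) (label_root l)
    simpa only [top_eq_self v.2] using h
  leaf i := ⟨top l (T.leaf i), label_top _⟩

/-- The contraction map. -/
noncomputable def toContract (l : T.Edge → ℂ) (v : T.V) : (T.contract l).V :=
  ⟨top l v, label_top v⟩

theorem toContract_coe (v : (T.contract l).V) : toContract l v.1 = v :=
  Subtype.ext (top_eq_self v.2)

theorem contract_isAbove_iff {a v : (T.contract l).V} :
    (T.contract l).IsAbove a v ↔ T.IsAbove a.1 v.1 := by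
  constructor
  · intro h
    refine IsAbove.rec_parent (T := T.contract l) (P := fun v => T.IsAbove a.1 v.1) (.refl _)
      (fun v _ _ _ ih => ?_) h
    exact ih.trans ((isAbove_top _).trans (isAbove_parent v.1))
  · intro h
    have h := exists_iterate_top h a.2
    simp only [top_eq_self v.2] at h
    exact h

theorem contract_isAbove_leaf_iff {a : (T.contract l).V} {i : Fin (m + 1)} :
    (T.contract l).IsAbove a ((T.contract l).leaf i) ↔ T.IsAbove a.1 (T.leaf i) :=
  contract_isAbove_iff.trans ⟨fun h => h.trans (isAbove_top _), fun h => h.top a.2⟩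

theorem contract_meet (i j : Fin (m + 1)) :
    (T.contract l).meet i j = toContract l (T.meet i j) := by
  refine IsAbove.antisymm (T := T.contract l) ?_ ?_
  · refine contract_isAbove_iff.2 (IsAbove.top (isAbove_meet ?_ ?_)
      ((T.contract l).meet i j).2)
    · exact contract_isAbove_leaf_iff.1 (isAbove_meet_left i j)
    · exact contract_isAbove_leaf_iff.1 (isAbove_meet_right i j)
  · refine isAbove_meet (contract_isAbove_leaf_iff.2 ?_) (contract_isAbove_leaf_iff.2 ?_)
    · exact (isAbove_top _).trans (isAbove_meet_left i j)
    · exact (isAbove_top _).trans (isAbove_meet_right i j)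

end MarkedTree

/-! ### The curve with given simple ratios -/

namespace ColoredTree

variable {m : ℕ} {T : ColoredTree m} {σ : Equiv.Perm (Fin (m + 1))} {l : T.Edge → ℂ}

/-- Leaves in different branches at `u` have a meet in `T` that is contracted to `u`. Their
difference at `u` is the one at the meet, nonzero by the open condition, times a product of nonzero
labels. -/
theorem lpos_ne (hσ : T.IsPlanar σ) (hl : l ∈ T.balancedStar σ)
    {u : (T.contract l).V} {i j : Fin (m + 1)} {b b' : Branch u} (hi : Leads b (σ i))
    (hj : Leads b' (σ j)) (hb : b ≠ b') : T.lpos σ l u.1 i ≠ T.lpos σ l u.1 j := by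
  obtain ⟨h1, rfl⟩ := hi.meet_eq hj hb
  rw [contract_meet]
  intro h2
  change T.lpos σ l (top l _) i = T.lpos σ l (top l _) j at h2
  have h3 := hσ.lpos_sub_mul l (isAbove_meet_left (σ i) (σ j)) (isAbove_meet_right (σ i) (σ j))
    (isAbove_top (l := l) _)
  rw [sub_eq_zero.2 h2.symm, eq_comm, mul_eq_zero, sub_eq_zero] at h3
  rcases h3 with h3 | h3
  · exact (mem_balancedStar_iff.1 hl).2 i j (fun h => h1 (congrArg σ h)) h3
  · exact (top_eq_iff (isAbove_top _) (label_top _)).1 rfl h3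

/-- The zero label at `w` kills all differences behind it; hence the node of `curve` does not depend
on the leaf chosen to place it. -/
theorem lpos_parent_eq (hσ : T.IsPlanar σ) {w : T.V} (hw : w ≠ T.root) (h0 : label l w = 0)
    {i j : Fin (m + 1)} (hi : T.IsAbove w (T.leaf (σ i))) (hj : T.IsAbove w (T.leaf (σ j))) :
    T.lpos σ l (top l (T.parent w)) i = T.lpos σ l (top l (T.parent w)) j := by
  have h1 := isAbove_top (l := l) (T.parent w)
  have h2 := hσ.lpos_sub_mul l hj hi (h1.trans (isAbove_parent w))
  rw [pathProd_parent l (h1.trans (isAbove_parent w)), h0, zero_mul, mul_zero, sub_eq_zero] at h2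
  · exact h2
  · intro h
    rw [← h] at h1
    exact not_isAbove_parent hw h1

open Classical in
/-- The form `1 / y` at the vertex `v`, in the coordinate in which the gap at `v` has length `1`
(or `y = 1` if `v` is colored). -/
noncomputable def lform (hT : T.IsMaximal) (l : T.Edge → ℂ) (v : T.V) : OnePoint ℂ :=
  if h : T.BehindCol v then ((0 : ℂ) : OnePoint ℂ)
    else P1.mk 1 (T.pathProd l (hT.exists_col_below h).choose v)

theorem lform_behindCol (hT : T.IsMaximal) {v : T.V} (h : T.BehindCol v) :
    lform hT l v = ((0 : ℂ) : OnePoint ℂ) := dif_pos h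

theorem lform_above (hT : T.IsMaximal) (hl : l ∈ T.balanced) {v c : T.V} (hc : c ∈ T.col)
    (h : T.IsAbove v c) : lform hT l v = P1.mk 1 (T.pathProd l c v) := by
  have hv := hT.not_behindCol hc h
  rw [lform, dif_neg hv]
  obtain ⟨h1, h2⟩ := (hT.exists_col_below hv).choose_spec
  rw [hT.balanced_iff.1 hl v _ c h1 hc h2 h]

theorem _root_.ScaledLine.P1.mk_one_ne_zero (z : ℂ) : P1.mk 1 z ≠ ((0 : ℂ) : OnePoint ℂ) := by
  unfold P1.mk
  split_ifs with h
  · exact OnePoint.infty_ne_coe 0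
  · intro h'
    exact one_div_ne_zero h (OnePoint.coe_injective h')

theorem _root_.ScaledLine.P1.mk_one_ne_infty_iff {z : ℂ} : P1.mk 1 z ≠ ∞ ↔ z ≠ 0 := by
  unfold P1.mk
  split_ifs with h
  · simp [h]
  · simp [h]

theorem lform_col (hT : T.IsMaximal) (hl : l ∈ T.balanced) {c : T.V} (hc : c ∈ T.col) :
    lform hT l c = ((1 : ℂ) : OnePoint ℂ) := by
  rw [lform_above hT hl hc (.refl c), pathProd_self, P1.mk, if_neg one_ne_zero, div_one]

/-- The form is nondegenerate exactly at the images of the colored vertices. -/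
theorem lform_nondegenerate_iff (hT : T.IsMaximal) (hl : l ∈ T.balanced) {v : T.V}
    (hv : label l v = 0) : (lform hT l v ≠ ((0 : ℂ) : OnePoint ℂ) ∧ lform hT l v ≠ ∞) ↔
      ∃ c ∈ T.col, top l c = v := by
  constructor
  · rintro ⟨h1, h2⟩
    have h3 : ¬ T.BehindCol v := fun h => h1 (lform_behindCol hT h)
    obtain ⟨c, hc, hvc⟩ := hT.exists_col_below h3
    rw [lform_above hT hl hc hvc, P1.mk_one_ne_infty_iff] at h2
    exact ⟨c, hc, (top_eq_iff hvc hv).2 h2⟩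
  · rintro ⟨c, hc, rfl⟩
    rw [lform_above hT hl hc (isAbove_top c), P1.mk_one_ne_infty_iff]
    exact ⟨P1.mk_one_ne_zero _, (top_eq_iff (isAbove_top c) hv).1 rfl⟩

/-- The stable nodal scaled line with the simple ratios `l`. -/
noncomputable def curve (hT : T.IsMaximal) (hσ : T.IsPlanar σ) (hl : l ∈ T.balancedStar σ) :
    Curve m where
  toMarkedTree := T.contract l
  node v := T.lpos σ l (top l (T.parent v.1)) (hT.exists_leaf (σ := σ) v.1).choose
  mark i := T.lpos σ l (top l (T.leaf i)) (σ.symm i)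
  form v := lform hT l v.1
  node_inj v w hv hw hvw h := by
    by_contra hne
    have h1 := contract_isAbove_leaf_iff.2 (hT.exists_leaf (σ := σ) v.1).choose_spec
    have h2 := contract_isAbove_leaf_iff.2 (hT.exists_leaf (σ := σ) w.1).choose_spec
    refine lpos_ne hσ hl (b := Sum.inl ⟨v, hv, rfl⟩) (b' := Sum.inl ⟨w, hw, hvw.symm⟩) h1 h2
      (by simpa using hne) ?_
    have h3 : top l (T.parent v.1) = top l (T.parent w.1) := congrArg Subtype.val hvw
    exact h.trans (by rw [← h3]; rfl)
  mark_inj i j hij h := by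
    by_contra hne
    have h3 : top l (T.leaf i) = top l (T.leaf j) := congrArg Subtype.val hij
    refine lpos_ne hσ hl (u := (T.contract l).leaf i) (b := Sum.inr ⟨i, rfl⟩)
      (b' := Sum.inr ⟨j, hij.symm⟩) (i := σ.symm i) (j := σ.symm j)
      (σ.apply_symm_apply i) (σ.apply_symm_apply j) (by simpa using hne) ?_
    exact h.trans (by rw [← h3]; rfl)
  node_ne_mark v i hv hvi h := by
    have h1 := contract_isAbove_leaf_iff.2 (hT.exists_leaf (σ := σ) v.1).choose_spec
    have h3 : top l (T.parent v.1) = top l (T.leaf i) := congrArg Subtype.val hvi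
    refine lpos_ne hσ hl (u := (T.contract l).leaf i) (b := Sum.inl ⟨v, hv, hvi⟩)
      (b' := Sum.inr ⟨i, rfl⟩) (j := σ.symm i) h1 (σ.apply_symm_apply i) (by simp) ?_
    exact Eq.trans (by rw [h3]; rfl) h
  form_parent v hv h := by
    have h1 : ¬ T.BehindCol v.1 := fun h' => h (lform_behindCol hT h')
    obtain ⟨c, hc, hvc⟩ := hT.exists_col_below h1
    have h2 : T.IsAbove (top l (T.parent v.1)) v.1 := (isAbove_top _).trans (isAbove_parent _)
    have h4 : v.1 ≠ T.root := fun h' => hv (Subtype.ext h')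
    change lform hT l (top l (T.parent v.1)) = ∞
    -- The path from `c` to the component above crosses the edge at `v`, whose label is zero, so the
    -- form there is `P1.mk 1 0 = ∞`.
    rw [lform_above hT hl.1 hc (h2.trans hvc), ← pathProd_mul l hvc h2, pathProd_parent l h2, v.2,
      zero_mul, mul_zero, P1.mk, if_pos rfl]
    intro h3
    have h5 := isAbove_top (l := l) (T.parent v.1)
    rw [← h3] at h5
    exact not_isAbove_parent h4 h5
  form_unique i := by
    obtain ⟨c, ⟨hc, hci⟩, hcu⟩ := T.col_unique i
    refine ⟨toContract l c, ⟨(lform_nondegenerate_iff hT hl.1 (label_top c)).2 ⟨c, hc, rfl⟩,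
      contract_isAbove_leaf_iff.2 ((isAbove_top c).trans hci)⟩, ?_⟩
    rintro v ⟨hv, hvi⟩
    have hvi := contract_isAbove_leaf_iff.1 hvi
    have hvb : ¬ T.BehindCol v.1 := fun h => hv.1 (lform_behindCol hT h)
    have hvc : T.IsAbove v.1 c := by
      rcases hvi.total hci with h | h
      · exact h
      · by_cases hcv : c = v.1
        · exact hcv ▸ .refl _
        · exact absurd ⟨c, hc, h, hcv⟩ hvb
    have h2 := hv.2
    rw [lform_above hT hl.1 hc hvc, P1.mk_one_ne_infty_iff, ← top_eq_iff hvc v.2] at h2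
    exact Subtype.ext h2.symm
  stable v := by
    refine ⟨fun _ => ?_, fun h => ?_⟩
    · obtain ⟨i, hi⟩ := hT.exists_leaf (σ := σ) v.1
      exact two_le_valence (contract_isAbove_leaf_iff.2 hi)
    -- A colored vertex has form `1`, so a degenerate component comes from a trivalent vertex. That
    -- vertex is the meet of two leaves and remains one after contraction, which gives valence at
    -- least three.
    · have hv : v.1 ∉ T.col := by
        intro hv
        rw [lform_col hT hl.1 hv] at h
        rcases h with h | h
        · exact one_ne_zero (OnePoint.coe_injective h)
        · exact OnePoint.coe_ne_infty _ h
      obtain ⟨i, j, hij, hm⟩ := exists_meet_eq hT.two_le_valence (hT.2 v.1 hv).ge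
      have h1 := three_le_valence (T := T.contract l) hij
      rwa [contract_meet, hm, toContract_coe] at h1

variable {hT : T.IsMaximal} {hσ : T.IsPlanar σ} {hl : l ∈ T.balancedStar σ}

theorem curve_pos {v : (curve hT hσ hl).V} {i : Fin (m + 1)}
    (h : (curve hT hσ hl).IsAbove v ((curve hT hσ hl).leaf (σ i))) :
    (curve hT hσ hl).pos v (σ i) = T.lpos σ l v.1 i := by
  by_cases hv : (curve hT hσ hl).leaf (σ i) = v
  · subst hv
    rw [Curve.pos_leaf]
    change T.lpos σ l _ (σ.symm (σ i)) = _
    rw [Equiv.symm_apply_apply]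
    rfl
  · obtain ⟨w, hw, rfl, hwi⟩ := h.exists_child hv
    rw [Curve.pos_parent hw hwi]
    exact lpos_parent_eq hσ (fun h => hw (Subtype.ext h)) w.2
      (hT.exists_leaf (σ := σ) w.1).choose_spec (contract_isAbove_leaf_iff.1 hwi)

/-- The contraction map to the type of the curve. -/
noncomputable def toCurve (hT : T.IsMaximal) (hσ : T.IsPlanar σ) (hl : l ∈ T.balancedStar σ) :
    T.V → (curve hT hσ hl).V := toContract l

theorem isContraction_curve : IsContraction T (curve hT hσ hl) (toCurve hT hσ hl) where
  surj v := ⟨v.1, toContract_coe v⟩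
  root := Subtype.ext (top_eq_self (label_root l))
  leaf _ := rfl
  parent v hv := by
    by_cases h : label l v = 0
    · refine Or.inr ⟨fun h' => hv ?_, Subtype.ext ?_⟩
      · rw [← top_eq_self h]
        exact congrArg Subtype.val h'
      · change top l (T.parent (top l v)) = top l (T.parent v)
        rw [top_eq_self h]
    · exact Or.inl (Subtype.ext (top_parent h).symm)
  inj v w hv hw hv' hw' h := by
    have h1 : label l v = 0 := by
      by_contra h1
      exact hv' (Subtype.ext (top_parent h1).symm)
    have h2 : label l w = 0 := by
      by_contra h2
      exact hw' (Subtype.ext (top_parent h2).symm)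
    rw [← top_eq_self h1, ← top_eq_self h2]
    exact congrArg Subtype.val h
  col := by
    ext v
    refine (lform_nondegenerate_iff hT hl.1 v.2).trans ?_
    exact exists_congr fun c => and_congr_right fun _ =>
      ⟨fun h => Subtype.ext h, fun h => congrArg Subtype.val h⟩

/-- The coordinate on a component is normalized so that the topmost vertex contracted to it has size
`1`; the sizes of the others are the path products up to it. -/
theorem curve_scale (v : T.V) : IsContraction.scale T (curve hT hσ hl) σ (toCurve hT hσ hl) v =
    T.pathProd l v (top l v) := by
  by_cases hv : v ∈ T.col
  · have h1 : T.pathProd l v (top l v) ≠ 0 := (top_eq_iff (isAbove_top v) (label_top v)).1 rfl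
    rw [IsContraction.scale_col hT hv]
    change (lform hT l (top l v)).elim 0 _ = _
    rw [lform_above hT hl.1 hv (isAbove_top v), P1.mk, if_neg h1, OnePoint.elim_some, one_div,
      inv_inv]
  · obtain ⟨p, rfl⟩ := hT.exists_gapVertex_eq hσ hv
    rw [IsContraction.scale_gapVertex hT hσ, Curve.gap, curve_pos, curve_pos,
      lpos_succ_sub]
    · rfl
    · exact contract_isAbove_leaf_iff.2 ((isAbove_top _).trans (isAbove_meet_left _ _))
    · exact contract_isAbove_leaf_iff.2 ((isAbove_top _).trans (isAbove_meet_right _ _))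

theorem curve_simpleRatio : (curve hT hσ hl).simpleRatio T σ = l := by
  funext e
  rw [isContraction_curve.simpleRatio_eq hT hσ, curve_scale, curve_scale]
  have h1 : toCurve hT hσ hl e.1 = toCurve hT hσ hl (T.parent e.1) ↔ label l e.1 ≠ 0 := by
    rw [← top_eq_top_parent_iff e.2]
    exact ⟨fun h => congrArg Subtype.val h, fun h => Subtype.ext h⟩
  by_cases h : label l e.1 = 0
  · rw [if_neg (by rw [h1]; simpa using h), ← label_edge l e, h]
  · have h2 := (isAbove_top (l := l) (T.parent e.1)).trans (isAbove_parent e.1)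
    rw [if_pos (h1.2 h), ← top_parent h, pathProd_parent l h2, mul_div_cancel_right₀, label_edge]
    · exact (top_eq_iff (isAbove_top _) (label_top _)).1 rfl
    · intro h3
      have h5 := isAbove_top (l := l) (T.parent e.1)
      rw [← h3] at h5
      exact not_isAbove_parent e.2 h5

end ColoredTree

open ColoredTree

/-! ### Recovering a curve from its simple ratios -/

variable {m : ℕ} {T : ColoredTree m} {S : Curve m} {f : T.V → S.V}
  {σ : Equiv.Perm (Fin (m + 1))}

theorem IsContraction.apply_top (hf : IsContraction T S f) (hT : T.IsMaximal)
    (hσ : T.IsPlanar σ) (v : T.V) : f (top (S.simpleRatio T σ) v) = f v := by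
  classical
  have h1 : T.pathProd (S.simpleRatio T σ) v (top (S.simpleRatio T σ) v) ≠ 0 :=
    (top_eq_iff (isAbove_top v) (label_top v)).1 rfl
  rw [hf.pathProd_eq hT hσ (isAbove_top v), ite_ne_right_iff] at h1
  exact h1.1.symm

/-- The components of a curve correspond to the root and the edges with simple ratio zero. -/
theorem IsContraction.bijective_val (hf : IsContraction T S f) (hT : T.IsMaximal)
    (hσ : T.IsPlanar σ) : Function.Bijective fun v : (T.contract (S.simpleRatio T σ)).V =>
      f v.1 := by
  have h0 : ∀ v : (T.contract (S.simpleRatio T σ)).V, v.1 ≠ T.root → f v.1 ≠ f (T.parent v.1) :=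
    fun v hv h => (hf.eq_parent_iff hT hσ hv).1 h v.2
  constructor
  · intro v w h
    refine Subtype.ext ?_
    by_cases hv : v.1 = T.root <;> by_cases hw : w.1 = T.root
    · rw [hv, hw]
    · refine absurd ?_ ((hf.parent w.1 hw).resolve_left (h0 w hw)).1
      rw [← hf.root, ← hv]
      exact h.symm
    · refine absurd ?_ ((hf.parent v.1 hv).resolve_left (h0 v hv)).1
      rw [← hf.root, ← hw]
      exact h
    · exact hf.inj _ _ hv hw (h0 v hv) (h0 w hw) h
  · intro w
    obtain ⟨v, rfl⟩ := hf.surj w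
    exact ⟨toContract _ v, hf.apply_top hT hσ v⟩

/-- A curve is determined by its simple ratios. -/
noncomputable def IsContraction.iso (hf : IsContraction T S f) (hT : T.IsMaximal)
    (hσ : T.IsPlanar σ) :
    Curve.Iso (curve hT hσ (hf.simpleRatio_mem hT hσ)) S := by
  -- The affine isomorphism on each component: its slope is the size of the vertex, and its
  -- translation is fixed by matching one reference leaf.
  have hpos : ∀ (v : T.V) (i : Fin (m + 1)), T.IsAbove v (T.leaf (σ i)) → S.pos (f v) (σ i) =
      scale T S σ f v * T.lpos σ (S.simpleRatio T σ) v i +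
        (S.pos (f v) (σ (hT.exists_leaf (σ := σ) v).choose) - scale T S σ f v *
          T.lpos σ (S.simpleRatio T σ) v (hT.exists_leaf (σ := σ) v).choose) := by
    intro v i hi
    have := hf.pos_sub hT hσ (hT.exists_leaf (σ := σ) v).choose_spec hi
    linear_combination this
  refine
    { ψ := Equiv.ofBijective _ (hf.bijective_val hT hσ)
      a := fun v => scale T S σ f v.1
      b := fun v => S.pos (f v.1) (σ (hT.exists_leaf (σ := σ) v.1).choose) - scale T S σ f v.1 *
          T.lpos σ (S.simpleRatio T σ) v.1 (hT.exists_leaf (σ := σ) v.1).choose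
      a_ne := fun v => hf.scale_ne_zero hT hσ v.1
      root := hf.root
      parent := ?_
      leaf := ?_
      node := ?_
      mark := ?_
      form := ?_ }
  · intro v
    change S.parent (f v.1) = f (top _ (T.parent v.1))
    rw [hf.apply_top hT hσ]
    by_cases hv : v.1 = T.root
    · rw [hv, T.parent_root, hf.root, S.parent_root]
    · exact ((hf.parent v.1 hv).resolve_left
        fun h => (hf.eq_parent_iff hT hσ hv).1 h v.2).2
  · intro i
    change S.leaf i = f (top _ (T.leaf i))
    rw [hf.apply_top hT hσ, hf.leaf]
  · intro v hv
    have hv' : v.1 ≠ T.root := fun h => hv (Subtype.ext h)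
    have h1 := (hf.parent v.1 hv').resolve_left fun h => (hf.eq_parent_iff hT hσ hv').1 h v.2
    obtain hi := (hT.exists_leaf (σ := σ) v.1).choose_spec
    have h2 := hpos (top (S.simpleRatio T σ) (T.parent v.1)) _
      ((isAbove_top _).trans ((isAbove_parent v.1).trans hi))
    refine (Curve.pos_parent h1.1 (hf.isAbove_leaf hi)).symm.trans ?_
    rw [h1.2, ← hf.apply_top hT hσ]
    exact h2
  · intro i
    have h2 := hpos (top (S.simpleRatio T σ) (T.leaf i)) (σ.symm i)
      (by rw [Equiv.apply_symm_apply]; exact isAbove_top _)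
    rw [Equiv.apply_symm_apply] at h2
    rw [← Curve.pos_leaf, ← hf.leaf, ← hf.apply_top hT hσ]
    exact h2
  · intro v
    have ha := hf.scale_ne_zero hT hσ v.1
    have hl := (hf.simpleRatio_mem hT hσ).1
    change S.form (f v.1) = (lform hT _ v.1).map _
    by_cases hv : T.BehindCol v.1
    · obtain ⟨c, hc, h1, h2⟩ := hv
      rw [lform_behindCol hT ⟨c, hc, h1, h2⟩, hf.form_below hT hσ hc h1,
        pathProd_parent _ h1 h2.symm, v.2, zero_mul, OnePoint.map_some]
    · obtain ⟨c, hc, h1⟩ := hT.exists_col_below hv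
      rw [lform_above hT hl hc h1, hf.form_above hT hσ hc h1, P1.mk, P1.mk]
      by_cases h2 : T.pathProd (S.simpleRatio T σ) c v.1 = 0
      · rw [if_pos h2, if_pos (by rw [h2, mul_zero]), OnePoint.map_infty]
      · rw [if_neg h2, if_neg (mul_ne_zero ha h2), OnePoint.map_some]
        congr 1
        field_simp

end ScaledLine

namespace ScaledLine

open MarkedTree

/-! ### Cross-ratios -/

namespace P1

theorem det_self (u : P1) : det u u = 0 := by
  unfold det
  ring

theorem det_eq_zero_iff {u v : P1} : det u v = 0 ↔ u = v := by
  refine ⟨fun h => ?_, fun h => h ▸ det_self v⟩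
  induction u using OnePoint.rec <;> induction v using OnePoint.rec <;> simp [det, hom] at h ⊢
  exact sub_eq_zero.1 h

theorem det_comm (u v : P1) : det u v = -det v u := by
  unfold det
  ring

theorem mk_mul_left {s : ℂ} (hs : s ≠ 0) (a b : ℂ) : mk (s * a) (s * b) = mk a b := by
  unfold mk
  by_cases hb : b = 0
  · simp [hb]
  · rw [if_neg hb, if_neg (mul_ne_zero hs hb), mul_div_mul_left _ _ hs]

theorem mk_div {a b s : ℂ} (hb : b ≠ 0) (h : a = s * b) : mk a b = (s : P1) := by
  rw [mk, if_neg hb, h, mul_div_cancel_right₀ _ hb]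

theorem crossRatio_eq_infty {w : Fin 4 → P1} (h : w 0 = w 1 ∨ w 2 = w 3) : crossRatio w = ∞ := by
  rw [crossRatio, mk, if_pos]
  rcases h with h | h <;> simp [h, det_self]

theorem crossRatio_eq_zero {w : Fin 4 → P1} (h1 : w 0 ≠ w 1) (h2 : w 2 ≠ w 3)
    (h : w 1 = w 2 ∨ w 3 = w 0) : crossRatio w = ((0 : ℂ) : P1) := by
  have h1 := mt det_eq_zero_iff.1 h1
  have h2 := mt det_eq_zero_iff.1 h2
  refine mk_div (mul_ne_zero h1 h2) ?_
  rcases h with h | h <;> simp [h, det_self]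

theorem crossRatio_eq_one {w : Fin 4 → P1} (h1 : w 0 ≠ w 1) (h2 : w 2 ≠ w 3)
    (h : w 0 = w 2 ∨ w 1 = w 3) : crossRatio w = ((1 : ℂ) : P1) := by
  have h1 := mt det_eq_zero_iff.1 h1
  have h2 := mt det_eq_zero_iff.1 h2
  refine mk_div (mul_ne_zero h1 h2) ?_
  rcases h with h | h
  · rw [h, det_comm (w 1), det_comm (w 3)]
    ring
  · rw [h, det_comm (w 3) (w 2), det_comm (w 3) (w 0)]
    ring

/-- The determinant of two pairs of homogeneous coordinates. -/
def pairDet {R : Type*} [CommRing R] (x y : R × R) : R := x.1 * y.2 - x.2 * y.1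

theorem exists_hom_mk {x : ℂ × ℂ} (hx : x ≠ 0) :
    ∃ s : ℂ, s ≠ 0 ∧ (mk x.1 x.2).hom = (s * x.1, s * x.2) := by
  by_cases h : x.2 = 0
  · have h1 : x.1 ≠ 0 := fun h1 => hx (Prod.ext h1 h)
    refine ⟨x.1⁻¹, inv_ne_zero h1, ?_⟩
    rw [mk, if_pos h, h, mul_zero, inv_mul_cancel₀ h1]
    rfl
  · refine ⟨x.2⁻¹, inv_ne_zero h, ?_⟩
    rw [mk, if_neg h, inv_mul_cancel₀ h, mul_comm, ← div_eq_mul_inv]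
    rfl

theorem mk_ne_mk_iff {x y : ℂ × ℂ} (hx : x ≠ 0) (hy : y ≠ 0) :
    mk x.1 x.2 ≠ mk y.1 y.2 ↔ pairDet x y ≠ 0 := by
  obtain ⟨s, hs, hs'⟩ := exists_hom_mk hx
  obtain ⟨t, ht, ht'⟩ := exists_hom_mk hy
  rw [Ne, ← det_eq_zero_iff, ← Ne, det, hs', ht']
  have h1 : s * x.1 * (t * y.2) - s * x.2 * (t * y.1) = s * t * pairDet x y := by
    rw [pairDet]
    ring
  change s * x.1 * (t * y.2) - s * x.2 * (t * y.1) ≠ 0 ↔ _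
  rw [h1]
  simp [hs, ht]

/-- Each point occurs once in the numerator and once in the denominator, so the choice of
homogeneous coordinates cancels. -/
theorem crossRatio_mk {x : Fin 4 → ℂ × ℂ} (hx : ∀ a, x a ≠ 0) :
    crossRatio (fun a => mk (x a).1 (x a).2) =
      mk (pairDet (x 1) (x 2) * pairDet (x 3) (x 0)) (pairDet (x 0) (x 1) * pairDet (x 2) (x 3)) := by
  choose s hs hs' using fun a => exists_hom_mk (hx a)
  have hd : ∀ a b, det (mk (x a).1 (x a).2) (mk (x b).1 (x b).2) = s a * s b * pairDet (x a) (x b) := by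
    intro a b
    rw [det, hs', hs', pairDet]
    ring
  rw [crossRatio, hd, hd, hd, hd]
  refine Eq.trans ?_ (mk_mul_left (mul_ne_zero (mul_ne_zero (hs 0) (hs 1))
    (mul_ne_zero (hs 2) (hs 3))) _ _)
  congr 1 <;> ring

end P1

namespace Curve

theorem ThreeDistinct.exists_ne {w : Fin 4 → P1} (h : ThreeDistinct w) (c d : P1) :
    ∃ a, w a ≠ c ∧ w a ≠ d := by
  by_contra! h'
  obtain ⟨x, y, z, h1, h2, h3⟩ := h
  rcases or_iff_not_imp_left.2 (h' x) with hx | hx <;>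
    rcases or_iff_not_imp_left.2 (h' y) with hy | hy <;>
    rcases or_iff_not_imp_left.2 (h' z) with hz | hz <;> first
      | exact h1 (hx.trans hy.symm)
      | exact h2 (hx.trans hz.symm)
      | exact h3 (hy.trans hz.symm)

theorem ThreeDistinct.not_all {w : Fin 4 → P1} (h : ThreeDistinct w) (c d : P1)
    (h0 : w 0 = c ∨ w 0 = d) (h1 : w 1 = c ∨ w 1 = d) (h2 : w 2 = c ∨ w 2 = d)
    (h3 : w 3 = c ∨ w 3 = d) : False := by
  obtain ⟨a, ha, ha'⟩ := h.exists_ne c d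
  fin_cases a
  exacts [h0.elim ha ha', h1.elim ha ha', h2.elim ha ha', h3.elim ha ha']

/-- Cross-ratios of two configurations that are complementary degenerations agree. -/
theorem crossRatio_eq_of_forall {w w' : Fin 4 → P1} (h : ThreeDistinct w) (h' : ThreeDistinct w')
    {c c' : P1} (hc : ∀ a, w a = c ∨ w' a = c') : P1.crossRatio w = P1.crossRatio w' := by
  have key : ∀ {w : Fin 4 → P1} (a b d e : Fin 4), ThreeDistinct w → w a = w b →
      (∀ x, x = a ∨ x = b ∨ x = d ∨ x = e) → w a ≠ w d ∧ w a ≠ w e ∧ w d ≠ w e := by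
    intro w a b d e h hab hx
    refine ⟨fun h1 => ?_, fun h1 => ?_, fun h1 => ?_⟩
    · obtain ⟨x, h2, h3⟩ := h.exists_ne (w a) (w e)
      rcases hx x with rfl | rfl | rfl | rfl <;> simp_all
    · obtain ⟨x, h2, h3⟩ := h.exists_ne (w a) (w d)
      rcases hx x with rfl | rfl | rfl | rfl <;> simp_all
    · obtain ⟨x, h2, h3⟩ := h.exists_ne (w a) (w d)
      rcases hx x with rfl | rfl | rfl | rfl <;> simp_all
  have e01 : w 0 = w 1 → w' 2 = w' 3 → P1.crossRatio w = P1.crossRatio w' := fun h1 h2 => by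
    rw [P1.crossRatio_eq_infty (Or.inl h1), P1.crossRatio_eq_infty (Or.inr h2)]
  have e23 : w 2 = w 3 → w' 0 = w' 1 → P1.crossRatio w = P1.crossRatio w' := fun h1 h2 => by
    rw [P1.crossRatio_eq_infty (Or.inr h1), P1.crossRatio_eq_infty (Or.inl h2)]
  have e12 : w 1 = w 2 → w' 0 = w' 3 → P1.crossRatio w = P1.crossRatio w' := fun h1 h2 => by
    obtain ⟨h3, h4, h5⟩ := key 1 2 0 3 h h1 (by decide)
    obtain ⟨h6, h7, h8⟩ := key 0 3 1 2 h' h2 (by decide)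
    rw [P1.crossRatio_eq_zero h3.symm (h1 ▸ h4) (Or.inl h1),
      P1.crossRatio_eq_zero h6 (h2 ▸ h7.symm) (Or.inr h2.symm)]
  have e03 : w 0 = w 3 → w' 1 = w' 2 → P1.crossRatio w = P1.crossRatio w' := fun h1 h2 => by
    obtain ⟨h3, h4, h5⟩ := key 0 3 1 2 h h1 (by decide)
    obtain ⟨h6, h7, h8⟩ := key 1 2 0 3 h' h2 (by decide)
    rw [P1.crossRatio_eq_zero h3 (h1 ▸ h4.symm) (Or.inr h1.symm),
      P1.crossRatio_eq_zero h6.symm (h2 ▸ h7) (Or.inl h2)]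
  have e02 : w 0 = w 2 → w' 1 = w' 3 → P1.crossRatio w = P1.crossRatio w' := fun h1 h2 => by
    obtain ⟨h3, h4, h5⟩ := key 0 2 1 3 h h1 (by decide)
    obtain ⟨h6, h7, h8⟩ := key 1 3 0 2 h' h2 (by decide)
    rw [P1.crossRatio_eq_one h3 (h1 ▸ h4) (Or.inl h1),
      P1.crossRatio_eq_one h6.symm (h2 ▸ h7.symm) (Or.inr h2)]
  have e13 : w 1 = w 3 → w' 0 = w' 2 → P1.crossRatio w = P1.crossRatio w' := fun h1 h2 => by
    obtain ⟨h3, h4, h5⟩ := key 1 3 0 2 h h1 (by decide)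
    obtain ⟨h6, h7, h8⟩ := key 0 2 1 3 h' h2 (by decide)
    rw [P1.crossRatio_eq_one h3.symm (h1 ▸ h4.symm) (Or.inr h1),
      P1.crossRatio_eq_one h6 (h2 ▸ h7) (Or.inl h2)]
  -- Three indices collapsed to `c` or to `c'` would leave at most two distinct points in that
  -- configuration. So two indices collapse in each configuration, and complementary pairs produce
  -- the same degenerate value `0`, `1` or `∞`.
  have n := h.not_all c
  have n' := h'.not_all c'
  rcases hc 0 with h0 | h0 <;> rcases hc 1 with h1 | h1 <;> rcases hc 2 with h2 | h2 <;>
    rcases hc 3 with h3 | h3 <;> first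
      | exact e01 (h0.trans h1.symm) (h2.trans h3.symm)
      | exact e23 (h2.trans h3.symm) (h0.trans h1.symm)
      | exact e12 (h1.trans h2.symm) (h0.trans h3.symm)
      | exact e03 (h0.trans h3.symm) (h1.trans h2.symm)
      | exact e02 (h0.trans h2.symm) (h1.trans h3.symm)
      | exact e13 (h1.trans h3.symm) (h0.trans h2.symm)
      | exact (n (w 0) (Or.inr rfl) (Or.inl h1) (Or.inl h2) (Or.inl h3)).elim
      | exact (n (w 1) (Or.inl h0) (Or.inr rfl) (Or.inl h2) (Or.inl h3)).elim
      | exact (n (w 2) (Or.inl h0) (Or.inl h1) (Or.inr rfl) (Or.inl h3)).elim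
      | exact (n (w 3) (Or.inl h0) (Or.inl h1) (Or.inl h2) (Or.inr rfl)).elim
      | exact (n' (w' 0) (Or.inr rfl) (Or.inl h1) (Or.inl h2) (Or.inl h3)).elim
      | exact (n' (w' 1) (Or.inl h0) (Or.inr rfl) (Or.inl h2) (Or.inl h3)).elim
      | exact (n' (w' 2) (Or.inl h0) (Or.inl h1) (Or.inr rfl) (Or.inl h3)).elim
      | exact (n' (w' 3) (Or.inl h0) (Or.inl h1) (Or.inl h2) (Or.inr rfl)).elim

/-! ### Cross-ratios do not depend on the component -/

variable {m : ℕ} {S : Curve m}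

theorem point_some {v : S.V} {i : Fin (m + 1)} (h : S.IsAbove v (S.leaf i)) :
    S.point v (some i) = (S.pos v i : P1) := if_pos h

theorem point_some_of_not {v : S.V} {i : Fin (m + 1)} (h : ¬ S.IsAbove v (S.leaf i)) :
    S.point v (some i) = ∞ := if_neg h

/-- Seen from one of two components, all markings but those seen behind the other component
from the second one are in the direction of the other one. -/
theorem exists_direction {v v' : S.V} (hne : v ≠ v') :
    ∃ c c', ∀ q, S.point v q = c ∨ S.point v' q = c' := by
  have key : ∀ {v v' : S.V}, v ≠ v' → S.IsAbove v v' →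
      ∃ c c', ∀ q, S.point v q = c ∨ S.point v' q = c' := by
    intro v v' hne h
    obtain ⟨i, hi⟩ := S.exists_leaf v'
    -- From the upper component everything behind `v'` is seen at one node, and from `v'` everything
    -- else is seen towards the root.
    refine ⟨S.pos v i, ∞, fun q => ?_⟩
    rcases q with _ | j
    · exact Or.inr rfl
    · by_cases hj : S.IsAbove v' (S.leaf j)
      · left
        rw [point_some (h.trans hj), (pos_eq_iff (h.trans hj) (h.trans hi)).2]
        refine Or.inr fun hm => hne (h.antisymm ?_)
        rw [hm]
        exact isAbove_meet hj hi
      · exact Or.inr (point_some_of_not hj)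
  by_cases h1 : S.IsAbove v v'
  · exact key hne h1
  by_cases h2 : S.IsAbove v' v
  · obtain ⟨c, c', h⟩ := key hne.symm h2
    exact ⟨c', c, fun q => (h q).symm⟩
  refine ⟨∞, ∞, fun q => ?_⟩
  rcases q with _ | j
  · exact Or.inr rfl
  · by_cases hj : S.IsAbove v' (S.leaf j)
    · left
      refine point_some_of_not fun hj' => ?_
      exact (hj.total hj').elim h2 h1
    · exact Or.inr (point_some_of_not hj)

/-- The cross-ratio can be computed on any component where three of the points are distinct. -/
theorem rho4_eq {v : S.V} {q : Fin 4 ↪ Option (Fin (m + 1))}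
    (h : ThreeDistinct fun a => S.point v (q a)) :
    S.rho4 q = P1.crossRatio fun a => S.point v (q a) := by
  have h1 : (fun w => ∃ v, ThreeDistinct (fun a => S.point v (q a)) ∧
      w = P1.crossRatio fun a => S.point v (q a)) =
      fun w => w = P1.crossRatio fun a => S.point v (q a) := by
    funext w
    refine propext ⟨?_, fun hw => ⟨v, h, hw⟩⟩
    rintro ⟨v', h', rfl⟩
    by_cases hv : v = v'
    · rw [hv]
    · obtain ⟨c, c', hc⟩ := exists_direction hv
      exact (crossRatio_eq_of_forall h h' fun a => hc (q a)).symm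
  rw [rho4, h1]
  exact Classical.epsilon_singleton _

/-- At most one of the four indices is `z_0`, so two are genuine markings `i`, `j`. On the component
where they meet, a third marking either gives a third point or coincides with one of them, in which
case the component where these two meet works. -/
theorem exists_threeDistinct (S : Curve m) (q : Fin 4 ↪ Option (Fin (m + 1))) :
    ∃ v, ThreeDistinct fun a => S.point v (q a) := by
  have hinf : ∀ {z : ℂ}, (z : P1) ≠ ∞ := fun {z} => OnePoint.coe_ne_infty z
  have key : ∀ i j : Fin (m + 1), i ≠ j → S.point (S.meet i j) (some i) ≠
      S.point (S.meet i j) (some j) ∧ S.point (S.meet i j) (some i) ≠ ∞ ∧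
        S.point (S.meet i j) (some j) ≠ ∞ := by
    intro i j hij
    have h := (separates_iff (S := S)).2 ⟨hij, rfl⟩
    rw [point_some h.1, point_some h.2.1]
    exact ⟨fun h' => h.2.2 (OnePoint.coe_injective h'), hinf, hinf⟩
  obtain ⟨a, b, c, hab, hac, hbc, i, j, hi, hj⟩ : ∃ a b c : Fin 4, a ≠ b ∧ a ≠ c ∧ b ≠ c ∧
      ∃ i j, q a = some i ∧ q b = some j := by
    have hq : ∀ a b : Fin 4, a ≠ b → q a ≠ none ∨ q b ≠ none := by
      intro a b hab
      by_contra! h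
      exact hab (q.injective (h.1.trans h.2.symm))
    have hs : ∀ a b c : Fin 4, a ≠ b → a ≠ c → b ≠ c → q a ≠ none → q b ≠ none →
        ∃ a b c : Fin 4, a ≠ b ∧ a ≠ c ∧ b ≠ c ∧ ∃ i j, q a = some i ∧ q b = some j := by
      intro a b c h1 h2 h3 h4 h5
      obtain ⟨i, hi⟩ := Option.ne_none_iff_exists'.1 h4
      obtain ⟨j, hj⟩ := Option.ne_none_iff_exists'.1 h5
      exact ⟨a, b, c, h1, h2, h3, i, j, hi, hj⟩
    rcases hq 0 1 (by decide) with h | h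
    · rcases hq 2 3 (by decide) with h' | h'
      · exact hs 0 2 1 (by decide) (by decide) (by decide) h h'
      · exact hs 0 3 1 (by decide) (by decide) (by decide) h h'
    · rcases hq 2 3 (by decide) with h' | h'
      · exact hs 1 2 0 (by decide) (by decide) (by decide) h h'
      · exact hs 1 3 0 (by decide) (by decide) (by decide) h h'
  have hij : i ≠ j := by
    rintro rfl
    exact hab (q.injective (hi.trans hj.symm))
  obtain ⟨h1, h2, h3⟩ := key i j hij
  by_cases h5 : S.point (S.meet i j) (q c) ≠ S.point (S.meet i j) (some i) ∧
      S.point (S.meet i j) (q c) ≠ S.point (S.meet i j) (some j)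
  · exact ⟨S.meet i j, a, b, c, by simpa only [hi, hj] using ⟨h1, h5.1.symm, h5.2.symm⟩⟩
  -- If `k` and `i` lie in one direction from where `i` and `j` meet, then `i` and `k` meet strictly
  -- lower, and from there `j` is seen towards the root.
  have sep : ∀ i j k : Fin (m + 1), i ≠ j → i ≠ k →
      S.point (S.meet i j) (some k) = S.point (S.meet i j) (some i) →
      S.point (S.meet i k) (some j) = ∞ := by
    intro i j k hij hik h
    obtain ⟨h1, h2, h3⟩ := key i j hij
    have hi := isAbove_meet_left (T := S.toMarkedTree) i j
    have hk : S.IsAbove (S.meet i j) (S.leaf k) := by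
      by_contra hk
      rw [point_some_of_not hk] at h
      exact h2 h.symm
    rw [point_some hk, point_some hi] at h
    have h6 := ((pos_eq_iff hk hi).1 (OnePoint.coe_injective h)).resolve_left hik.symm
    refine point_some_of_not fun h7 => h6 ?_
    rw [meet_comm k i]
    exact (isAbove_meet hi hk).antisymm (isAbove_meet (isAbove_meet_left i k) h7)
  rcases hqc : q c with _ | k
  · rw [hqc] at h5
    exact absurd ⟨h2.symm, h3.symm⟩ h5
  rw [hqc] at h5
  have hik : i ≠ k := by
    rintro rfl
    exact hac (q.injective (hi.trans hqc.symm))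
  have hjk : j ≠ k := by
    rintro rfl
    exact hbc (q.injective (hj.trans hqc.symm))
  by_cases h6 : S.point (S.meet i j) (some k) = S.point (S.meet i j) (some i)
  · have h7 := sep i j k hij hik h6
    obtain ⟨h8, h9, h10⟩ := key i k hik
    exact ⟨S.meet i k, a, c, b, by simpa only [hi, hj, hqc, h7] using ⟨h8, h9, h10⟩⟩
  · have h6 : S.point (S.meet i j) (some k) = S.point (S.meet i j) (some j) := by tauto
    have h7 := sep j i k hij.symm hjk (by rwa [meet_comm])
    obtain ⟨h8, h9, h10⟩ := key j k hjk
    exact ⟨S.meet j k, b, c, a, by simpa only [hi, hj, hqc, h7] using ⟨h8, h9, h10⟩⟩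

theorem rho2_eq (p : Fin 2 ↪ Fin (m + 1)) : S.rho2 p = (S.form (S.meet (p 0) (p 1))).elim
    ((0 : ℂ) : P1) (fun c => P1.mk 1 (c * (S.pos (S.meet (p 0) (p 1)) (p 1) -
      S.pos (S.meet (p 0) (p 1)) (p 0)))) := by
  have h : p 0 ≠ p 1 := p.injective.ne (by decide)
  have h1 : ∀ v, S.Separates v (p 0) (p 1) ↔ v = S.meet (p 0) (p 1) := fun v => by
    rw [separates_iff, and_iff_right h]
  simp only [rho2, h1, exists_eq_left]
  exact Classical.epsilon_singleton _

end Curve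

end ScaledLine

namespace ScaledLine

open MarkedTree ColoredTree

variable {m : ℕ} {T : ColoredTree m} {S : Curve m} {f : T.V → S.V}
  {σ : Equiv.Perm (Fin (m + 1))}

/-! ### The coordinates of the moduli space in terms of the simple ratios -/

namespace IsContraction

theorem lpos_meet_ne (hf : IsContraction T S f) (hT : T.IsMaximal) (hσ : T.IsPlanar σ)
    {i j : Fin (m + 1)} (hij : i ≠ j) :
    T.lpos σ (S.simpleRatio T σ) (T.meet (σ i) (σ j)) j ≠
      T.lpos σ (S.simpleRatio T σ) (T.meet (σ i) (σ j)) i :=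
  (mem_balancedStar_iff.1 (hf.simpleRatio_mem hT hσ)).2 i j hij

/-- The unknown size of the component cancels between the form and the difference of positions,
which leaves only labels. -/
theorem rho2_eq_below (hf : IsContraction T S f) (hT : T.IsMaximal) (hσ : T.IsPlanar σ)
    {p : Fin 2 ↪ Fin (m + 1)} {i j : Fin (m + 1)} (hi : p 0 = σ i) (hj : p 1 = σ j) {c : T.V}
    (hc : c ∈ T.col) (h : T.IsAbove c (T.meet (σ i) (σ j))) : S.rho2 p =
      P1.mk 1 (T.pathProd (S.simpleRatio T σ) (T.meet (σ i) (σ j)) c *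
        (T.lpos σ (S.simpleRatio T σ) (T.meet (σ i) (σ j)) j -
          T.lpos σ (S.simpleRatio T σ) (T.meet (σ i) (σ j)) i)) := by
  have h1 := hf.scale_ne_zero hT hσ (T.meet (σ i) (σ j))
  rw [Curve.rho2_eq, hi, hj, hf.meet, hf.form_below hT hσ hc h, OnePoint.elim_some,
    hf.pos_sub hT hσ (isAbove_meet_left _ _) (isAbove_meet_right _ _), ← mul_assoc,
    div_mul_cancel₀ _ h1]

theorem rho2_eq_above (hf : IsContraction T S f) (hT : T.IsMaximal) (hσ : T.IsPlanar σ)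
    {p : Fin 2 ↪ Fin (m + 1)} {i j : Fin (m + 1)} (hi : p 0 = σ i) (hj : p 1 = σ j) {c : T.V}
    (hc : c ∈ T.col) (h : T.IsAbove (T.meet (σ i) (σ j)) c) : S.rho2 p =
      P1.mk (T.pathProd (S.simpleRatio T σ) c (T.meet (σ i) (σ j)))
        (T.lpos σ (S.simpleRatio T σ) (T.meet (σ i) (σ j)) j -
          T.lpos σ (S.simpleRatio T σ) (T.meet (σ i) (σ j)) i) := by
  have h1 := hf.scale_ne_zero hT hσ (T.meet (σ i) (σ j))
  have hij : i ≠ j := by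
    rintro rfl
    exact absurd (p.injective (hi.trans hj.symm)) (by decide)
  have h2 := sub_ne_zero.2 (hf.lpos_meet_ne hT hσ hij)
  rw [Curve.rho2_eq, hi, hj, hf.meet, hf.form_above hT hσ hc h]
  by_cases h3 : T.pathProd (S.simpleRatio T σ) c (T.meet (σ i) (σ j)) = 0
  · rw [h3, mul_zero, P1.mk_div (s := 0) h2 (by rw [zero_mul]), P1.mk, if_pos rfl,
      OnePoint.elim_infty]
  · rw [P1.mk, if_neg (mul_ne_zero h1 h3), OnePoint.elim_some,
      hf.pos_sub hT hσ (isAbove_meet_left _ _) (isAbove_meet_right _ _),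
      P1.mk_div h2 (div_mul_cancel₀ _ h2).symm]
    refine P1.mk_div (mul_ne_zero (one_div_ne_zero (mul_ne_zero h1 h3)) (mul_ne_zero h1 h2)) ?_
    field_simp

open Classical in
/-- The least vertex above `u` and the leaf `i`. -/
noncomputable def join (hT : T.IsMaximal) (σ : Equiv.Perm (Fin (m + 1))) (u : T.V)
    (i : Fin (m + 1)) : T.V :=
  if T.IsAbove u (T.leaf (σ i)) then u
    else T.meet (σ i) (σ (hT.exists_leaf (σ := σ) u).choose)

theorem join_spec (hT : T.IsMaximal) (σ : Equiv.Perm (Fin (m + 1))) (u : T.V)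
    (i : Fin (m + 1)) : T.IsAbove (join hT σ u i) u ∧
      T.IsAbove (join hT σ u i) (T.leaf (σ i)) := by
  unfold join
  split_ifs with h
  · exact ⟨.refl u, h⟩
  · refine ⟨?_, isAbove_meet_left _ _⟩
    have h1 := (hT.exists_leaf (σ := σ) u).choose_spec
    refine ((isAbove_meet_right _ _).total h1).resolve_right fun h2 => h ?_
    exact h2.trans (isAbove_meet_left _ _)

/-- Homogeneous coordinates of the special point towards a marking on the component of `u`,
as polynomials in the simple ratios. -/
noncomputable def pointPoly (hT : T.IsMaximal) (σ : Equiv.Perm (Fin (m + 1))) (u : T.V) :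
    Option (Fin (m + 1)) → MvPolynomial T.Edge ℂ × MvPolynomial T.Edge ℂ
  | none => (1, 0)
  | some a => (T.lposPoly σ (join hT σ u (σ.symm a)) (σ.symm a) -
      T.lposPoly σ (join hT σ u (σ.symm a)) (hT.exists_leaf (σ := σ) u).choose,
      T.pathPoly u (join hT σ u (σ.symm a)))

/-- Their values. -/
noncomputable def pointCoord (hT : T.IsMaximal) (σ : Equiv.Perm (Fin (m + 1))) (u : T.V)
    (l : T.Edge → ℂ) (q : Option (Fin (m + 1))) : ℂ × ℂ :=
  (MvPolynomial.eval l (pointPoly hT σ u q).1, MvPolynomial.eval l (pointPoly hT σ u q).2)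

/-- A leaf is seen at a finite point from `f u` exactly if the path from `u` to the join is
contracted, that is, if the second coordinate in `pointPoly` does not vanish. -/
theorem isAbove_leaf_iff_join (hf : IsContraction T S f) (hT : T.IsMaximal) (u : T.V)
    (i : Fin (m + 1)) : S.IsAbove (f u) (S.leaf (σ i)) ↔ f u = f (join hT σ u i) := by
  obtain ⟨h1, h2⟩ := join_spec hT σ u i
  constructor
  · intro h
    by_cases h3 : T.IsAbove u (T.leaf (σ i))
    · rw [join, if_pos h3]
    · refine IsAbove.antisymm ?_ (hf.mono h1)
      rw [join, if_neg h3, ← hf.meet]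
      exact isAbove_meet h (hf.isAbove_leaf (hT.exists_leaf (σ := σ) u).choose_spec)
  · intro h
    rw [h]
    exact hf.isAbove_leaf h2

/-- If the leaf is behind `u` the second coordinate is `1`; otherwise the join is the meet of the
leaf with the reference leaf, and the first coordinate is nonzero by the open condition. -/
theorem pointCoord_ne_zero (hf : IsContraction T S f) (hT : T.IsMaximal) (hσ : T.IsPlanar σ)
    (u : T.V) (q : Option (Fin (m + 1))) : pointCoord hT σ u (S.simpleRatio T σ) q ≠ 0 := by
  rcases q with _ | a
  · simp [pointCoord, pointPoly]
  · obtain ⟨i, rfl⟩ := σ.surjective a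
    intro h
    simp only [pointCoord, pointPoly, Equiv.symm_apply_apply, map_sub, eval_lposPoly,
      eval_pathPoly, Prod.mk_eq_zero] at h
    obtain ⟨h1, h2⟩ := h
    by_cases h3 : T.IsAbove u (T.leaf (σ i))
    · rw [join, if_pos h3, pathProd_self] at h2
      exact one_ne_zero h2
    · rw [join, if_neg h3] at h1
      refine hf.lpos_meet_ne hT hσ ?_ (sub_eq_zero.1 h1).symm
      intro h4
      exact h3 (h4 ▸ (hT.exists_leaf (σ := σ) u).choose_spec)

/-- Dividing a difference of positions at the join by the path product converts it to the scale at
`u`. The remaining affine map is invisible to cross-ratios. -/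
theorem point_eq (hf : IsContraction T S f) (hT : T.IsMaximal) (hσ : T.IsPlanar σ)
    (u : T.V) (q : Option (Fin (m + 1))) : S.point (f u) q =
      (P1.mk (pointCoord hT σ u (S.simpleRatio T σ) q).1
        (pointCoord hT σ u (S.simpleRatio T σ) q).2).map (fun z => scale T S σ f u * z +
          S.pos (f u) (σ (hT.exists_leaf (σ := σ) u).choose)) := by
  classical
  rcases q with _ | a
  · simp [pointCoord, pointPoly, P1.mk, Curve.point]
  · obtain ⟨i, rfl⟩ := σ.surjective a
    obtain ⟨h1, h2⟩ := join_spec hT σ u i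
    have h3 := (hT.exists_leaf (σ := σ) u).choose_spec
    have h4 := hf.isAbove_leaf_iff_join (σ := σ) hT u i
    have h5 := hf.pathProd_eq hT hσ h1
    simp only [pointCoord, pointPoly, Equiv.symm_apply_apply, map_sub, eval_lposPoly,
      eval_pathPoly]
    by_cases h : f u = f (join hT σ u i)
    · have h6 := hf.pos_sub hT hσ (h1.trans h3) h2
      have h7 := hf.scale_ne_zero hT hσ u
      have h8 := hf.scale_ne_zero hT hσ (join hT σ u i)
      rw [if_pos h] at h5
      rw [Curve.point_some (h4.2 h), h5, P1.mk, if_neg (div_ne_zero h7 h8), OnePoint.map_some]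
      rw [← h] at h6
      congr 1
      rw [← sub_eq_iff_eq_add, h6]
      field_simp
    · rw [if_neg h] at h5
      rw [Curve.point_some_of_not fun h' => h (h4.1 h'), h5, P1.mk, if_pos rfl,
        OnePoint.map_infty]

theorem eval_pairDet (hT : T.IsMaximal) (u : T.V) (l : T.Edge → ℂ) (q q' : Option (Fin (m + 1))) :
    MvPolynomial.eval l (P1.pairDet (pointPoly hT σ u q) (pointPoly hT σ u q')) =
      P1.pairDet (pointCoord hT σ u l q) (pointCoord hT σ u l q') := by
  simp [P1.pairDet, pointCoord]

theorem point_ne_iff (hf : IsContraction T S f) (hT : T.IsMaximal) (hσ : T.IsPlanar σ)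
    (u : T.V) (q q' : Option (Fin (m + 1))) : S.point (f u) q ≠ S.point (f u) q' ↔
      P1.pairDet (pointCoord hT σ u (S.simpleRatio T σ) q)
        (pointCoord hT σ u (S.simpleRatio T σ) q') ≠ 0 := by
  rw [hf.point_eq hT hσ, hf.point_eq hT hσ,
    (Curve.Iso.map_injective (hf.scale_ne_zero hT hσ u) _).ne_iff, P1.mk_ne_mk_iff
      (hf.pointCoord_ne_zero hT hσ u q) (hf.pointCoord_ne_zero hT hσ u q')]

theorem crossRatio_point (hf : IsContraction T S f) (hT : T.IsMaximal) (hσ : T.IsPlanar σ)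
    (u : T.V) (q : Fin 4 → Option (Fin (m + 1))) {x : Fin 4 → ℂ × ℂ}
    (hx : ∀ a, x a = pointCoord hT σ u (S.simpleRatio T σ) (q a)) :
    P1.crossRatio (fun a => S.point (f u) (q a)) =
      P1.mk (P1.pairDet (x 1) (x 2) * P1.pairDet (x 3) (x 0))
        (P1.pairDet (x 0) (x 1) * P1.pairDet (x 2) (x 3)) := by
  rw [← P1.crossRatio_mk fun a => hx a ▸ hf.pointCoord_ne_zero hT hσ u (q a),
    ← Curve.Iso.crossRatio_map (hf.scale_ne_zero hT hσ u)
      (S.pos (f u) (σ (hT.exists_leaf (σ := σ) u).choose)) fun a => P1.mk (x a).1 (x a).2]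
  congr 1
  funext a
  rw [hf.point_eq hT hσ, hx]

/-- Near a given curve, the cross-ratio of four markings is a rational function of the simple
ratios. -/
theorem exists_rho4_poly (hf : IsContraction T S f) (hT : T.IsMaximal) (hσ : T.IsPlanar σ)
    (q : Fin 4 ↪ Option (Fin (m + 1))) : ∃ P Q : MvPolynomial T.Edge ℂ,
      ¬ (MvPolynomial.eval (S.simpleRatio T σ) P = 0 ∧
        MvPolynomial.eval (S.simpleRatio T σ) Q = 0) ∧
      ∀ (S' : Curve m) (f' : T.V → S'.V), IsContraction T S' f' →
        ¬ (MvPolynomial.eval (S'.simpleRatio T σ) P = 0 ∧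
          MvPolynomial.eval (S'.simpleRatio T σ) Q = 0) →
        S'.rho4 q = P1.mk (MvPolynomial.eval (S'.simpleRatio T σ) P)
          (MvPolynomial.eval (S'.simpleRatio T σ) Q) := by
  obtain ⟨v, hv⟩ := S.exists_threeDistinct q
  obtain ⟨u, rfl⟩ := hf.surj v
  have hv' := hv
  obtain ⟨a, b, c, hab, hac, hbc⟩ := hv'
  rw [hf.point_ne_iff hT hσ] at hab hac hbc
  let x := fun a => pointPoly hT σ u (q a)
  -- Where `R` is nonzero, the same three special points remain distinct on the component of `u`, so
  -- the cross-ratio may be computed there. Multiplying `P` and `Q` by `R` restricts to this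
  -- neighbourhood.
  obtain ⟨R, hR₀⟩ : ∃ R, R =
    P1.pairDet (x a) (x b) * P1.pairDet (x a) (x c) * P1.pairDet (x b) (x c) := ⟨_, rfl⟩
  refine ⟨R * (P1.pairDet (x 1) (x 2) * P1.pairDet (x 3) (x 0)),
    R * (P1.pairDet (x 0) (x 1) * P1.pairDet (x 2) (x 3)), ?_, fun S' f' hf' h' => ?_⟩
  · simp only [hR₀, x, map_mul, eval_pairDet]
    rintro ⟨h1, h2⟩
    have h1 := (mul_eq_zero.1 h1).resolve_left (mul_ne_zero (mul_ne_zero hab hac) hbc)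
    have h2 := (mul_eq_zero.1 h2).resolve_left (mul_ne_zero (mul_ne_zero hab hac) hbc)
    simp only [mul_eq_zero] at h1 h2
    -- If numerator and denominator both vanished, the coincidences would leave at most two distinct
    -- points among the four.
    have key : ∀ a b, P1.pairDet (pointCoord hT σ u (S.simpleRatio T σ) (q a))
        (pointCoord hT σ u (S.simpleRatio T σ) (q b)) = 0 →
          S.point (f u) (q a) = S.point (f u) (q b) := fun a b =>
      not_imp_not.1 (hf.point_ne_iff hT hσ u (q a) (q b)).1
    rcases h1 with h1 | h1 <;> rcases h2 with h2 | h2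
    · exact hv.not_all _ (S.point (f u) (q 3)) (Or.inl rfl) (Or.inl (key _ _ h2).symm)
        (Or.inl ((key _ _ h2).trans (key _ _ h1)).symm) (Or.inr rfl)
    · exact hv.not_all (S.point (f u) (q 0)) (S.point (f u) (q 1)) (Or.inl rfl) (Or.inr rfl)
        (Or.inr (key _ _ h1).symm) (Or.inr ((key _ _ h1).trans (key _ _ h2)).symm)
    · exact hv.not_all (S.point (f u) (q 0)) (S.point (f u) (q 2)) (Or.inl rfl)
        (Or.inl (key _ _ h2).symm) (Or.inr rfl) (Or.inl (key _ _ h1))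
    · exact hv.not_all (S.point (f u) (q 0)) (S.point (f u) (q 1)) (Or.inl rfl) (Or.inr rfl)
        (Or.inl ((key _ _ h2).trans (key _ _ h1))) (Or.inl (key _ _ h1))
  · have hR : MvPolynomial.eval (S'.simpleRatio T σ) R ≠ 0 := by
      intro hR
      exact h' ⟨by rw [map_mul, hR, zero_mul], by rw [map_mul, hR, zero_mul]⟩
    have hR' := hR
    simp only [hR₀, x, map_mul, eval_pairDet, mul_ne_zero_iff] at hR'
    rw [map_mul _ R, map_mul _ R, P1.mk_mul_left hR, Curve.rho4_eq (v := f' u),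
      hf'.crossRatio_point hT hσ u q fun _ => rfl]
    · simp only [x, map_mul, eval_pairDet]
    · refine ⟨a, b, c, ?_⟩
      simp only [hf'.point_ne_iff hT hσ]
      exact ⟨hR'.1.1, hR'.1.2, hR'.2⟩

/-- The coordinate `ρ_{ij}` is a rational function of the simple ratios. -/
theorem exists_rho2_poly (hT : T.IsMaximal) (hσ : T.IsPlanar σ)
    (p : Fin 2 ↪ Fin (m + 1)) : ∃ P Q : MvPolynomial T.Edge ℂ,
      ∀ (S : Curve m) (f : T.V → S.V), IsContraction T S f →
        ¬ (MvPolynomial.eval (S.simpleRatio T σ) P = 0 ∧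
          MvPolynomial.eval (S.simpleRatio T σ) Q = 0) ∧
        S.rho2 p = P1.mk (MvPolynomial.eval (S.simpleRatio T σ) P)
          (MvPolynomial.eval (S.simpleRatio T σ) Q) := by
  obtain ⟨i, hi⟩ := σ.surjective (p 0)
  obtain ⟨j, hj⟩ := σ.surjective (p 1)
  have hij : i ≠ j := by
    rintro rfl
    exact absurd (p.injective (hi.symm.trans hj)) (by decide)
  by_cases h : T.BehindCol (T.meet (σ i) (σ j))
  · obtain ⟨c, hc, h1, -⟩ := h
    refine ⟨1, T.pathPoly (T.meet (σ i) (σ j)) c * (T.lposPoly σ (T.meet (σ i) (σ j)) j -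
      T.lposPoly σ (T.meet (σ i) (σ j)) i), fun S f hf => ⟨fun h => ?_, ?_⟩⟩
    · rw [map_one] at h
      exact one_ne_zero h.1
    · rw [hf.rho2_eq_below hT hσ hi.symm hj.symm hc h1]
      simp
  · obtain ⟨c, hc, h1⟩ := hT.exists_col_below h
    refine ⟨T.pathPoly c (T.meet (σ i) (σ j)), T.lposPoly σ (T.meet (σ i) (σ j)) j -
      T.lposPoly σ (T.meet (σ i) (σ j)) i, fun S f hf => ⟨fun h => ?_, ?_⟩⟩
    · rw [map_sub, eval_lposPoly, eval_lposPoly, sub_eq_zero] at h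
      exact hf.lpos_meet_ne hT hσ hij h.2
    · rw [hf.rho2_eq_above hT hσ hi.symm hj.symm hc h1]
      simp

end IsContraction

/-! ### The simple ratios in terms of the coordinates of the moduli space -/

/-- The index of the cross-ratio of `z_0` and three other markings. -/
def quad {a b c : Fin (m + 1)} (hab : a ≠ b) (hac : a ≠ c) (hbc : b ≠ c) :
    Fin 4 ↪ Option (Fin (m + 1)) where
  toFun := ![none, some a, some b, some c]
  inj' x y h := by fin_cases x <;> fin_cases y <;> simp_all

/-- With `z_0` at infinity the cross-ratio becomes a ratio of differences, finite because `b` and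
`c` are separated. -/
theorem Curve.rho4_quad {a b c : Fin (m + 1)} (hab : a ≠ b) (hac : a ≠ c) (hbc : b ≠ c)
    {v : S.V} (h : S.Separates v b c) (ha : S.IsAbove v (S.leaf a)) :
    S.rho4 (quad hab hac hbc) =
      (((S.pos v b - S.pos v a) / (S.pos v b - S.pos v c) : ℂ) : P1) := by
  have hw : (fun i => S.point v (quad hab hac hbc i)) =
      ![∞, ((S.pos v a : ℂ) : P1), ((S.pos v b : ℂ) : P1), ((S.pos v c : ℂ) : P1)] := by
    funext i
    fin_cases i
    exacts [rfl, point_some ha, point_some h.1, point_some h.2.1]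
  rw [rho4_eq (v := v), hw]
  · have h1 := sub_ne_zero.2 h.2.2
    refine P1.mk_div ?_ ?_
    · simpa [P1.det, P1.hom] using h1
    · simp [P1.det, P1.hom]
      field_simp
  · rw [hw]
    refine ⟨0, 2, 3, OnePoint.infty_ne_coe _, OnePoint.infty_ne_coe _, fun h' => h.2.2 ?_⟩
    exact OnePoint.coe_injective h'

theorem IsContraction.label_eq_gap_div (hf : IsContraction T S f) (hT : T.IsMaximal)
    (hσ : T.IsPlanar σ) {e : T.Edge} {i j : Fin m} (hi : T.gapVertex σ i = e.1)
    (hj : T.gapVertex σ j = T.parent e.1) : S.simpleRatio T σ e =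
      S.gap σ (f (T.parent e.1)) i / S.gap σ (f (T.parent e.1)) j := by
  have h1 := isAbove_parent (T := T.toMarkedTree) e.1
  rw [hf.gap_eq hT hσ (hi ▸ h1), hf.gap_eq hT hσ (hj ▸ .refl _), hi, hj, pathProd_self, mul_one,
    mul_div_cancel_left₀ _ (hf.scale_ne_zero hT hσ _),
    pathProd_parent _ h1 (parent_ne e.2).symm, pathProd_self, mul_one, label_edge]

/-- A simple ratio of gaps is, up to sign, a cross-ratio or a product of two of them. -/
theorem exists_ratio_poly (hT : T.IsMaximal) (hσ : T.IsPlanar σ) {e : T.Edge} {i j : Fin m}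
    (hi : T.gapVertex σ i = e.1) (hj : T.gapVertex σ j = T.parent e.1) :
    ∃ (K : Set ((Fin 4 ↪ Option (Fin (m + 1))) ⊕ (Fin 2 ↪ Fin (m + 1))))
      (P : MvPolynomial ((Fin 4 ↪ Option (Fin (m + 1))) ⊕ (Fin 2 ↪ Fin (m + 1))) ℂ),
      ∀ (S : Curve m) (f : T.V → S.V), IsContraction T S f →
        (∀ k ∈ K, P1.InChart false (S.rho k)) ∧ ∀ s : _ → Bool, (∀ k ∈ K, s k = false) →
          S.simpleRatio T σ e = MvPolynomial.eval (fun k => P1.coord (s k) (S.rho k)) P := by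
  have hu := isAbove_parent (T := T.toMarkedTree) e.1
  have hne : T.parent e.1 ≠ e.1 := parent_ne e.2
  have hAB : σ j.castSucc ≠ σ j.succ := σ.injective.ne Fin.castSucc_lt_succ.ne
  have hCD : σ i.castSucc ≠ σ i.succ := σ.injective.ne Fin.castSucc_lt_succ.ne
  obtain ⟨heC, heD⟩ := isAbove_meet_iff.1 (hi ▸ .refl _ : T.IsAbove e.1 (T.gapVertex σ i))
  obtain ⟨huA, huB⟩ :=
    isAbove_meet_iff.1 (hj ▸ .refl _ : T.IsAbove (T.parent e.1) (T.gapVertex σ j))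
  -- Of the two leaves of the upper gap, `X` is one that meets the lower leaf `C = σ i.castSucc` at
  -- the upper vertex, `Y` is the other one, and `ε` is the resulting sign.
  obtain ⟨X, Y, ε, hXC, hXY, hne', hε⟩ : ∃ (X Y : Fin (m + 1)) (ε : ℂ),
      T.meet X (σ i.castSucc) = T.parent e.1 ∧ T.meet X Y = T.parent e.1 ∧ X ≠ Y ∧
      ∀ (S : Curve m) (v : S.V), S.gap σ v j = ε * (S.pos v X - S.pos v Y) ∧ ε * ε = 1 := by
    by_cases h1 : T.meet (σ j.castSucc) (σ i.castSucc) = T.parent e.1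
    · refine ⟨σ j.castSucc, σ j.succ, -1, h1, hj, hAB, fun S v => ⟨?_, by norm_num⟩⟩
      rw [Curve.gap]
      ring
    · refine ⟨σ j.succ, σ j.castSucc, 1, ?_, ?_, hAB.symm, fun S v => ⟨?_, by norm_num⟩⟩
      · by_contra h2
        exact ne_meet_trans huA (hu.trans heC) huB (Ne.symm h1)
          (by rw [meet_comm]; exact Ne.symm h2) hj.symm
      · rw [meet_comm]
        exact hj
      · rw [Curve.gap, one_mul]
  have hCX : σ i.castSucc ≠ X := by
    rintro rfl
    exact not_isAbove_parent e.2 (hXC ▸ isAbove_meet heC heC)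
  have hDX : σ i.succ ≠ X := by
    rintro rfl
    rw [meet_comm] at hXC
    exact hne (hXC.symm.trans hi)
  have key : ∀ (S : Curve m) (f : T.V → S.V), IsContraction T S f →
      S.rho4 (quad hCD.symm hDX hCX) = (((S.pos (f (T.parent e.1)) (σ i.castSucc) -
        S.pos (f (T.parent e.1)) (σ i.succ)) / (S.pos (f (T.parent e.1)) (σ i.castSucc) -
          S.pos (f (T.parent e.1)) X) : ℂ) : P1) ∧
      S.pos (f (T.parent e.1)) (σ i.castSucc) - S.pos (f (T.parent e.1)) X ≠ 0 ∧
      S.Separates (f (T.parent e.1)) X Y := by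
    intro S f hf
    have h1 : S.Separates (f (T.parent e.1)) (σ i.castSucc) X :=
      hf.separates_iff.2 ⟨hCX, by rw [meet_comm, hXC]⟩
    exact ⟨Curve.rho4_quad _ _ _ h1 (hf.isAbove_leaf (hu.trans heD)), sub_ne_zero.2 h1.2.2,
      hf.separates_iff.2 ⟨hne', by rw [hXY]⟩⟩
  -- With `D = σ i.succ`, the ratio is up to sign `(C - D) / (C - X)` times `(X - C) / (X - Y)`. The
  -- second factor is `1` when `C = Y`, where it would not be a cross-ratio of distinct markings.
  by_cases hCY : σ i.castSucc = Y
  · refine ⟨{Sum.inl (quad hCD.symm hDX hCX)}, MvPolynomial.C ε *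
      MvPolynomial.X (Sum.inl (quad hCD.symm hDX hCX)), fun S f hf => ?_⟩
    obtain ⟨h1, h2, h3⟩ := key S f hf
    have h4 := sub_ne_zero.2 h3.2.2
    obtain ⟨h5, h6⟩ := hε S (f (T.parent e.1))
    have hε0 : ε ≠ 0 := left_ne_zero_of_mul_eq_one h6
    simp only [Set.mem_singleton_iff, forall_eq]
    change P1.InChart _ (S.rho4 _) ∧ _
    rw [h1]
    refine ⟨OnePoint.coe_ne_infty _, fun s hs => ?_⟩
    rw [hf.label_eq_gap_div hT hσ hi hj, h5, Curve.gap, map_mul, MvPolynomial.eval_C,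
      MvPolynomial.eval_X, hs]
    change _ = ε * P1.coord false (S.rho4 _)
    rw [h1]
    change _ = ε * (_ / _)
    subst hCY
    field_simp
    linear_combination (S.pos (f (T.parent e.1)) (σ i.castSucc) -
      S.pos (f (T.parent e.1)) (σ i.succ)) * (S.pos (f (T.parent e.1)) (σ i.castSucc) -
        S.pos (f (T.parent e.1)) X) * h6
  · refine ⟨{Sum.inl (quad hCD.symm hDX hCX), Sum.inl (quad hCX hCY hne')}, MvPolynomial.C ε *
      (MvPolynomial.X (Sum.inl (quad hCD.symm hDX hCX)) *
        MvPolynomial.X (Sum.inl (quad hCX hCY hne'))), fun S f hf => ?_⟩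
    obtain ⟨h1, h2, h3⟩ := key S f hf
    have h4 := sub_ne_zero.2 h3.2.2
    obtain ⟨h5, h6⟩ := hε S (f (T.parent e.1))
    have hε0 : ε ≠ 0 := left_ne_zero_of_mul_eq_one h6
    have h7 := Curve.rho4_quad hCX hCY hne' h3 (hf.isAbove_leaf (hu.trans heC))
    simp only [Set.mem_insert_iff, Set.mem_singleton_iff, forall_eq_or_imp, forall_eq]
    change (P1.InChart _ (S.rho4 _) ∧ P1.InChart _ (S.rho4 _)) ∧ _
    rw [h1, h7]
    refine ⟨⟨OnePoint.coe_ne_infty _, OnePoint.coe_ne_infty _⟩, fun s hs => ?_⟩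
    rw [hf.label_eq_gap_div hT hσ hi hj, h5, Curve.gap, map_mul, map_mul, MvPolynomial.eval_C,
      MvPolynomial.eval_X, MvPolynomial.eval_X, hs.1, hs.2]
    change _ = ε * (P1.coord false (S.rho4 _) * P1.coord false (S.rho4 _))
    rw [h1, h7]
    change _ = ε * ((_ / _) * (_ / _))
    field_simp
    linear_combination (S.pos (f (T.parent e.1)) (σ i.castSucc) -
      S.pos (f (T.parent e.1)) (σ i.succ)) * (S.pos (f (T.parent e.1)) (σ i.castSucc) -
        S.pos (f (T.parent e.1)) X) * h6

end ScaledLine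

namespace ScaledLine

open MarkedTree ColoredTree

variable {m : ℕ} {T : ColoredTree m} {σ : Equiv.Perm (Fin (m + 1))}

/-- The index of the coordinate `ρ` of the two leaves of a gap. -/
def gapPair (σ : Equiv.Perm (Fin (m + 1))) (p : Fin m) : Fin 2 ↪ Fin (m + 1) where
  toFun := ![σ p.castSucc, σ p.succ]
  inj' x y h := by
    have := σ.injective.ne (Fin.castSucc_lt_succ (i := p)).ne
    fin_cases x <;> fin_cases y <;> simp_all

theorem P1.inChart_mk_one (z : ℂ) : P1.InChart true (P1.mk 1 z) := P1.mk_one_ne_zero z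

theorem P1.coord_mk_one (z : ℂ) : P1.coord true (P1.mk 1 z) = z := by
  unfold P1.mk
  split_ifs with h
  · exact h.symm
  · change (1 / z)⁻¹ = z
    rw [one_div, inv_inv]

theorem P1.mk_one_right (z : ℂ) : P1.mk z 1 = (z : P1) := by
  rw [P1.mk, if_neg one_ne_zero, div_one]

/-- The simple ratios are regular functions of the coordinates of the moduli space. -/
theorem exists_simpleRatio_poly (hT : T.IsMaximal) (hσ : T.IsPlanar σ) (e : T.Edge) :
    ∃ (b : Bool) (K : Set ((Fin 4 ↪ Option (Fin (m + 1))) ⊕ (Fin 2 ↪ Fin (m + 1))))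
      (P : MvPolynomial ((Fin 4 ↪ Option (Fin (m + 1))) ⊕ (Fin 2 ↪ Fin (m + 1))) ℂ),
      ∀ (S : Curve m) (f : T.V → S.V), IsContraction T S f →
        (∀ k ∈ K, P1.InChart b (S.rho k)) ∧ ∀ s : _ → Bool, (∀ k ∈ K, s k = b) →
          S.simpleRatio T σ e = MvPolynomial.eval (fun k => P1.coord (s k) (S.rho k)) P := by
  have hpe := isAbove_parent (T := T.toMarkedTree) e.1
  have hprod : ∀ l : T.Edge → ℂ, T.pathProd l e.1 (T.parent e.1) = l e := fun l => by
    rw [pathProd_parent l hpe (parent_ne e.2).symm, pathProd_self, mul_one, label_edge]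
  -- A gap has length `1` at its own vertex, so `ρ` of its two leaves is, next to a colored vertex,
  -- the label itself or its inverse.
  have hgap : ∀ (l : T.Edge → ℂ) (p : Fin m), T.lpos σ l (T.meet (σ p.castSucc) (σ p.succ)) p.succ -
      T.lpos σ l (T.meet (σ p.castSucc) (σ p.succ)) p.castSucc = 1 := fun l p => by
    rw [lpos_succ_sub]
    exact pathProd_self _ _
  by_cases h1 : e.1 ∈ T.col
  · have h2 : T.parent e.1 ∉ T.col := fun h2 =>
      parent_ne e.2 (hT.col_eq_of_isAbove h2 h1 hpe)
    obtain ⟨p, hp⟩ := hT.exists_gapVertex_eq hσ h2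
    have hp' : T.meet (σ p.castSucc) (σ p.succ) = T.parent e.1 := hp
    refine ⟨false, {Sum.inr (gapPair σ p)}, MvPolynomial.X (Sum.inr (gapPair σ p)),
      fun S f hf => ?_⟩
    have h3 : S.rho (Sum.inr (gapPair σ p)) = ((S.simpleRatio T σ e : ℂ) : P1) := by
      refine (hf.rho2_eq_above hT hσ (p := gapPair σ p) rfl rfl h1 (hp' ▸ hpe)).trans ?_
      rw [hgap, hp', hprod, P1.mk_one_right]
    simp only [Set.mem_singleton_iff, forall_eq, h3]
    refine ⟨OnePoint.coe_ne_infty _, fun s hs => ?_⟩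
    rw [MvPolynomial.eval_X, hs, h3]
    rfl
  obtain ⟨i, hi⟩ := hT.exists_gapVertex_eq hσ h1
  by_cases h2 : T.parent e.1 ∈ T.col
  · have hi' : T.meet (σ i.castSucc) (σ i.succ) = e.1 := hi
    -- Below a colored vertex the label is `1 / ρ`, so the chart at infinity is used; it contains
    -- `ρ` for every curve in the domain.
    refine ⟨true, {Sum.inr (gapPair σ i)}, MvPolynomial.X (Sum.inr (gapPair σ i)),
      fun S f hf => ?_⟩
    have h3 : S.rho (Sum.inr (gapPair σ i)) = P1.mk 1 (S.simpleRatio T σ e) := by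
      refine (hf.rho2_eq_below hT hσ (p := gapPair σ i) rfl rfl h2 (hi' ▸ hpe)).trans ?_
      rw [hgap, hi', hprod, mul_one]
    simp only [Set.mem_singleton_iff, forall_eq, h3]
    refine ⟨P1.inChart_mk_one _, fun s hs => ?_⟩
    rw [MvPolynomial.eval_X, hs, h3, P1.coord_mk_one]
  · obtain ⟨j, hj⟩ := hT.exists_gapVertex_eq hσ h2
    exact ⟨false, exists_ratio_poly hT hσ hi hj⟩

/-! ### The isomorphism -/

theorem Moduli.exists_rep {C : Moduli m} (hC : C ∈ Moduli.below T) :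
    ∃ (S : Curve m) (f : T.V → S.V), Quotient.mk (Curve.setoid m) S = C ∧ IsContraction T S f := by
  obtain ⟨S, hS, h⟩ := hC
  obtain ⟨f, hf⟩ := contractsTo_iff.1 h
  exact ⟨S, f, hS, hf⟩

theorem Moduli.simpleRatio_mem (hT : T.IsMaximal) (hσ : T.IsPlanar σ) {C : Moduli m}
    (hC : C ∈ Moduli.below T) : Moduli.simpleRatio T σ C ∈ T.balancedStar σ := by
  obtain ⟨S, f, rfl, hf⟩ := Moduli.exists_rep hC
  exact hf.simpleRatio_mem hT hσ

/-- The simple ratio map as a bijection onto the labellings in `X*(T)`. -/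
noncomputable def simpleRatioEquiv (hT : T.IsMaximal) (hσ : T.IsPlanar σ) :
    Moduli.below T ≃ T.balancedStar σ where
  toFun C := ⟨Moduli.simpleRatio T σ C.1, Moduli.simpleRatio_mem hT hσ C.2⟩
  invFun l := ⟨Quotient.mk (Curve.setoid m) (curve hT hσ l.2), curve hT hσ l.2, rfl,
    contractsTo_iff.2 ⟨_, isContraction_curve⟩⟩
  left_inv := by
    rintro ⟨C, hC⟩
    obtain ⟨S, f, rfl, hf⟩ := Moduli.exists_rep hC
    exact Subtype.ext (Quotient.sound ⟨hf.iso hT hσ⟩)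
  right_inv l := Subtype.ext (curve_simpleRatio (hT := hT) (hσ := hσ) (hl := l.2))

theorem isRegularMap_simpleRatioEquiv (hT : T.IsMaximal) (hσ : T.IsPlanar σ) :
    IsRegularMap (fun C : Moduli.below T => Moduli.rho C.1)
      (fun (l : T.balancedStar σ) e => ((l.1 e : ℂ) : P1)) (simpleRatioEquiv hT hσ) := by
  classical
  rintro ⟨C, hC⟩ e
  obtain ⟨b, K, P, h⟩ := exists_simpleRatio_poly hT hσ e
  obtain ⟨S, f, rfl, hf⟩ := Moduli.exists_rep hC
  -- The coordinates in `K`, which control the formula, stay in one fixed chart on the whole domain;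
  -- each other coordinate gets any chart containing its value at the given curve.
  refine ⟨fun k => if k ∈ K then b else decide (S.rho k = ∞), P, 1, fun k => ?_, fun h' => ?_,
    ?_⟩
  · change P1.InChart _ (S.rho k)
    dsimp only
    split_ifs with hk
    · exact (h S f hf).1 k hk
    · by_cases hr : S.rho k = ∞
      · simp [hr, P1.InChart]
      · simp [hr, P1.InChart]
  · rw [map_one] at h'
    exact one_ne_zero h'.2
  · rintro ⟨C', hC'⟩ - -
    obtain ⟨S', f', rfl, hf'⟩ := Moduli.exists_rep hC'
    rw [map_one, P1.mk_one_right]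
    change ((S'.simpleRatio T σ e : ℂ) : P1) = _
    rw [(h S' f' hf').2 _ fun k hk => if_pos hk]
    rfl

/-- Labels are finite, so only the affine chart of `ℂ` is needed. The formulas for the coordinates
are applied to the explicit curves `curve`, whose simple ratios are the given labels. -/
theorem isRegularMap_simpleRatioEquiv_symm (hT : T.IsMaximal) (hσ : T.IsPlanar σ) :
    IsRegularMap (fun (l : T.balancedStar σ) e => ((l.1 e : ℂ) : P1))
      (fun C : Moduli.below T => Moduli.rho C.1) (simpleRatioEquiv hT hσ).symm := by
  intro l k
  have hf : ∀ l : T.balancedStar σ, IsContraction T (curve hT hσ l.2) (toCurve hT hσ l.2) :=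
    fun l => isContraction_curve
  have hl : ∀ l : T.balancedStar σ, (curve hT hσ l.2).simpleRatio T σ = l.1 :=
    fun l => curve_simpleRatio
  rcases k with q | p
  · obtain ⟨P, Q, h0, h⟩ := (hf l).exists_rho4_poly hT hσ q
    rw [hl] at h0
    refine ⟨fun _ => false, P, Q, fun _ => OnePoint.coe_ne_infty _, h0, fun l' _ h1 => ?_⟩
    have h2 := h _ _ (hf l')
    rw [hl] at h2
    exact h2 h1
  · obtain ⟨P, Q, h⟩ := IsContraction.exists_rho2_poly hT hσ p
    have h0 := (h _ _ (hf l)).1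
    rw [hl] at h0
    refine ⟨fun _ => false, P, Q, fun _ => OnePoint.coe_ne_infty _, h0, fun l' _ _ => ?_⟩
    have h2 := (h _ _ (hf l')).2
    rw [hl] at h2
    exact h2

end ScaledLine

theorem mainTheorem9 (m : ℕ) (T : ScaledLine.ColoredTree m) (hT : T.IsMaximal)
    (σ : Equiv.Perm (Fin (m + 1))) (hσ : T.IsPlanar σ) :
    ScaledLine.IsAffineToric T.balanced ∧
    (∃ F : MvPolynomial T.Edge ℂ,
      T.balancedStar σ = {l | l ∈ T.balanced ∧ MvPolynomial.eval l F ≠ 0}) ∧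
    ∃ Φ : ScaledLine.Moduli.below T ≃ T.balancedStar σ,
      (∀ C, (Φ C : T.Edge → ℂ) = ScaledLine.Moduli.simpleRatio T σ C) ∧
      ScaledLine.IsRegularMap (fun C : ScaledLine.Moduli.below T => ScaledLine.Moduli.rho C.1)
        (fun l e => ((l.1 e : ℂ) : ScaledLine.P1)) Φ ∧
      ScaledLine.IsRegularMap (fun l e => ((l.1 e : ℂ) : ScaledLine.P1))
        (fun C : ScaledLine.Moduli.below T => ScaledLine.Moduli.rho C.1) Φ.symm := by
  exact ⟨hT.isAffineToric_balanced, ScaledLine.ColoredTree.balancedStar_eq,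
    ScaledLine.simpleRatioEquiv hT hσ, fun _ => rfl,
    ScaledLine.isRegularMap_simpleRatioEquiv hT hσ,
    ScaledLine.isRegularMap_simpleRatioEquiv_symm hT hσ⟩
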